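/- Let $d\ge 1$ and $M\ge 0$, and write points of $\mathbb{R}^d$ as $x=(x',x_d)$ with $x'\in\mathbb{R}^{d-1}$. Below, $F:\mathbb{R}^{d-1}\to\mathbb{R}$ denotes any $C^{1,1}$ function such that $\nabla F$ is Lipschitz with constant at most $M$ and $|\nabla F|\le \frac1{20}$ everywhere. Write $\hat f(\xi)=\int e^{-i\langle x,\xi\rangle}f(x)\,dx$, and let $\cos(t\sqrt{-\Delta})$ be the Fourier multiplier $\cos(t|\xi|)$ on $L^2(\mathbb{R}^d)$. (1) There is a constant $C$ depending only on $d$ and $M$ such that, for all such $F$, all $r\ge 1$ and all $f\in L^2(\mathbb{R}^d)$ with $\hat f$ supported in $\frac34 r\le|\xi|\le\frac32 r$, the function $(t,x)\mapsto(\cos(t\sqrt{-\Delta})f)(x)$ has a representative that is continuous on $\mathbb{R}\times\mathbb{R}^d$, and its restriction to the graph $x_d=F(x')$ satisfies $$\biggl(\int_0^1\Bigl\|\bigl(\cos(t\sqrt{-\Delta})f\bigr)(x',F(x'))\Bigr\|_{L^2(\mathbb{R}^{d-1},dx')}^4\,dt\biggr)^{\frac14}\le C\,r^{\frac14}\,\|f\|_{L^2(\mathbb{R}^d)}.$$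 (2) For every real-valued $\chi\in C_c^\infty(\mathbb{R}^{d-1})$ supported in the closed unit ball there is a constant $C$ depending only on $d$, $M$ and $\chi$ such that, for all such $F$, all $r\ge 1$ and all $g\in L^2(\mathbb{S}^{d-1}_r)$, the function $Tg(x)=\int_{\mathbb{S}^{d-1}_r}e^{i\langle x,\xi\rangle}g(\xi)\,d\sigma_r(\xi)$, which satisfies $-\Delta Tg=r^2\,Tg$, obeys $$\biggl(\int\bigl|(Tg)(x',F(x'))\bigr|^2\,|\chi(x')|\,dx'\biggr)^{\frac12}\le C\,r^{\frac14}\,\|g\|_{L^2(\mathbb{S}^{d-1}_r)},$$ where $\mathbb{S}^{d-1}_r$ is the sphere of radius $r$ centred at the origin of $\mathbb{R}^d$ and $\sigma_r$ is its surface measure. -/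

import Mathlib

open MeasureTheory FourierTransform
open scoped ENNReal NNReal

noncomputable section

/-- Euclidean space `ℝ^n`. -/
abbrev Eucl (n : ℕ) : Type := EuclideanSpace ℝ (Fin n)

/-- Complex-valued `L²(ℝ^d)`. -/
abbrev L2Eucl (d : ℕ) : Type := Lp (α := Eucl d) ℂ 2 volume

/-- `F : ℝ^n → ℝ` is of class `C^{1,1}`, its gradient having Lipschitz constant at most `M`. -/
structure IsC11With (n : ℕ) (M : ℝ≥0) (F : Eucl n → ℝ) : Prop where
  contDiff : ContDiff ℝ 1 F
  lipschitz_fderiv : LipschitzWith M (fderiv ℝ F)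

/-- The point `(x', F x')` of the graph of `F`; the last coordinate is the vertical one. -/
def graphPoint {n : ℕ} (F : Eucl n → ℝ) (x' : Eucl n) : Eucl (n + 1) :=
  WithLp.toLp 2 (Fin.snoc (α := fun _ => ℝ) (fun i => x' i) (F x'))

theorem memLp_cos_mul {d : ℕ} (t : ℝ) (g : L2Eucl d) :
    MemLp (fun ξ : Eucl d => ((Real.cos (t * (2 * Real.pi * ‖ξ‖)) : ℝ) : ℂ) * g ξ) 2 volume := by
  refine (Lp.memLp g).mono ?_ (Filter.Eventually.of_forall fun ξ => ?_)
  · exact (Continuous.aestronglyMeasurable (by fun_prop)).mul (Lp.aestronglyMeasurable g)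
  · rw [norm_mul, Complex.norm_real]
    exact mul_le_of_le_one_left (norm_nonneg _) (Real.abs_cos_le_one _)

/-- The operator `cos (t √(-Δ))` on `L²(ℝ^d)`. In the normalization of the Fourier transform used
here (phase `e^{-2πi⟨x,ξ⟩}`), `√(-Δ)` is the Fourier multiplier `2π|ξ|`. -/
def cosSqrtNegLaplacian {d : ℕ} (t : ℝ) (f : L2Eucl d) : L2Eucl d :=
  𝓕⁻ ((memLp_cos_mul t (𝓕 f)).toLp _)

/-- The Fourier transform of `f`, as a function of the angular frequency `2πξ`, is supported in
the annulus `3r/4 ≤ |2πξ| ≤ 3r/2`. -/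
def HasFrequencyNear {d : ℕ} (r : ℝ) (f : L2Eucl d) : Prop :=
  ∀ᵐ ξ : Eucl d, (𝓕 f : L2Eucl d) ξ ≠ 0 →
    3 / 4 * r ≤ 2 * Real.pi * ‖ξ‖ ∧ 2 * Real.pi * ‖ξ‖ ≤ 3 / 2 * r

/-- Surface measure `δ(|ξ| - r)` on the sphere of radius `r > 0` about the origin of `ℝ^d`, as a
measure on `ℝ^d`: the dilate of surface measure on the unit sphere, multiplied by `r^(d-1)`. -/
def sphereMeasure (d : ℕ) (r : ℝ) : Measure (Eucl d) :=
  ENNReal.ofReal (r ^ (d - 1)) •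
    ((volume : Measure (Eucl d)).toSphere).map
      (fun ω : Metric.sphere (0 : Eucl d) 1 => r • (ω : Eucl d))

/-- `T g (x) = ∫ e^{i⟨x,ξ⟩} g(ξ) δ(|ξ| - r)`, a solution of `-Δ (T g) = r² T g`. -/
def sphereExtension {d : ℕ} (r : ℝ) (g : Eucl d → ℂ) (x : Eucl d) : ℂ :=
  ∫ ξ, Complex.exp (Complex.I * ((inner ℝ x ξ : ℝ) : ℂ)) * g ξ ∂(sphereMeasure d r)

end

/-! Both estimates come from one dual inequality. Let `T` send a frequency profile to the half-wave
`e^{it√-Δ}` restricted to the graph. Then `T T*` is an integral operator in time, whose kernel at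
time difference `t`, localized to frequencies of size `ϱ`, is the bilinear form `waveForm ϱ t`. The
heart of the matter is the fixed time bound `exists_waveForm_le`: this form has norm at most `C
(ϱ/|t|)^{1/2}` on `L²` of the graph. Since `|t|^{-1/2}` is the kernel of a fractional integration
taking `L^{4/3}` to `L^4`, `T T*` costs `ϱ^{1/2}` and `T` costs `ϱ^{1/4}`
(`exists_lintegral_waveSum_sq_le`).

For the fixed time bound, lengths are rescaled by `h = √(|t|/ϱ)`, so that frequency and time both
have size `Λ = √(ϱ|t|)`, and the rescaled graph deviates from its tangent planes by `O(1/Λ)` on unit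
balls. If `Λ < 1`, Plancherel in the horizontal variables suffices. Otherwise the measures are
decomposed into unit phase space cells `(c, μ)`. Over a unit frequency cell the phase `Λ|ζ|` is
linear up to a bounded smooth error, so the propagator moves a cell by `Λ` in the direction of its
frequency, with rapidly decaying tails (`exists_coneIntegral_decay`). Schur's test reduces the bound
to the `L²` norm of the coefficients, weighted by how close the transported cell lands to the graph.

There are `n+1` frequency variables but only `n` variables on the graph, so the coefficients do not
decay transversally to the tangent plane, and the weight must be integrable in that direction. It
is: if the frequency is steep, the transported point misses the graph by a multiple of `Λ` because
the graph has slope at most `1/20`; if it is nearly horizontal, changing the transversal frequency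
changes the landing height at a definite rate (`abs_flowHeight_sub_ge`). The weighted Plancherel
estimate then applies to the nearly flat pieces.

Part (1) follows by duality, testing the dual inequality on the solution itself weighted by its
energy. For part (2), a time-independent density modulated by `e^{2πitϱ}` turns the dual inequality
into an `L²` bound for the Fourier transform of a measure on the graph over a shell of constant
thickness. A Sobolev inequality along rays passes to the sphere, and a second duality gives the
extension operator. -/

noncomputable section

/-! ### The character `e^{2πix}` -/

/-- `ec x = e^{2πix}`. -/
def ec (x : ℝ) : ℂ := Complex.exp (((2 * Real.pi * x : ℝ) : ℂ) * Complex.I)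

@[simp] theorem ec_zero : ec 0 = 1 := by simp [ec]

theorem ec_add (x y : ℝ) : ec (x + y) = ec x * ec y := by
  rw [ec, ec, ec, ← Complex.exp_add]; congr 1; push_cast; ring

@[simp] theorem norm_ec (x : ℝ) : ‖ec x‖ = 1 := Complex.norm_exp_ofReal_mul_I _

@[simp] theorem enorm_ec (x : ℝ) : ‖ec x‖ₑ = 1 := by
  rw [← ofReal_norm, norm_ec, ENNReal.ofReal_one]

theorem conj_ec (x : ℝ) : (starRingEnd ℂ) (ec x) = ec (-x) := by
  rw [ec, ec, ← Complex.exp_conj]; congr 1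
  rw [map_mul, Complex.conj_ofReal, Complex.conj_I]; push_cast; ring

theorem contDiff_ec {m : WithTop ℕ∞} : ContDiff ℝ m ec := by
  unfold ec
  exact ((Complex.ofRealCLM.contDiff.comp (contDiff_const.mul contDiff_id)).mul
    contDiff_const).cexp

@[fun_prop] theorem continuous_ec : Continuous ec := (contDiff_ec (m := 0)).continuous

@[fun_prop] theorem measurable_ec : Measurable ec := continuous_ec.measurable

theorem hasDerivAt_ec (x : ℝ) : HasDerivAt ec (2 * Real.pi * Complex.I * ec x) x := by
  have h : HasDerivAt (fun y : ℝ => ((2 * Real.pi * y : ℝ) : ℂ) * Complex.I)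
      (((2 * Real.pi * 1 : ℝ) : ℂ) * Complex.I) x :=
    (((hasDerivAt_id x).const_mul (2 * Real.pi)).ofReal_comp).mul_const _
  refine HasDerivAt.congr_deriv (f := ec) h.cexp ?_
  unfold ec; push_cast; ring

theorem fourier_eq_ec {n : ℕ} (f : Eucl n → ℂ) (w : Eucl n) :
    𝓕 f w = ∫ v, ec (-inner ℝ v w) * f v := by
  rw [Real.fourier_eq']
  refine integral_congr_ae (Filter.Eventually.of_forall fun v => ?_)
  change Complex.exp _ * f v = Complex.exp _ * f v
  congr 3; push_cast; ring

theorem fourierInv_eq_ec {n : ℕ} (f : Eucl n → ℂ) (w : Eucl n) :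
    𝓕⁻ f w = ∫ v, ec (inner ℝ v w) * f v := by
  rw [Real.fourierInv_eq']
  refine integral_congr_ae (Filter.Eventually.of_forall fun v => ?_)
  simp only [ec, smul_eq_mul]

/-! ### The Fourier transform on `L¹ ∩ L²` -/

theorem integral_fourier_mul_eq {n : ℕ} {f g : Eucl n → ℂ} (hf : Integrable f)
    (hg : Integrable g) : ∫ ξ, 𝓕 f ξ * g ξ = ∫ x, f x * 𝓕 g x := by
  have := VectorFourier.integral_fourierIntegral_smul_eq_flip (μ := (volume : Measure (Eucl n)))
    (ν := (volume : Measure (Eucl n))) (L := innerₗ (Eucl n)) (f := f) (g := g)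
    Real.continuous_fourierChar (by simp only [innerₗ_apply_apply]; fun_prop) hf hg
  simp only [smul_eq_mul, flip_innerₗ] at this
  exact this

theorem integral_fourierInv_mul_eq {n : ℕ} {f g : Eucl n → ℂ} (hf : Integrable f)
    (hg : Integrable g) : ∫ ξ, 𝓕⁻ f ξ * g ξ = ∫ x, f x * 𝓕⁻ g x := by
  have h1 : ∀ (h : Eucl n → ℂ) w, 𝓕⁻ h w = 𝓕 (fun x => h (-x)) w := fun h w => by
    rw [fourierInv_eq_ec, fourier_eq_ec, ← integral_neg_eq_self]; simp
  have h2 : ∀ (h : Eucl n → ℂ) w, 𝓕⁻ h w = 𝓕 h (-w) := fun h w => by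
    rw [fourierInv_eq_ec, fourier_eq_ec]; simp
  simp_rw [h1 f]
  rw [integral_fourier_mul_eq hf.comp_neg hg, ← integral_neg_eq_self]
  simp_rw [h2 g, neg_neg]

/-- The `L²` transform is defined by extension and the other side by an integral. Both are tested
against smooth compactly supported functions: tempered distributions move the first transform onto
the test function, and Fubini moves the second. -/
theorem fourierInv_toLp_ae_eq {n : ℕ} {f : Eucl n → ℂ} (hf : Integrable f)
    (hf2 : MemLp f 2 volume) : (𝓕⁻ (hf2.toLp f) : L2Eucl n) =ᵐ[volume] 𝓕⁻ f := by
  have hc : Continuous (𝓕⁻ f) :=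
    VectorFourier.fourierIntegral_continuous (μ := (volume : Measure (Eucl n)))
      (L := -innerₗ (Eucl n)) Real.continuous_fourierChar
      (by simp only [LinearMap.neg_apply, innerₗ_apply_apply]; fun_prop) hf
  refine ae_eq_of_integral_contDiff_smul_eq ((Lp.memLp _).locallyIntegrable (by norm_num))
    hc.locallyIntegrable fun g hg hgs => ?_
  let g' : SchwartzMap (Eucl n) ℂ := HasCompactSupport.toSchwartzMap
    (f := fun x => (g x : ℂ)) (hgs.comp_left (g := fun x : ℝ => (x : ℂ)) (by simp))
    (Complex.ofRealCLM.contDiff.comp hg)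
  have h1 := congrArg (fun T : TemperedDistribution (Eucl n) ℂ => T g')
    (Lp.fourierInv_toTemperedDistribution_eq (hf2.toLp f))
  simp only [TemperedDistribution.fourierInv_apply, Lp.toTemperedDistribution_apply] at h1
  have hg' : ∀ x, g' x = (g x : ℂ) := fun x => rfl
  have e1 : ∫ x, g x • (𝓕⁻ (hf2.toLp f) : L2Eucl n) x =
      ∫ x, g' x • (𝓕⁻ (hf2.toLp f) : L2Eucl n) x := by simp [hg']
  rw [e1, ← h1]
  have e2 : ∫ x, (𝓕⁻ g') x • (hf2.toLp f) x = ∫ x, f x * 𝓕⁻ (fun x => (g x : ℂ)) x := by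
    refine integral_congr_ae ?_
    filter_upwards [hf2.coeFn_toLp] with x hx
    rw [hx, smul_eq_mul, mul_comm, SchwartzMap.fourierInv_coe]; rfl
  rw [e2, ← integral_fourierInv_mul_eq hf (g := fun x => (g x : ℂ)) g'.integrable]
  exact integral_congr_ae (Filter.Eventually.of_forall fun x => by simp [mul_comm])

theorem fourier_toLp_ae_eq {n : ℕ} {f : Eucl n → ℂ} (hf : Integrable f)
    (hf2 : MemLp f 2 volume) : (𝓕 (hf2.toLp f) : L2Eucl n) =ᵐ[volume] 𝓕 f := by
  have hc : Continuous (𝓕 f) :=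
    VectorFourier.fourierIntegral_continuous (μ := (volume : Measure (Eucl n)))
      (L := innerₗ (Eucl n)) Real.continuous_fourierChar
      (by simp only [innerₗ_apply_apply]; fun_prop) hf
  refine ae_eq_of_integral_contDiff_smul_eq ((Lp.memLp _).locallyIntegrable (by norm_num))
    hc.locallyIntegrable fun g hg hgs => ?_
  let g' : SchwartzMap (Eucl n) ℂ := HasCompactSupport.toSchwartzMap
    (f := fun x => (g x : ℂ)) (hgs.comp_left (g := fun x : ℝ => (x : ℂ)) (by simp))
    (Complex.ofRealCLM.contDiff.comp hg)
  have h1 := congrArg (fun T : TemperedDistribution (Eucl n) ℂ => T g')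
    (Lp.fourier_toTemperedDistribution_eq (hf2.toLp f))
  simp only [TemperedDistribution.fourier_apply, Lp.toTemperedDistribution_apply] at h1
  have hg' : ∀ x, g' x = (g x : ℂ) := fun x => rfl
  have e1 : ∫ x, g x • (𝓕 (hf2.toLp f) : L2Eucl n) x =
      ∫ x, g' x • (𝓕 (hf2.toLp f) : L2Eucl n) x := by simp [hg']
  rw [e1, ← h1]
  have e2 : ∫ x, (𝓕 g') x • (hf2.toLp f) x = ∫ x, f x * 𝓕 (fun x => (g x : ℂ)) x := by
    refine integral_congr_ae ?_
    filter_upwards [hf2.coeFn_toLp] with x hx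
    rw [hx, smul_eq_mul, mul_comm, SchwartzMap.fourier_coe]; rfl
  rw [e2, ← integral_fourier_mul_eq hf (g := fun x => (g x : ℂ)) g'.integrable]
  exact integral_congr_ae (Filter.Eventually.of_forall fun x => by simp [mul_comm])

theorem eLpNorm_two_sq {α F : Type*} [MeasurableSpace α] [NormedAddCommGroup F] (f : α → F)
    (μ : Measure α) : eLpNorm f 2 μ ^ 2 = ∫⁻ x, ‖f x‖ₑ ^ 2 ∂μ := by
  rw [eLpNorm_eq_lintegral_rpow_enorm_toReal (by norm_num) (by norm_num), ← ENNReal.rpow_natCast,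
    ← ENNReal.rpow_mul]
  norm_num

theorem lintegral_fourier_sq {n : ℕ} {f : Eucl n → ℂ} (hf : Integrable f)
    (hf2 : MemLp f 2 volume) : ∫⁻ ξ, ‖𝓕 f ξ‖ₑ ^ 2 = ∫⁻ x, ‖f x‖ₑ ^ 2 := by
  have h := Lp.norm_fourier_eq (hf2.toLp f)
  rw [Lp.norm_def, Lp.norm_def, ENNReal.toReal_eq_toReal_iff' (Lp.eLpNorm_ne_top _)
    (Lp.eLpNorm_ne_top _), eLpNorm_congr_ae (fourier_toLp_ae_eq hf hf2),
    eLpNorm_congr_ae hf2.coeFn_toLp] at h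
  rw [← eLpNorm_two_sq, ← eLpNorm_two_sq, h]

/-! ### Horizontal and vertical coordinates -/

/-- The horizontal component of a point of `ℝ^(n+1)`. -/
def hor {n : ℕ} (ζ : Eucl (n + 1)) : Eucl n := WithLp.toLp 2 fun i => ζ i.castSucc

/-- The vertical component of a point of `ℝ^(n+1)`. -/
def ver {n : ℕ} (ζ : Eucl (n + 1)) : ℝ := ζ (Fin.last n)

/-- The point with given horizontal and vertical components. -/
def join {n : ℕ} (ω : Eucl n) (τ : ℝ) : Eucl (n + 1) :=
  WithLp.toLp 2 (Fin.snoc (α := fun _ => ℝ) (fun i => ω i) τ)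

theorem graphPoint_eq_join {n : ℕ} (F : Eucl n → ℝ) (x : Eucl n) :
    graphPoint F x = join x (F x) := rfl

@[simp] theorem hor_join {n : ℕ} (ω : Eucl n) (τ : ℝ) : hor (join ω τ) = ω := by
  ext i; simp [hor, join]

@[simp] theorem ver_join {n : ℕ} (ω : Eucl n) (τ : ℝ) : ver (join ω τ) = τ := by
  simp [ver, join]

theorem inner_eq_hor_ver {n : ℕ} (x y : Eucl (n + 1)) :
    inner ℝ x y = inner ℝ (hor x) (hor y) + ver x * ver y := by
  simp [PiLp.inner_apply, Fin.sum_univ_castSucc, hor, ver, mul_comm]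

theorem norm_sq_eq_hor_ver {n : ℕ} (x : Eucl (n + 1)) : ‖x‖ ^ 2 = ‖hor x‖ ^ 2 + ver x ^ 2 := by
  rw [← real_inner_self_eq_norm_sq, inner_eq_hor_ver, real_inner_self_eq_norm_sq]; ring

theorem norm_hor_le {n : ℕ} (x : Eucl (n + 1)) : ‖hor x‖ ≤ ‖x‖ :=
  le_of_sq_le_sq (by rw [norm_sq_eq_hor_ver x]; nlinarith [sq_nonneg (ver x)]) (norm_nonneg _)

theorem abs_ver_le {n : ℕ} (x : Eucl (n + 1)) : |ver x| ≤ ‖x‖ :=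
  abs_le_of_sq_le_sq (by rw [norm_sq_eq_hor_ver x]; nlinarith [sq_nonneg ‖hor x‖]) (norm_nonneg _)

theorem norm_le_hor_add_ver {n : ℕ} (x : Eucl (n + 1)) : ‖x‖ ≤ ‖hor x‖ + |ver x| :=
  le_of_sq_le_sq (by
    rw [norm_sq_eq_hor_ver x, ← sq_abs (ver x)]
    nlinarith [mul_nonneg (norm_nonneg (hor x)) (abs_nonneg (ver x))]) (by positivity)

@[simp] theorem hor_add {n : ℕ} (x y : Eucl (n + 1)) : hor (x + y) = hor x + hor y := by
  ext i; simp [hor]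
@[simp] theorem hor_sub {n : ℕ} (x y : Eucl (n + 1)) : hor (x - y) = hor x - hor y := by
  ext i; simp [hor]
@[simp] theorem hor_smul {n : ℕ} (a : ℝ) (x : Eucl (n + 1)) : hor (a • x) = a • hor x := by
  ext i; simp [hor]
@[simp] theorem ver_add {n : ℕ} (x y : Eucl (n + 1)) : ver (x + y) = ver x + ver y := by
  simp [ver]
@[simp] theorem ver_sub {n : ℕ} (x y : Eucl (n + 1)) : ver (x - y) = ver x - ver y := by
  simp [ver]
@[simp] theorem ver_smul {n : ℕ} (a : ℝ) (x : Eucl (n + 1)) : ver (a • x) = a * ver x := by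
  simp [ver]

@[fun_prop] theorem continuous_hor {n : ℕ} : Continuous (hor (n := n)) :=
  (PiLp.continuous_toLp 2 _).comp (continuous_pi fun i => by fun_prop)

@[fun_prop] theorem continuous_ver {n : ℕ} : Continuous (ver (n := n)) := by
  unfold ver; fun_prop

theorem continuous_join {n : ℕ} : Continuous fun p : Eucl n × ℝ => join p.1 p.2 := by
  refine (PiLp.continuous_toLp 2 _).comp (continuous_pi fun i => ?_)
  refine Fin.lastCases ?_ (fun j => ?_) i
  · simpa using continuous_snd
  · simp only [Fin.snoc_castSucc]; fun_prop

@[fun_prop] theorem Continuous.join {X : Type*} [TopologicalSpace X] {n : ℕ} {f : X → Eucl n}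
    {g : X → ℝ} (hf : Continuous f) (hg : Continuous g) : Continuous fun x => join (f x) (g x) :=
  continuous_join.comp (hf.prodMk hg)

theorem measurePreserving_join {n : ℕ} :
    MeasurePreserving (fun p : ℝ × Eucl n => join p.2 p.1) (volume.prod volume) volume := by
  have h1 := (PiLp.volume_preserving_ofLp (Fin n))
  have h2 := (volume_preserving_piFinSuccAbove (fun _ : Fin (n + 1) => ℝ) (Fin.last n)).symm
  have h3 := (PiLp.volume_preserving_toLp (Fin (n + 1)))
  have h := h3.comp (h2.comp ((MeasurePreserving.id (volume : Measure ℝ)).prod h1))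
  have e : (fun p : ℝ × Eucl n => join p.2 p.1) =
      WithLp.toLp 2 ∘ ⇑(MeasurableEquiv.piFinSuccAbove (fun _ : Fin (n + 1) => ℝ)
        (Fin.last n)).symm ∘ Prod.map id WithLp.ofLp := by
    funext p
    simp only [Function.comp_def, join, Prod.map]
    congr 1
    ext i
    refine Fin.lastCases ?_ (fun j => ?_) i <;> simp [MeasurableEquiv.piFinSuccAbove]
  rw [e]
  exact h

theorem lintegral_eq_lintegral_join {n : ℕ} {f : Eucl (n + 1) → ℝ≥0∞} (hf : Measurable f) :
    ∫⁻ ζ, f ζ = ∫⁻ τ : ℝ, ∫⁻ ω : Eucl n, f (join ω τ) := by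
  rw [← measurePreserving_join.lintegral_comp hf]
  exact lintegral_prod _ (hf.comp measurePreserving_join.measurable).aemeasurable

/-! ### Cauchy–Schwarz for the lower Lebesgue integral -/

theorem sq_lintegral_mul_le {α : Type*} [MeasurableSpace α] {μ : Measure α} {f g : α → ℝ≥0∞}
    (hf : AEMeasurable f μ) (hg : AEMeasurable g μ) :
    (∫⁻ x, f x * g x ∂μ) ^ 2 ≤ (∫⁻ x, f x ^ 2 ∂μ) * ∫⁻ x, g x ^ 2 ∂μ := by
  have h := ENNReal.lintegral_mul_le_Lp_mul_Lq μ Real.HolderConjugate.two_two hf hg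
  calc (∫⁻ x, f x * g x ∂μ) ^ 2
      ≤ ((∫⁻ x, f x ^ (2 : ℝ) ∂μ) ^ (1 / (2 : ℝ)) * (∫⁻ x, g x ^ (2 : ℝ) ∂μ) ^ (1 / (2 : ℝ))) ^ 2 :=
        pow_le_pow_left' h 2
    _ = _ := by
        rw [mul_pow, ← ENNReal.rpow_natCast, ← ENNReal.rpow_natCast, ← ENNReal.rpow_mul,
          ← ENNReal.rpow_mul]
        norm_num

theorem sq_lintegral_le {α : Type*} [MeasurableSpace α] {μ : Measure α} {f : α → ℝ≥0∞}
    (hf : AEMeasurable f μ) : (∫⁻ x, f x ∂μ) ^ 2 ≤ μ Set.univ * ∫⁻ x, f x ^ 2 ∂μ := by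
  simpa using sq_lintegral_mul_le (f := fun _ => 1) aemeasurable_const hf

theorem ENNReal.add_sq_le (a b : ℝ≥0∞) : (a + b) ^ 2 ≤ 2 * a ^ 2 + 2 * b ^ 2 := by
  have h := ENNReal.rpow_add_le_mul_rpow_add_rpow a b (p := 2) one_le_two
  norm_num at h
  rw [← mul_add]; exact_mod_cast h

/-! ### Bounded functions of bounded support -/

/-- Bounded measurable functions of bounded support. -/
structure BddSupp {n : ℕ} (f : Eucl n → ℂ) : Prop where
  meas : Measurable f
  bdd : ∃ B : ℝ, ∀ y, ‖f y‖ ≤ B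
  supp : ∃ R : ℝ, ∀ y, R < ‖y‖ → f y = 0

theorem BddSupp.memLp {n : ℕ} {f : Eucl n → ℂ} (hf : BddSupp f) (p : ℝ≥0∞) :
    MemLp f p volume := by
  obtain ⟨B, hB⟩ := hf.bdd
  obtain ⟨R, hR⟩ := hf.supp
  have e : f = (Metric.closedBall 0 R).indicator f := by
    ext y
    by_cases h : ‖y‖ ≤ R
    · rw [Set.indicator_of_mem (by simpa using h)]
    · rw [Set.indicator_of_notMem (by simpa using h), hR y (not_le.1 h)]
  rw [e, memLp_indicator_iff_restrict measurableSet_closedBall]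
  have : IsFiniteMeasure (volume.restrict (Metric.closedBall (0 : Eucl n) R)) :=
    ⟨by simpa using measure_closedBall_lt_top⟩
  exact MemLp.of_bound hf.meas.aestronglyMeasurable B (Filter.Eventually.of_forall hB)

theorem BddSupp.integrable {n : ℕ} {f : Eucl n → ℂ} (hf : BddSupp f) : Integrable f :=
  memLp_one_iff_integrable.1 (hf.memLp 1)

theorem BddSupp.mul {n : ℕ} {f g : Eucl n → ℂ} (hf : BddSupp f) (hg : Measurable g)
    {b : ℝ} (hb : ∀ y, f y ≠ 0 → ‖g y‖ ≤ b) : BddSupp fun y => g y * f y := by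
  obtain ⟨B, hB⟩ := hf.bdd
  obtain ⟨R, hR⟩ := hf.supp
  refine ⟨hg.mul hf.meas, ⟨max 0 (b * B), fun y => ?_⟩, R, fun y hy => by rw [hR y hy, mul_zero]⟩
  by_cases h : f y = 0
  · simp [h]
  · rw [norm_mul]
    exact (mul_le_mul (hb y h) (hB y) (norm_nonneg _) ((norm_nonneg _).trans (hb y h))).trans
      (le_max_right _ _)

theorem BddSupp.ec_mul {n : ℕ} {f : Eucl n → ℂ} (hf : BddSupp f) {θ : Eucl n → ℝ}
    (hθ : Measurable θ) : BddSupp fun y => ec (θ y) * f y :=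
  hf.mul (measurable_ec.comp hθ) (b := 1) fun y _ => by simp

theorem BddSupp.lintegral_sq_lt_top {n : ℕ} {f : Eucl n → ℂ} (hf : BddSupp f) :
    ∫⁻ y, ‖f y‖ₑ ^ 2 < ∞ := by
  rw [← eLpNorm_two_sq]
  exact ENNReal.pow_lt_top (hf.memLp 2).eLpNorm_lt_top

theorem BddSupp.lintegral_fourier_sq {n : ℕ} {f : Eucl n → ℂ} (hf : BddSupp f) :
    ∫⁻ ξ, ‖𝓕 f ξ‖ₑ ^ 2 = ∫⁻ x, ‖f x‖ₑ ^ 2 :=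
  _root_.lintegral_fourier_sq hf.integrable (hf.memLp 2)

theorem lintegral_ec_mul_sq {n : ℕ} (f : Eucl n → ℂ) (θ : Eucl n → ℝ) :
    ∫⁻ y, ‖ec (θ y) * f y‖ₑ ^ 2 = ∫⁻ y, ‖f y‖ₑ ^ 2 := by simp [enorm_mul]

/-- Continuity of oscillatory integrals in a parameter. -/
theorem continuous_integral_ec_mul {X : Type*} [TopologicalSpace X] [FirstCountableTopology X]
    {α : Type*} [MeasurableSpace α] {μ : Measure α} {f : α → ℂ} (hf : Integrable f μ)
    {θ : α → X → ℝ} (h1 : ∀ p, Measurable fun y => θ y p) (h2 : ∀ y, Continuous (θ y)) :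
    Continuous fun p => ∫ y, ec (θ y p) * f y ∂μ := by
  refine continuous_of_dominated (bound := fun y => ‖f y‖) (fun p => ?_) (fun p => ?_) hf.norm ?_
  · exact (measurable_ec.comp (h1 p)).aestronglyMeasurable.mul hf.1
  · exact Filter.Eventually.of_forall fun y => by simp
  · exact Filter.Eventually.of_forall fun y => (continuous_ec.comp (h2 y)).mul continuous_const

/-! ### The Fourier transform of a measure on a graph -/

/-- The Fourier transform of the measure `f(x') dx'` carried by the graph of `G`. -/
def gHat {n : ℕ} (G : Eucl n → ℝ) (f : Eucl n → ℂ) (ζ : Eucl (n + 1)) : ℂ :=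
  ∫ y, ec (-inner ℝ (graphPoint G y) ζ) * f y

theorem inner_graphPoint {n : ℕ} (G : Eucl n → ℝ) (y : Eucl n) (ζ : Eucl (n + 1)) :
    inner ℝ (graphPoint G y) ζ = inner ℝ y (hor ζ) + G y * ver ζ := by
  rw [inner_eq_hor_ver, graphPoint_eq_join, hor_join, ver_join]

theorem measurable_graphPoint {n : ℕ} {G : Eucl n → ℝ} (hG : Measurable G) :
    Measurable (graphPoint G) :=
  continuous_join.measurable.comp (measurable_id.prodMk hG)

theorem continuous_gHat {n : ℕ} {G : Eucl n → ℝ} (hG : Measurable G) {f : Eucl n → ℂ}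
    (hf : Integrable f) : Continuous (gHat G f) :=
  continuous_integral_ec_mul hf
    (fun p => ((measurable_graphPoint hG).inner measurable_const).neg) (fun y => by fun_prop)

theorem norm_gHat_le {n : ℕ} (G : Eucl n → ℝ) (f : Eucl n → ℂ) (ζ : Eucl (n + 1)) :
    ‖gHat G f ζ‖ ≤ ∫ y, ‖f y‖ :=
  (norm_integral_le_integral_norm _).trans_eq (by simp)

theorem gHat_join {n : ℕ} (G : Eucl n → ℝ) (f : Eucl n → ℂ) (ω : Eucl n) (τ : ℝ) :
    gHat G f (join ω τ) = 𝓕 (fun y => ec (-(G y * τ)) * f y) ω := by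
  rw [gHat, fourier_eq_ec]
  congr 1; ext y
  rw [inner_graphPoint, hor_join, ver_join, neg_add, ec_add, mul_assoc]

/-- At a fixed vertical frequency, `gHat` is the `n`-dimensional Fourier transform of a unimodular
multiple of `f`. Plancherel bounds each such slice by the norm of `f`, and there is a length `2L` of
slices. -/
theorem lintegral_gHat_sq_le {n : ℕ} {G : Eucl n → ℝ} (hG : Measurable G) {f : Eucl n → ℂ}
    (hf : BddSupp f) (L : ℝ) :
    ∫⁻ ζ in {ζ | |ver ζ| ≤ L}, ‖gHat G f ζ‖ₑ ^ 2 ≤ ENNReal.ofReal (2 * L) * ∫⁻ y, ‖f y‖ₑ ^ 2 := by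
  have hm : MeasurableSet {ζ : Eucl (n + 1) | |ver ζ| ≤ L} :=
    measurableSet_le (by fun_prop) measurable_const
  have hg := (continuous_gHat hG hf.integrable).measurable
  rw [← lintegral_indicator hm, lintegral_eq_lintegral_join
    ((hg.enorm.pow_const 2).indicator hm)]
  have : ∀ τ : ℝ, ∫⁻ ω : Eucl n, {ζ : Eucl (n + 1) | |ver ζ| ≤ L}.indicator
      (fun ζ => ‖gHat G f ζ‖ₑ ^ 2) (join ω τ) =
      (Set.Icc (-L) L).indicator (fun _ => ∫⁻ y, ‖f y‖ₑ ^ 2) τ := fun τ => by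
    by_cases h : |τ| ≤ L
    · rw [Set.indicator_of_mem (show τ ∈ Set.Icc (-L) L from abs_le.1 h)]
      simp_rw [Set.indicator, Set.mem_ofPred_eq, ver_join, if_pos h, gHat_join]
      rw [(hf.ec_mul (θ := fun y => -(G y * τ)) (hG.mul_const τ).neg).lintegral_fourier_sq, lintegral_ec_mul_sq]
    · rw [Set.indicator_of_notMem (show τ ∉ Set.Icc (-L) L from fun h' => h (abs_le.2 h'))]
      simp_rw [Set.indicator, Set.mem_ofPred_eq, ver_join, if_neg h]
      simp
  simp_rw [this]
  rw [lintegral_indicator measurableSet_Icc, setLIntegral_const, Real.volume_Icc, mul_comm]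
  apply le_of_eq; congr 2; ring

/-! ### A weighted Plancherel estimate for nearly flat graphs -/

theorem ec_sub_one_eq_integral (a τ : ℝ) :
    ec (-(τ * a)) - 1 = ∫ σ in (0 : ℝ)..τ, ec (-(σ * a)) * (-(2 * Real.pi * a) * Complex.I) := by
  have h : ∀ σ : ℝ, HasDerivAt (fun σ => ec (-(σ * a)))
      (ec (-(σ * a)) * (-(2 * Real.pi * a) * Complex.I)) σ := fun σ => by
    have h1 : HasDerivAt (fun σ : ℝ => -(σ * a)) (-(1 * a)) σ :=
      ((hasDerivAt_id σ).mul_const a).neg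
    refine ((hasDerivAt_ec (-(σ * a))).scomp σ h1).congr_deriv ?_
    rw [Complex.real_smul]; push_cast; ring
  rw [intervalIntegral.integral_eq_sub_of_hasDerivAt (fun σ _ => h σ)
    (Continuous.intervalIntegrable (by fun_prop) _ _)]
  simp

/-- A Sobolev embedding in `τ`: the supremum over `τ` is controlled by the value at `0` and the
`τ`-derivative, and each derivative costs only a factor `2πb`. The resulting majorant is independent
of `τ`, and its constant depends only on the product `T b`. -/
theorem fourier_ec_sup_sq_le {n : ℕ} {f : Eucl n → ℂ} (hf : BddSupp f) {ρ : Eucl n → ℝ}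
    (hρ : Measurable ρ) {b T : ℝ} (hb0 : 0 ≤ b)
    (hb : ∀ y, f y ≠ 0 → |ρ y| ≤ b) (hT : 0 ≤ T) :
    ∃ S : Eucl n → ℝ≥0∞, Measurable S ∧
      (∀ ω, ∀ τ ∈ Set.Icc (-T) T, ‖𝓕 (fun y => ec (-(τ * ρ y)) * f y) ω‖ₑ ^ 2 ≤ S ω) ∧
      ∫⁻ ω, S ω ≤ ENNReal.ofReal (2 + 8 * (2 * Real.pi * T * b) ^ 2) * ∫⁻ y, ‖f y‖ₑ ^ 2 := by
  set f1 : Eucl n → ℂ := fun y => (-(2 * Real.pi * ρ y) * Complex.I) * f y with hf1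
  have hn1 : ∀ y, f y ≠ 0 → ‖-(2 * Real.pi * ρ y : ℂ) * Complex.I‖ ≤ 2 * Real.pi * b :=
    fun y hy => by
    rw [norm_mul, norm_neg, Complex.norm_I, mul_one, norm_mul, norm_mul, Complex.norm_real,
      Complex.norm_real, Real.norm_eq_abs, Real.norm_eq_abs, abs_of_pos Real.pi_pos]
    simpa using mul_le_mul_of_nonneg_left (hb y hy) (by positivity : 0 ≤ 2 * Real.pi)
  have hf1' : BddSupp f1 := hf.mul (by fun_prop) hn1
  set E1 : ℝ → Eucl n → ℂ := fun σ ω => 𝓕 (fun y => ec (-(σ * ρ y)) * f1 y) ω with hE1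
  have hE1c : Continuous (Function.uncurry E1) := by
    have : Function.uncurry E1 = fun p : ℝ × Eucl n =>
        ∫ y, ec (-inner ℝ y p.2 + -(p.1 * ρ y)) * f1 y := by
      ext p
      simp only [Function.uncurry, hE1, fourier_eq_ec, ec_add, mul_assoc]
    rw [this]
    exact continuous_integral_ec_mul hf1'.integrable (fun p => by fun_prop) (fun y => by fun_prop)
  have key : ∀ ω τ, 𝓕 (fun y => ec (-(τ * ρ y)) * f y) ω =
      𝓕 f ω + ∫ σ in (0 : ℝ)..τ, E1 σ ω := fun ω τ => by
    simp only [hE1, fourier_eq_ec]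
    rw [intervalIntegral_integral_swap, ← integral_add]
    · congr 1; ext y
      have h1 : ∀ σ : ℝ, ec (-inner ℝ y ω) * (ec (-(σ * ρ y)) * f1 y) =
          (ec (-inner ℝ y ω) * f y) *
            (ec (-(σ * ρ y)) * (-(2 * Real.pi * ρ y) * Complex.I)) := fun σ => by
        simp only [hf1]; ring
      simp_rw [h1]
      rw [intervalIntegral.integral_const_mul, ← ec_sub_one_eq_integral]; ring
    · exact (hf.ec_mul (θ := fun y => -inner ℝ y ω) (by fun_prop)).integrable
    · have h1 : ∀ y, ∫ σ in (0 : ℝ)..τ, ec (-inner ℝ y ω) * (ec (-(σ * ρ y)) * f1 y) =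
          (ec (-(τ * ρ y)) - 1) * (ec (-inner ℝ y ω) * f y) := fun y => by
        have h1 : ∀ σ : ℝ, ec (-inner ℝ y ω) * (ec (-(σ * ρ y)) * f1 y) =
          (ec (-inner ℝ y ω) * f y) *
            (ec (-(σ * ρ y)) * (-(2 * Real.pi * ρ y) * Complex.I)) := fun σ => by
          simp only [hf1]; ring
        simp_rw [h1]
        rw [intervalIntegral.integral_const_mul, ← ec_sub_one_eq_integral]; ring
      simp_rw [h1]
      refine (((hf.ec_mul (θ := fun y => -inner ℝ y ω) (by fun_prop)).mul
        (g := fun y => ec (-(τ * ρ y)) - 1) (by fun_prop) (b := 2) fun y _ => ?_)).integrable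
      exact (norm_sub_le _ _).trans (by simp; norm_num)
    · have h2 : Integrable (fun p : ℝ × Eucl n => (1 : ℝ) * ‖f1 p.2‖)
          ((volume.restrict (Set.uIoc 0 τ)).prod volume) := by
        have : IsFiniteMeasure ((volume : Measure ℝ).restrict (Set.uIoc 0 τ)) :=
          ⟨by simp [Set.uIoc]⟩
        exact (integrable_const (1 : ℝ)).mul_prod hf1'.integrable.norm
      refine h2.mono' (Measurable.aestronglyMeasurable ?_) (Filter.Eventually.of_forall fun p => ?_)
      · have := hf1'.meas
        simp only [Function.uncurry_def]
        fun_prop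
      · simp [Function.uncurry]
  have hEm := hE1c.measurable
  have hE1m : Measurable fun p : Eucl n × ℝ => ‖E1 p.2 p.1‖ₑ ^ 2 :=
    ((hEm.comp measurable_swap).enorm.pow_const 2)
  have hf0 : Continuous (𝓕 f) := by
    have : 𝓕 f = fun ω => ∫ y, ec (-inner ℝ y ω) * f y := funext fun ω => fourier_eq_ec f ω
    rw [this]
    exact continuous_integral_ec_mul hf.integrable (fun p => by fun_prop) (fun y => by fun_prop)
  -- The square of value plus integrated derivative, expanded by `(a+b)² ≤ 2a² + 2b²` and
  -- Cauchy–Schwarz on an interval of length `2T`. Integrating in `ω` and then over `σ` yields `2 ·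
  -- (2T)² · (2πb)² = 8 (2πTb)²`.
  refine ⟨fun ω => 2 * ‖𝓕 f ω‖ₑ ^ 2 + 2 * (ENNReal.ofReal (2 * T) *
    ∫⁻ σ in Set.Icc (-T) T, ‖E1 σ ω‖ₑ ^ 2), ?_, fun ω τ hτ => ?_, ?_⟩
  · have h3 := hE1m.lintegral_prod_right' (ν := volume.restrict (Set.Icc (-T) T))
    have h4 := hf0.measurable
    fun_prop
  · rw [key]
    refine (pow_le_pow_left' (enorm_add_le _ _) 2).trans ((ENNReal.add_sq_le _ _).trans ?_)
    refine add_le_add le_rfl (mul_le_mul_right ?_ _)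
    calc ‖∫ σ in (0 : ℝ)..τ, E1 σ ω‖ₑ ^ 2
        ≤ (∫⁻ σ in Set.Icc (-T) T, ‖E1 σ ω‖ₑ) ^ 2 := by
          gcongr
          rw [← ofReal_norm, intervalIntegral.norm_intervalIntegral_eq, ofReal_norm]
          refine (enorm_integral_le_lintegral_enorm _).trans (lintegral_mono_set ?_)
          refine Set.uIoc_subset_uIcc.trans (Set.uIcc_subset_Icc ⟨by linarith, hT⟩ hτ)
      _ ≤ _ := by
          refine (sq_lintegral_le (by fun_prop)).trans ?_
          rw [Measure.restrict_apply_univ, Real.volume_Icc]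
          gcongr; linarith
  · have hsw : ∫⁻ ω, ∫⁻ σ in Set.Icc (-T) T, ‖E1 σ ω‖ₑ ^ 2 =
        ∫⁻ σ in Set.Icc (-T) T, ∫⁻ ω, ‖E1 σ ω‖ₑ ^ 2 :=
      lintegral_lintegral_swap hE1m.aemeasurable
    have h5 : ∀ σ, ∫⁻ ω, ‖E1 σ ω‖ₑ ^ 2 = ∫⁻ y, ‖f1 y‖ₑ ^ 2 := fun σ => by
      simp only [hE1]
      rw [(hf1'.ec_mul (θ := fun y => -(σ * ρ y)) (by fun_prop)).lintegral_fourier_sq,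
        lintegral_ec_mul_sq]
    have h6 : ∫⁻ y, ‖f1 y‖ₑ ^ 2 ≤ ENNReal.ofReal (2 * Real.pi * b) ^ 2 * ∫⁻ y, ‖f y‖ₑ ^ 2 := by
      rw [← lintegral_const_mul' _ _ (by simp)]
      refine lintegral_mono fun y => ?_
      by_cases hy : f y = 0
      · simp [hf1, hy]
      · simp only [hf1, enorm_mul, ← mul_pow]
        gcongr
        rw [← enorm_mul, ← ofReal_norm]
        exact ENNReal.ofReal_le_ofReal (hn1 y hy)
    have h7 := hE1m.lintegral_prod_right' (ν := volume.restrict (Set.Icc (-T) T))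
    rw [lintegral_add_left (by have := hf0.measurable; fun_prop), lintegral_const_mul' _ _ (by simp),
      lintegral_const_mul' _ _ (by simp), lintegral_const_mul' _ _ ENNReal.ofReal_ne_top, hsw,
      hf.lintegral_fourier_sq]
    simp_rw [h5]
    rw [setLIntegral_const, Real.volume_Icc, show T - -T = 2 * T by ring]
    set A := ∫⁻ y, ‖f y‖ₑ ^ 2
    calc _ ≤ 2 * A + 2 * (ENNReal.ofReal (2 * T) *
          ((ENNReal.ofReal (2 * Real.pi * b) ^ 2 * A) * ENNReal.ofReal (2 * T))) := by
          gcongr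
      _ = (2 + 2 * (ENNReal.ofReal (2 * T) * ENNReal.ofReal (2 * Real.pi * b)) ^ 2) *
          A := by ring
      _ ≤ _ := by
          gcongr
          rw [← ENNReal.ofReal_mul (by positivity), ← ENNReal.ofReal_pow (by positivity),
            show (2 : ℝ≥0∞) = ENNReal.ofReal 2 by simp, ← ENNReal.ofReal_mul (by norm_num),
            ← ENNReal.ofReal_add (by norm_num) (by positivity)]
          apply ENNReal.ofReal_le_ofReal
          apply le_of_eq; ring

/-- For a flat piece of graph of slope `v` the transform depends on `μ` only through `hor μ + ver μ
• v`; the deviation `ρ` is absorbed by the majorant of `fourier_ec_sup_sq_le`. Shearing to that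
variable leaves the weight alone to be integrated along the lines `τ ↦ (ω - τ v, τ)`. -/
theorem weighted_plancherel {n : ℕ} {f : Eucl n → ℂ} (hf : BddSupp f) {ρ : Eucl n → ℝ}
    (hρ : Measurable ρ) {b T : ℝ} (hb0 : 0 ≤ b) (hb : ∀ y, f y ≠ 0 → |ρ y| ≤ b) (hT : 0 ≤ T)
    {w : Eucl (n + 1) → ℝ≥0∞} (hw : Measurable w) (v : Eucl n) {W : ℝ≥0∞}
    (hW : ∀ ω, ∫⁻ τ in Set.Icc (-T) T, w (join (ω - τ • v) τ) ≤ W) :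
    ∫⁻ μ in {μ | |ver μ| ≤ T}, w μ *
        ‖∫ y, ec (-(inner ℝ y (hor μ + ver μ • v) + ver μ * ρ y)) * f y‖ₑ ^ 2 ≤
      W * (ENNReal.ofReal (2 + 8 * (2 * Real.pi * T * b) ^ 2) * ∫⁻ y, ‖f y‖ₑ ^ 2) := by
  obtain ⟨S, hS, hS1, hS2⟩ := fourier_ec_sup_sq_le hf hρ hb0 hb hT
  have hm : MeasurableSet {ζ : Eucl (n + 1) | |ver ζ| ≤ T} :=
    measurableSet_le (by fun_prop) measurable_const
  have hle : ∫⁻ μ in {μ | |ver μ| ≤ T}, w μ *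
        ‖∫ y, ec (-(inner ℝ y (hor μ + ver μ • v) + ver μ * ρ y)) * f y‖ₑ ^ 2 ≤
      ∫⁻ μ : Eucl (n + 1) in {μ | |ver μ| ≤ T}, w μ * S (hor μ + ver μ • v) := by
    refine setLIntegral_mono' hm fun μ hμ => mul_le_mul_right ?_ _
    refine le_trans (le_of_eq ?_) (hS1 (hor μ + ver μ • v) (ver μ) (abs_le.1 hμ))
    rw [fourier_eq_ec]
    simp only [neg_add, ec_add, mul_assoc]
  refine hle.trans ?_
  have hS' : Measurable fun μ : Eucl (n + 1) => w μ * S (hor μ + ver μ • v) :=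
    hw.mul (hS.comp (by fun_prop))
  rw [← lintegral_indicator hm, lintegral_eq_lintegral_join (hS'.indicator hm)]
  have e1 : ∀ τ : ℝ, ∫⁻ ω : Eucl n, {ζ : Eucl (n + 1) | |ver ζ| ≤ T}.indicator
      (fun μ => w μ * S (hor μ + ver μ • v)) (join ω τ) =
      (Set.Icc (-T) T).indicator
        (fun τ => ∫⁻ ω : Eucl n, w (join (ω - τ • v) τ) * S ω) τ := fun τ => by
    by_cases h : |τ| ≤ T
    · rw [Set.indicator_of_mem (show τ ∈ Set.Icc (-T) T from abs_le.1 h)]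
      simp_rw [Set.indicator, Set.mem_ofPred_eq, ver_join, if_pos h, hor_join]
      rw [← lintegral_sub_right_eq_self _ (τ • v)]
      simp
    · rw [Set.indicator_of_notMem (show τ ∉ Set.Icc (-T) T from fun h' => h (abs_le.2 h'))]
      simp_rw [Set.indicator, Set.mem_ofPred_eq, ver_join, if_neg h]
      simp
  simp_rw [e1]
  have hwm : Measurable fun p : ℝ × Eucl n => w (join (p.2 - p.1 • v) p.1) :=
    hw.comp (by fun_prop : Continuous fun p : ℝ × Eucl n => join (p.2 - p.1 • v) p.1).measurable
  rw [lintegral_indicator measurableSet_Icc, lintegral_lintegral_swap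
    (f := fun τ ω => w (join (ω - τ • v) τ) * S ω)
    (hwm.mul (hS.comp measurable_snd)).aemeasurable]
  calc _ = ∫⁻ ω : Eucl n, (∫⁻ τ in Set.Icc (-T) T, w (join (ω - τ • v) τ)) * S ω := by
        refine lintegral_congr fun ω => lintegral_mul_const _ ?_
        exact hwm.comp (measurable_id.prodMk measurable_const)
    _ ≤ ∫⁻ ω : Eucl n, W * S ω := lintegral_mono fun ω => mul_le_mul_left (hW ω) _
    _ = W * ∫⁻ ω, S ω := lintegral_const_mul _ hS
    _ ≤ _ := mul_le_mul_right hS2 _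

/-! ### Uniform decay of Fourier transforms of a smooth family -/

theorem norm_iteratedFDeriv_slice_le {P V F : Type*} [NormedAddCommGroup P] [NormedSpace ℝ P]
    [NormedAddCommGroup V] [NormedSpace ℝ V] [NormedAddCommGroup F] [NormedSpace ℝ F]
    {B : P × V → F} (hB : ContDiff ℝ (⊤ : ℕ∞) B) (j : ℕ) (p : P) (s : V) :
    ‖iteratedFDeriv ℝ j (fun s => B (p, s)) s‖ ≤ ‖iteratedFDeriv ℝ j B (p, s)‖ := by
  have e : (fun s => B (p, s)) = (fun x => B ((p, 0) + x)) ∘ ContinuousLinearMap.inr ℝ P V := by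
    ext s; simp
  have hB' : ContDiff ℝ (⊤ : ℕ∞) fun x => B ((p, 0) + x) := hB.comp (by fun_prop)
  rw [e, ContinuousLinearMap.iteratedFDeriv_comp_right _ hB' _ (by exact_mod_cast le_top),
    iteratedFDeriv_comp_add_left]
  refine (ContinuousMultilinearMap.norm_compContinuousLinearMap_le _ _).trans ?_
  have h1 : ((p, 0) : P × V) + ContinuousLinearMap.inr ℝ P V s = (p, s) := by simp
  rw [h1]
  refine mul_le_of_le_one_right (norm_nonneg _) (Finset.prod_le_one (fun _ _ => norm_nonneg _)
    fun _ _ => ContinuousLinearMap.norm_inr_le_one ..)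

/-- Repeated integration by parts in `s`. Joint smoothness bounds every `s`-derivative on the
compact set `K × closedBall 0 R`, which makes the constant uniform in the parameter. -/
theorem exists_uniform_fourier_decay {P : Type*} [NormedAddCommGroup P] [NormedSpace ℝ P] {m : ℕ}
    {B : P × Eucl m → ℂ} (hB : ContDiff ℝ (⊤ : ℕ∞) B) {K : Set P} (hK : IsCompact K) {R : ℝ}
    (hR : ∀ p s, R < ‖s‖ → B (p, s) = 0) (N : ℕ) :
    ∃ C : ℝ, 0 ≤ C ∧ ∀ p ∈ K, ∀ w, ‖w‖ ^ N * ‖𝓕 (fun s => B (p, s)) w‖ ≤ C := by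
  have hb : ∀ j : ℕ, ∃ C : ℝ, ∀ p ∈ K, ∀ s, ‖iteratedFDeriv ℝ j (fun s => B (p, s)) s‖ ≤
      (Metric.closedBall (0 : Eucl m) R).indicator (fun _ => C) s := fun j => by
    obtain ⟨C, hC⟩ := (hK.prod (isCompact_closedBall (0 : Eucl m) R)).exists_bound_of_continuousOn
      (hB.continuous_iteratedFDeriv (m := j) (by exact_mod_cast le_top)).continuousOn
    refine ⟨C, fun p hp s => ?_⟩
    by_cases hs : s ∈ Metric.closedBall (0 : Eucl m) R
    · rw [Set.indicator_of_mem hs]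
      exact (norm_iteratedFDeriv_slice_le hB j p s).trans (hC _ ⟨hp, hs⟩)
    · rw [Set.indicator_of_notMem hs]
      have h1 : s ∉ tsupport fun s => B (p, s) := fun h => hs <|
        closure_minimal (s := Function.support fun s => B (p, s)) (fun x hx => by
          by_contra h2
          exact hx (hR p x (by simpa using h2))) Metric.isClosed_closedBall h
      have h2 : iteratedFDeriv ℝ j (fun s => B (p, s)) s = 0 := by
        by_contra h3
        exact h1 (support_iteratedFDeriv_subset j h3)
      rw [h2, norm_zero]
  choose C hC using hb
  have hvol : volume (Metric.closedBall (0 : Eucl m) R) < ∞ := measure_closedBall_lt_top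
  have hint : ∀ c : ℝ, Integrable ((Metric.closedBall (0 : Eucl m) R).indicator fun _ => c) :=
    fun c => (integrable_indicator_iff Metric.isClosed_closedBall.measurableSet).2
      (integrableOn_const hvol.ne)
  have hsm : ∀ p, ContDiff ℝ (⊤ : ℕ∞) fun s => B (p, s) := fun p => hB.comp (by fun_prop)
  have hI : ∀ p ∈ K, ∀ j : ℕ, Integrable fun s => ‖iteratedFDeriv ℝ j (fun s => B (p, s)) s‖ :=
    fun p hp j => (hint (C j)).mono'
      ((hsm p).continuous_iteratedFDeriv (m := j)
        (by exact_mod_cast le_top)).norm.aestronglyMeasurable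
      (Filter.Eventually.of_forall fun s => by simpa using hC j p hp s)
  refine ⟨max 0 (2 ^ N * ∑ j ∈ Finset.range (N + 1),
    ∫ s, (Metric.closedBall (0 : Eucl m) R).indicator (fun _ => C j) s), le_max_left _ _,
    fun p hp w => ?_⟩
  have h := Real.pow_mul_norm_iteratedFDeriv_fourier_le (K := 0) (N := ⊤) (f := fun s => B (p, s))
    (hsm p) (fun k j hk _ => by
      have : k = 0 := by simpa using hk
      subst this; simpa using hI p hp j) (k := 0) (n := N) (by simp) le_top w
  simp only [norm_iteratedFDeriv_zero, pow_zero, one_mul, zero_add, Finset.range_one,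
    Finset.singleton_product, Finset.sum_map, Nat.cast_zero, mul_zero] at h
  refine h.trans (le_max_of_le_right ?_)
  gcongr with j hj
  · simpa using hI p hp j
  · exact hint _
  · intro s; simpa using hC j p hp s

/-! ### Cutoff functions -/

/-- A smooth cutoff to the annulus `1/2 ≤ ‖ζ‖ ≤ √5`, equal to one for `3/4 ≤ ‖ζ‖ ≤ 2`. -/
def annulusCutoff {m : ℕ} (ζ : Eucl m) : ℝ :=
  Real.smoothTransition (4 * ‖ζ‖ ^ 2 - 1) * Real.smoothTransition (5 - ‖ζ‖ ^ 2)

theorem contDiff_annulusCutoff {m : ℕ} : ContDiff ℝ (⊤ : ℕ∞) (annulusCutoff (m := m)) := by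
  have h := contDiff_norm_sq ℝ (E := Eucl m) (n := (⊤ : ℕ∞))
  exact (Real.smoothTransition.contDiff.comp ((contDiff_const.mul h).sub contDiff_const)).mul
    (Real.smoothTransition.contDiff.comp (contDiff_const.sub h))

theorem annulusCutoff_nonneg {m : ℕ} (ζ : Eucl m) : 0 ≤ annulusCutoff ζ :=
  mul_nonneg (Real.smoothTransition.nonneg _) (Real.smoothTransition.nonneg _)

theorem annulusCutoff_le_one {m : ℕ} (ζ : Eucl m) : annulusCutoff ζ ≤ 1 :=
  mul_le_one₀ (Real.smoothTransition.le_one _) (Real.smoothTransition.nonneg _)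
    (Real.smoothTransition.le_one _)

theorem annulusCutoff_eq_one {m : ℕ} {ζ : Eucl m} (h1 : 3 / 4 ≤ ‖ζ‖) (h2 : ‖ζ‖ ≤ 2) :
    annulusCutoff ζ = 1 := by
  rw [annulusCutoff, Real.smoothTransition.one_of_one_le (by nlinarith),
    Real.smoothTransition.one_of_one_le (by nlinarith), one_mul]

theorem norm_mem_of_annulusCutoff_ne_zero {m : ℕ} {ζ : Eucl m} (h : annulusCutoff ζ ≠ 0) :
    1 / 2 ≤ ‖ζ‖ ∧ ‖ζ‖ ≤ 5 / 2 := by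
  constructor
  · by_contra! h'
    exact h (by rw [annulusCutoff, Real.smoothTransition.zero_of_nonpos
      (by nlinarith [norm_nonneg ζ]), zero_mul])
  · by_contra! h'
    exact h (by rw [annulusCutoff, Real.smoothTransition.zero_of_nonpos (x := 5 - ‖ζ‖ ^ 2)
      (by nlinarith), mul_zero])

/-- A smooth approximate identity supported in the ball of radius `1/32`. -/
def smallBump (m : ℕ) : Eucl m → ℝ :=
  (⟨1 / 64, 1 / 32, by norm_num, by norm_num⟩ : ContDiffBump (0 : Eucl m)).normed volume

theorem contDiff_smallBump {m : ℕ} : ContDiff ℝ (⊤ : ℕ∞) (smallBump m) :=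
  ContDiffBump.contDiff_normed _

theorem smallBump_nonneg {m : ℕ} (s : Eucl m) : 0 ≤ smallBump m s :=
  ContDiffBump.nonneg_normed _ _

theorem integral_smallBump {m : ℕ} : ∫ s, smallBump m s = 1 := ContDiffBump.integral_normed _

theorem integrable_smallBump {m : ℕ} : Integrable (smallBump m) :=
  ContDiffBump.integrable_normed _

theorem norm_le_of_smallBump_ne_zero {m : ℕ} {s : Eucl m} (h : smallBump m s ≠ 0) :
    ‖s‖ ≤ 1 / 32 := by
  have h1 : s ∈ Function.support (smallBump m) := h
  rw [smallBump, ContDiffBump.support_normed_eq] at h1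
  simpa using (Metric.mem_ball.1 h1).le

/-- A smooth positive function which agrees with the norm off the ball of radius `1/8`. -/
def smoothNorm {m : ℕ} (x : Eucl m) : ℝ :=
  Real.sqrt (‖x‖ ^ 2 + (1 - Real.smoothTransition (64 * ‖x‖ ^ 2)))

theorem smoothNorm_arg_pos {m : ℕ} (x : Eucl m) :
    0 < ‖x‖ ^ 2 + (1 - Real.smoothTransition (64 * ‖x‖ ^ 2)) := by
  by_cases h : ‖x‖ = 0
  · simp [h, Real.smoothTransition.zero_of_nonpos]
  · have := Real.smoothTransition.le_one (64 * ‖x‖ ^ 2)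
    positivity [sub_nonneg.2 this]

theorem smoothNorm_pos {m : ℕ} (x : Eucl m) : 0 < smoothNorm x :=
  Real.sqrt_pos.2 (smoothNorm_arg_pos x)

theorem contDiff_smoothNorm {m : ℕ} : ContDiff ℝ (⊤ : ℕ∞) (smoothNorm (m := m)) := by
  have h := contDiff_norm_sq ℝ (E := Eucl m) (n := (⊤ : ℕ∞))
  refine ContDiff.sqrt (h.add (contDiff_const.sub
    (Real.smoothTransition.contDiff.comp (contDiff_const.mul h)))) fun x => ?_
  exact (smoothNorm_arg_pos x).ne'

theorem smoothNorm_eq_norm {m : ℕ} {x : Eucl m} (h : 1 / 8 ≤ ‖x‖) : smoothNorm x = ‖x‖ := by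
  rw [smoothNorm, Real.smoothTransition.one_of_one_le (by nlinarith), sub_self, add_zero,
    Real.sqrt_sq (norm_nonneg x)]

/-! ### The oscillatory integral of the wave kernel between two frequency cells -/

/-- The second order Taylor remainder of `ε⁻² ‖z + ε s‖`. -/
def conePhase {m : ℕ} (z : Eucl m) (ε : ℝ) (s : Eucl m) : ℝ :=
  ‖s‖ ^ 2 / (smoothNorm z + smoothNorm (z + ε • s)) -
    inner ℝ z s * (2 * inner ℝ z s + ε * ‖s‖ ^ 2) /
      (smoothNorm z * (smoothNorm z + smoothNorm (z + ε • s)) ^ 2)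

/-- Rationalizing the difference of norms twice extracts an explicit factor `ε²` from the Taylor
remainder, with `ε = Λ⁻¹`. What is left has no negative power of `ε`, so it is smooth up to `ε = 0`,
that is, uniformly as `Λ → ∞`. -/
theorem conePhase_eq {m : ℕ} {μ s : Eucl m} {Λ : ℝ} (hΛ : 0 < Λ)
    (h1 : 1 / 8 ≤ ‖Λ⁻¹ • μ‖) (h2 : 1 / 8 ≤ ‖Λ⁻¹ • (μ + s)‖) :
    Λ * ‖μ + s‖ = Λ * ‖μ‖ + inner ℝ ((Λ / ‖μ‖) • μ) s + conePhase (Λ⁻¹ • μ) Λ⁻¹ s := by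
  set z := Λ⁻¹ • μ with hz
  set ε := Λ⁻¹ with hε
  have hε0 : 0 < ε := inv_pos.2 hΛ
  have hμ : μ = Λ • z := by rw [hz, smul_smul, hε, mul_inv_cancel₀ hΛ.ne', one_smul]
  have hsum : μ + s = Λ • (z + ε • s) := by
    rw [smul_add, ← hμ, smul_smul, hε, mul_inv_cancel₀ hΛ.ne', one_smul]
  have h2' : 1 / 8 ≤ ‖z + ε • s‖ := by rw [smul_add] at h2; exact h2
  rw [conePhase, smoothNorm_eq_norm h1, smoothNorm_eq_norm h2', hsum, norm_smul Λ (z + ε • s), hμ,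
    norm_smul Λ z, Real.norm_eq_abs, abs_of_pos hΛ]
  have hB : ‖z + ε • s‖ ^ 2 = ‖z‖ ^ 2 + 2 * ε * inner ℝ z s + ε ^ 2 * ‖s‖ ^ 2 := by
    rw [norm_add_sq_real, inner_smul_right, norm_smul ε s, Real.norm_eq_abs, abs_of_pos hε0]; ring
  rw [smul_smul, inner_smul_left]
  have hA0 : 0 < ‖z‖ := by linarith
  have hB0 : 0 < ‖z + ε • s‖ := by linarith
  simp only [conj_trivial]
  have hΛε : Λ = ε⁻¹ := by rw [hε, inv_inv]
  rw [hΛε]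
  generalize ‖z + ε • s‖ = B at *
  generalize ‖z‖ = A at *
  generalize (inner ℝ z s : ℝ) = p at *
  generalize ‖s‖ = q at *
  have hAB : A + B ≠ 0 := by positivity
  field_simp
  -- With `A = ‖z‖`, `B = ‖z + εs‖`, `p = ⟪z, s⟫` and `q = ‖s‖`, the only relation needed is `B² =
  -- A² + 2εp + ε²q²`.
  linear_combination (A * (A + B) - ε * p) * hB

/-- The amplitude, in the rescaled variables, of the wave kernel between two frequency cells. -/
def coneAmplitude {m : ℕ} (σ : ℝ) (p : (Eucl m × ℝ × Eucl m) × Eucl m) : ℂ :=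
  ((annulusCutoff (p.1.1 + p.1.2.1 • p.2) * smallBump m p.2 * smallBump m (p.2 - p.1.2.2) : ℝ) : ℂ)
    * ec (σ * conePhase p.1.1 p.1.2.1 p.2)

/-- Smoothness is joint in the rescaled frequency, the small parameter, the offset between the cells
and `s`. The denominators never vanish because `smoothNorm` is positive everywhere, including at the
origin. -/
theorem contDiff_coneAmplitude {m : ℕ} (σ : ℝ) :
    ContDiff ℝ (⊤ : ℕ∞) (coneAmplitude (m := m) σ) := by
  have hz : ContDiff ℝ (⊤ : ℕ∞) fun p : (Eucl m × ℝ × Eucl m) × Eucl m => p.1.1 := by fun_prop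
  have hs : ContDiff ℝ (⊤ : ℕ∞) fun p : (Eucl m × ℝ × Eucl m) × Eucl m => p.2 := by fun_prop
  have he : ContDiff ℝ (⊤ : ℕ∞) fun p : (Eucl m × ℝ × Eucl m) × Eucl m => p.1.2.1 := by fun_prop
  have hd : ContDiff ℝ (⊤ : ℕ∞) fun p : (Eucl m × ℝ × Eucl m) × Eucl m => p.1.2.2 := by fun_prop
  have hzs := hz.add (he.smul hs)
  have hA := contDiff_smoothNorm.comp hz
  have hAB := hA.add (contDiff_smoothNorm.comp hzs)
  have hp := hz.inner ℝ hs
  have hq := hs.norm_sq ℝ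
  refine (Complex.ofRealCLM.contDiff.comp (((contDiff_annulusCutoff.comp hzs).mul
    (contDiff_smallBump.comp hs)).mul (contDiff_smallBump.comp (hs.sub hd)))).mul
    (contDiff_ec.comp (contDiff_const.mul ?_))
  refine (hq.div hAB fun p => ?_).sub ((hp.mul ((contDiff_const.mul hp).add (he.mul hq))).div
    (hA.mul (hAB.pow 2)) fun p => ?_)
  · exact (add_pos (smoothNorm_pos _) (smoothNorm_pos _)).ne'
  · exact (mul_pos (smoothNorm_pos _) (pow_pos (add_pos (smoothNorm_pos _) (smoothNorm_pos _)) 2)).ne'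

/-- The matrix coefficient of the half-wave propagator between two frequency cells. -/
def coneIntegral {m : ℕ} (σ Λ : ℝ) (w μ μ' : Eucl m) : ℂ :=
  ∫ ζ, ((annulusCutoff (Λ⁻¹ • ζ) * smallBump m (ζ - μ) * smallBump m (ζ - μ') : ℝ) : ℂ) *
    ec (σ * (Λ * ‖ζ‖) + inner ℝ w ζ)

theorem coneIntegral_swap {m : ℕ} (σ Λ : ℝ) (w μ μ' : Eucl m) :
    coneIntegral σ Λ w μ μ' = coneIntegral σ Λ w μ' μ := by
  simp only [coneIntegral, mul_assoc, mul_comm (smallBump m (_ - μ))]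

/-- Two bumps of radius `1/32` must meet, whence `1/16`. The bump about `μ` must also meet the
annulus `Λ/2 ≤ ‖ζ‖ ≤ 5Λ/2`, and `Λ ≥ 1` absorbs its radius. -/
theorem coneIntegral_ne_zero {m : ℕ} {σ Λ : ℝ} (hΛ : 1 ≤ Λ) {w μ μ' : Eucl m}
    (h : coneIntegral σ Λ w μ μ' ≠ 0) :
    ‖μ' - μ‖ ≤ 1 / 16 ∧ Λ / 4 ≤ ‖μ‖ ∧ ‖μ‖ ≤ 3 * Λ := by
  have hex : ∃ ζ : Eucl m, annulusCutoff (Λ⁻¹ • ζ) * smallBump m (ζ - μ) * smallBump m (ζ - μ') ≠ 0 := by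
    by_contra! h'
    exact h (by simp [coneIntegral, h'])
  obtain ⟨ζ, hζ⟩ := hex
  have h1 := norm_mem_of_annulusCutoff_ne_zero (left_ne_zero_of_mul (left_ne_zero_of_mul hζ))
  have h2 := norm_le_of_smallBump_ne_zero (right_ne_zero_of_mul (left_ne_zero_of_mul hζ))
  have h3 := norm_le_of_smallBump_ne_zero (right_ne_zero_of_mul hζ)
  have hΛ0 : 0 < Λ := by linarith
  rw [norm_smul, Real.norm_eq_abs, abs_of_pos (inv_pos.2 hΛ0)] at h1
  have h4 : 1 / 2 * Λ ≤ ‖ζ‖ := by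
    have := (le_inv_mul_iff₀ hΛ0).1 h1.1; linarith
  have h5 : ‖ζ‖ ≤ 5 / 2 * Λ := by
    have := (inv_mul_le_iff₀ hΛ0).1 h1.2; linarith
  refine ⟨?_, ?_, ?_⟩
  · have e : μ' - μ = (ζ - μ) - (ζ - μ') := by abel
    rw [e]; linarith [norm_sub_le (ζ - μ) (ζ - μ')]
  · have := norm_sub_norm_le ζ μ
    linarith
  · have := norm_sub_norm_le μ ζ
    rw [norm_sub_rev] at this
    linarith

/-- Centring the integral at `μ` makes the phase a constant, plus a linear term with coefficient `u
= w + σΛ μ/‖μ‖`, plus `σ` times the smooth remainder `conePhase`. Up to a unimodular factor the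
integral is therefore the Fourier transform at `-u` of an amplitude from a smooth family with
compact parameter set. -/
theorem exists_coneIntegral_decay (m N : ℕ) :
    ∃ C : ℝ, 0 ≤ C ∧ ∀ σ : ℝ, σ = 1 ∨ σ = -1 → ∀ Λ : ℝ, 1 ≤ Λ → ∀ w μ μ' : Eucl m,
      (1 + ‖w + (σ * (Λ / ‖μ‖)) • μ‖) ^ N * ‖coneIntegral σ Λ w μ μ'‖ ≤ C := by
  -- The parameters are `(μ/Λ, 1/Λ, μ' - μ)`. Including the endpoint `1/Λ = 0` gives compactness,
  -- hence uniformity in `Λ`.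
  have hK : IsCompact (Metric.closedBall (0 : Eucl m) 3 ×ˢ (Set.Icc (0 : ℝ) 1 ×ˢ
      Metric.closedBall (0 : Eucl m) 1)) :=
    (isCompact_closedBall _ _).prod (isCompact_Icc.prod (isCompact_closedBall _ _))
  have hR : ∀ σ : ℝ, ∀ (p : Eucl m × ℝ × Eucl m) (s : Eucl m), 1 / 32 < ‖s‖ →
      coneAmplitude σ (p, s) = 0 := fun σ p s hs => by
    have : smallBump m s = 0 := by
      by_contra h; linarith [norm_le_of_smallBump_ne_zero h]
    simp [coneAmplitude, this]
  have hall : ∀ σ : ℝ, ∃ C : ℝ, 0 ≤ C ∧ ∀ p ∈ Metric.closedBall (0 : Eucl m) 3 ×ˢ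
      (Set.Icc (0 : ℝ) 1 ×ˢ Metric.closedBall (0 : Eucl m) 1),
      ∀ w, (1 + ‖w‖) ^ N * ‖𝓕 (fun s => coneAmplitude σ (p, s)) w‖ ≤ C := fun σ => by
    obtain ⟨C0, hC0, h0⟩ := exists_uniform_fourier_decay (contDiff_coneAmplitude σ) hK (hR σ) 0
    obtain ⟨C1, hC1, h1⟩ := exists_uniform_fourier_decay (contDiff_coneAmplitude σ) hK (hR σ) N
    refine ⟨2 ^ (N - 1) * (C0 + C1), by positivity, fun p hp w => ?_⟩
    have h2 := add_pow_le zero_le_one (norm_nonneg w) N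
    rw [one_pow] at h2
    calc _ ≤ 2 ^ (N - 1) * (1 + ‖w‖ ^ N) * ‖𝓕 (fun s => coneAmplitude σ (p, s)) w‖ := by gcongr
      _ = 2 ^ (N - 1) * (‖w‖ ^ 0 * ‖𝓕 (fun s => coneAmplitude σ (p, s)) w‖ +
          ‖w‖ ^ N * ‖𝓕 (fun s => coneAmplitude σ (p, s)) w‖) := by ring
      _ ≤ _ := by
        gcongr
        · exact h0 p hp w
        · exact h1 p hp w
  obtain ⟨C1, hC1, h1⟩ := hall 1
  obtain ⟨C2, hC2, h2⟩ := hall (-1)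
  refine ⟨C1 + C2, by positivity, fun σ hσ Λ hΛ w μ μ' => ?_⟩
  by_cases hJ : coneIntegral σ Λ w μ μ' = 0
  · rw [hJ]; simp; positivity
  obtain ⟨hd, hμ1, hμ2⟩ := coneIntegral_ne_zero hΛ hJ
  have hΛ0 : 0 < Λ := by linarith
  set u := w + (σ * (Λ / ‖μ‖)) • μ with hu
  have hnz : ‖Λ⁻¹ • μ‖ = Λ⁻¹ * ‖μ‖ := by
    rw [norm_smul, Real.norm_eq_abs, abs_of_pos (inv_pos.2 hΛ0)]
  have hz1 : 1 / 8 ≤ ‖Λ⁻¹ • μ‖ := by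
    rw [hnz, le_inv_mul_iff₀ hΛ0]; linarith
  have key : coneIntegral σ Λ w μ μ' = ec (σ * (Λ * ‖μ‖) + inner ℝ w μ) *
      𝓕 (fun s => coneAmplitude σ ((Λ⁻¹ • μ, Λ⁻¹, μ' - μ), s)) (-u) := by
    rw [fourier_eq_ec, ← integral_const_mul, coneIntegral, ← integral_add_left_eq_self _ μ]
    congr 1; ext s
    simp only [coneAmplitude]
    have e1 : μ + s - μ = s := by abel
    have e2 : μ + s - μ' = s - (μ' - μ) := by abel
    rw [e1, e2, smul_add]
    by_cases hα : annulusCutoff (Λ⁻¹ • μ + Λ⁻¹ • s) = 0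
    · simp [hα]
    have hα2 := (norm_mem_of_annulusCutoff_ne_zero hα).1
    rw [← smul_add] at hα2
    rw [conePhase_eq hΛ0 hz1 (by linarith), inner_add_right, hu]
    have e3 : σ * (Λ * ‖μ‖ + inner ℝ ((Λ / ‖μ‖) • μ) s + conePhase (Λ⁻¹ • μ) Λ⁻¹ s) +
        (inner ℝ w μ + inner ℝ w s) = (σ * (Λ * ‖μ‖) + inner ℝ w μ) +
        (-inner ℝ s (-(w + (σ * (Λ / ‖μ‖)) • μ))) + σ * conePhase (Λ⁻¹ • μ) Λ⁻¹ s := by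
      rw [inner_neg_right, inner_add_right, inner_smul_right, inner_smul_left,
        real_inner_comm s w, real_inner_comm s μ]
      simp only [conj_trivial]
      ring
    rw [e3, ec_add, ec_add]; ring
  rw [key, norm_mul, norm_ec, one_mul, ← norm_neg u]
  have hp : (Λ⁻¹ • μ, Λ⁻¹, μ' - μ) ∈ Metric.closedBall (0 : Eucl m) 3 ×ˢ
      (Set.Icc (0 : ℝ) 1 ×ˢ Metric.closedBall (0 : Eucl m) 1) := by
    refine ⟨?_, ⟨(inv_pos.2 hΛ0).le, inv_le_one_of_one_le₀ hΛ⟩, ?_⟩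
    · rw [mem_closedBall_zero_iff, hnz, inv_mul_le_iff₀ hΛ0]; linarith
    · rw [mem_closedBall_zero_iff]; linarith
  rcases hσ with rfl | rfl
  · exact (h1 _ hp _).trans (by linarith)
  · exact (h2 _ hp _).trans (by linarith)

/-! ### Summability of the phase space weights -/

theorem lintegral_one_add_norm_inv_pow_lt_top (m : ℕ) :
    ∫⁻ x : Eucl m, ENNReal.ofReal (((1 + ‖x‖) ^ (m + 1))⁻¹) < ∞ := by
  have h := finite_integral_one_add_norm (E := Eucl m) (μ := volume) (r := m + 1)
    (by rw [finrank_euclideanSpace_fin]; linarith)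
  refine lt_of_eq_of_lt (lintegral_congr fun x => ?_) h
  rw [Real.rpow_neg (by positivity)]
  norm_cast

theorem lintegral_one_add_abs_inv_sq_lt_top :
    ∫⁻ τ : ℝ, ENNReal.ofReal (((1 + |τ|) ^ 2)⁻¹) < ∞ := by
  have h := finite_integral_one_add_norm (E := ℝ) (μ := volume) (r := 2) (by simp)
  refine lt_of_eq_of_lt (lintegral_congr fun x => ?_) h
  rw [Real.rpow_neg (by positivity), Real.norm_eq_abs]
  norm_cast

/-- The total weight of the phase space cells at frequency `μ` joined to the cell of `c'`. -/
def cellWeight {n : ℕ} (σ Λ : ℝ) (G : Eucl n → ℝ) (c' : Eucl n) (μ : Eucl (n + 1)) : ℝ≥0∞ :=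
  {μ : Eucl (n + 1) | Λ / 4 ≤ ‖μ‖ ∧ ‖μ‖ ≤ 3 * Λ}.indicator (fun μ => ∫⁻ c, ENNReal.ofReal
    (((1 + ‖graphPoint G c - graphPoint G c' + (σ * (Λ / ‖μ‖)) • μ‖) ^ (n + 3))⁻¹)) μ

theorem measurable_cellWeight {n : ℕ} (σ Λ : ℝ) {G : Eucl n → ℝ} (hG : Measurable G) :
    Measurable fun p : Eucl n × Eucl (n + 1) => cellWeight σ Λ G p.1 p.2 := by
  have hm : MeasurableSet {p : Eucl n × Eucl (n + 1) | Λ / 4 ≤ ‖p.2‖ ∧ ‖p.2‖ ≤ 3 * Λ} :=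
    measurableSet_Icc.preimage (f := fun p : Eucl n × Eucl (n + 1) => ‖p.2‖) (by fun_prop)
  have hg := measurable_graphPoint hG
  have h := Measurable.indicator (f := fun p : Eucl n × Eucl (n + 1) => ∫⁻ c, ENNReal.ofReal
    (((1 + ‖graphPoint G c - graphPoint G p.1 + (σ * (Λ / ‖p.2‖)) • p.2‖) ^ (n + 3))⁻¹))
    (Measurable.lintegral_prod_right' (f := fun q : (Eucl n × Eucl (n + 1)) × Eucl n =>
      ENNReal.ofReal (((1 + ‖graphPoint G q.2 - graphPoint G q.1.1 +
        (σ * (Λ / ‖q.1.2‖)) • q.1.2‖) ^ (n + 3))⁻¹)) (by fun_prop)) hm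
  exact h

/-- The height above the graph of the point reached from `c'` in the direction `-σμ`. -/
def flowHeight {n : ℕ} (σ Λ : ℝ) (G : Eucl n → ℝ) (c' : Eucl n) (μ : Eucl (n + 1)) : ℝ :=
  G (c' - (σ * (Λ / ‖μ‖)) • hor μ) - G c' + σ * (Λ / ‖μ‖) * ver μ

/-- The displacement `D` from the transported point to the graph point over `c` has horizontal part
`c - x`, and its vertical part differs from the flow height by at most `‖c - x‖/20`. So `D` controls
both `‖c - x‖` and the height. Of the `n + 3` powers of decay, two are spent on the height and `n +
1` make the integral in `c` converge. -/
theorem lintegral_cell_le {n : ℕ} {G : Eucl n → ℝ} (hG : ∀ x y, |G x - G y| ≤ 1 / 20 * ‖x - y‖)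
    (σ Λ : ℝ) (c' : Eucl n) (μ : Eucl (n + 1)) :
    ∫⁻ c, ENNReal.ofReal
      (((1 + ‖graphPoint G c - graphPoint G c' + (σ * (Λ / ‖μ‖)) • μ‖) ^ (n + 3))⁻¹) ≤
    ENNReal.ofReal (4 * ((1 + |flowHeight σ Λ G c' μ|) ^ 2)⁻¹) *
      ∫⁻ c : Eucl n, ENNReal.ofReal (((1 + ‖c‖) ^ (n + 1))⁻¹) := by
  set x := c' - (σ * (Λ / ‖μ‖)) • hor μ with hx
  set κ := flowHeight σ Λ G c' μ with hκ
  rw [← lintegral_sub_right_eq_self (fun c : Eucl n => ENNReal.ofReal (((1 + ‖c‖) ^ (n + 1))⁻¹)) x,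
    ← lintegral_const_mul' _ _ ENNReal.ofReal_ne_top]
  refine lintegral_mono fun c => ?_
  rw [← ENNReal.ofReal_mul (by positivity)]
  apply ENNReal.ofReal_le_ofReal
  set D := graphPoint G c - graphPoint G c' + (σ * (Λ / ‖μ‖)) • μ with hD
  have h1 : hor D = c - x := by
    rw [hD, hx]; simp only [hor_add, hor_sub, graphPoint_eq_join, hor_join, hor_smul]; abel
  have h2 : ver D = κ + (G c - G x) := by
    rw [hD, hκ, flowHeight, ← hx]
    simp only [ver_add, ver_sub, graphPoint_eq_join, ver_join, ver_smul]; ring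
  have h3 : ‖c - x‖ ≤ ‖D‖ := h1 ▸ norm_hor_le D
  have h4 : |κ| ≤ 2 * ‖D‖ := by
    have e : κ = ver D - (G c - G x) := by rw [h2]; ring
    rw [e]
    have := hG c x
    linarith [abs_sub (ver D) (G c - G x), abs_ver_le D, norm_nonneg D]
  have h5 : (1 + |κ|) ^ 2 ≤ 4 * (1 + ‖D‖) ^ 2 := by
    have : 1 + |κ| ≤ 2 * (1 + ‖D‖) := by linarith
    calc _ ≤ (2 * (1 + ‖D‖)) ^ 2 := by gcongr
      _ = _ := by ring
  have h6 : (1 + ‖c - x‖) ^ (n + 1) ≤ (1 + ‖D‖) ^ (n + 1) := by gcongr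
  rw [mul_assoc, ← mul_inv, ← div_eq_mul_inv, inv_eq_one_div, div_le_div_iff₀ (by positivity)
    (by positivity), one_mul]
  calc _ ≤ (4 * (1 + ‖D‖) ^ 2) * (1 + ‖D‖) ^ (n + 1) := by gcongr
    _ = _ := by ring

/-- In a steep direction the point moves vertically by at least `Λ/10`, while the graph, over a
horizontal displacement of at most `Λ`, changes height by at most `Λ/20`. -/
theorem abs_flowHeight_ge {n : ℕ} {G : Eucl n → ℝ} (hG : ∀ x y, |G x - G y| ≤ 1 / 20 * ‖x - y‖)
    {σ Λ : ℝ} (hσ : |σ| = 1) (hΛ : 0 ≤ Λ) (c' : Eucl n) {μ : Eucl (n + 1)} (hμ : 0 < ‖μ‖)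
    (h : ‖μ‖ / 10 < |ver μ|) : Λ / 20 ≤ |flowHeight σ Λ G c' μ| := by
  have h1 := hG (c' - (σ * (Λ / ‖μ‖)) • hor μ) c'
  have h2 : ‖c' - (σ * (Λ / ‖μ‖)) • hor μ - c'‖ ≤ Λ := by
    rw [show c' - (σ * (Λ / ‖μ‖)) • hor μ - c' = -((σ * (Λ / ‖μ‖)) • hor μ) by abel, norm_neg,
      norm_smul, Real.norm_eq_abs, abs_mul, hσ, one_mul, abs_of_nonneg (by positivity)]
    calc _ ≤ Λ / ‖μ‖ * ‖μ‖ := by gcongr; exact norm_hor_le μ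
      _ = Λ := by field_simp
  have h3 : Λ / 10 ≤ |σ * (Λ / ‖μ‖) * ver μ| := by
    rw [abs_mul, abs_mul, hσ, one_mul, abs_of_nonneg (by positivity : 0 ≤ Λ / ‖μ‖)]
    calc Λ / 10 = Λ / ‖μ‖ * (‖μ‖ / 10) := by field_simp
      _ ≤ _ := by gcongr
  have h4 := abs_sub_abs_le_abs_sub (σ * (Λ / ‖μ‖) * ver μ)
    (-(G (c' - (σ * (Λ / ‖μ‖)) • hor μ) - G c'))
  rw [abs_neg, sub_neg_eq_add, add_comm (σ * (Λ / ‖μ‖) * ver μ)] at h4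
  rw [flowHeight]
  linarith

/-- Transversality. The line `τ ↦ (ω - τ v, τ)` is almost vertical, so near a horizontal direction
moving along it mostly tilts the unit vector `μ/‖μ‖`. Per unit of `|τ₁ - τ₂|/‖μ₂‖` the vertical
component changes by at least `1 - (1/10)(21/20) = 179/200`. The horizontal one changes by at most
`1/20 + 21/20 = 11/10`, which the slope `1/20` turns into a height of at most `11/200`. The
difference `21/25` survives. -/
theorem abs_flowHeight_sub_ge {n : ℕ} {G : Eucl n → ℝ}
    (hG : ∀ x y, |G x - G y| ≤ 1 / 20 * ‖x - y‖) {σ Λ : ℝ} (hσ : |σ| = 1) (hΛ : 0 < Λ)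
    (c' ω : Eucl n) {v : Eucl n} (hv : ‖v‖ ≤ 1 / 20) {τ₁ τ₂ : ℝ}
    (h10 : 0 < ‖join (ω - τ₁ • v) τ₁‖) (h20 : 0 < ‖join (ω - τ₂ • v) τ₂‖)
    (h2 : ‖join (ω - τ₂ • v) τ₂‖ ≤ 3 * Λ) (h1 : |τ₁| ≤ ‖join (ω - τ₁ • v) τ₁‖ / 10) :
    |τ₁ - τ₂| / 4 ≤ |flowHeight σ Λ G c' (join (ω - τ₁ • v) τ₁) -
      flowHeight σ Λ G c' (join (ω - τ₂ • v) τ₂)| := by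
  set μ₁ := join (ω - τ₁ • v) τ₁ with hμ₁
  set μ₂ := join (ω - τ₂ • v) τ₂ with hμ₂
  set Δ := τ₂ - τ₁ with hΔ
  -- The relative change of length; it measures the effect of normalizing `μ₁` and `μ₂` by different
  -- lengths.
  set r := (‖μ₂‖ - ‖μ₁‖) / ‖μ₂‖ with hr
  have hdiff : |‖μ₂‖ - ‖μ₁‖| ≤ 21 / 20 * |Δ| := by
    refine (abs_norm_sub_norm_le μ₂ μ₁).trans ((norm_le_hor_add_ver _).trans ?_)
    have e1 : hor (μ₂ - μ₁) = -(Δ • v) := by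
      rw [hor_sub, hμ₁, hμ₂, hor_join, hor_join, hΔ, sub_smul]; abel
    have e2 : ver (μ₂ - μ₁) = Δ := by rw [ver_sub, hμ₁, hμ₂, ver_join, ver_join]
    rw [e1, e2, norm_neg, norm_smul, Real.norm_eq_abs]
    nlinarith [abs_nonneg Δ]
  have hrb : |r| ≤ 21 / 20 * |Δ| / ‖μ₂‖ := by
    rw [hr, abs_div, abs_norm]; gcongr
  -- vertical components of the directions
  have hver : τ₂ / ‖μ₂‖ - τ₁ / ‖μ₁‖ = Δ / ‖μ₂‖ - τ₁ / ‖μ₁‖ * r := by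
    rw [hr, hΔ]; field_simp; ring
  have hver' : (179 / 200) * (|Δ| / ‖μ₂‖) ≤ |τ₂ / ‖μ₂‖ - τ₁ / ‖μ₁‖| := by
    rw [hver]
    have h3 : |τ₁ / ‖μ₁‖ * r| ≤ 1 / 10 * (21 / 20 * |Δ| / ‖μ₂‖) := by
      rw [abs_mul, abs_div, abs_norm]
      refine mul_le_mul ?_ hrb (abs_nonneg _) (by norm_num)
      rw [div_le_iff₀ h10]; linarith
    have h4 := abs_sub_abs_le_abs_sub (Δ / ‖μ₂‖) (τ₁ / ‖μ₁‖ * r)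
    rw [abs_div, abs_norm] at h4
    have e : 1 / 10 * (21 / 20 * |Δ| / ‖μ₂‖) = 21 / 200 * (|Δ| / ‖μ₂‖) := by ring
    linarith
  have hhor : (1 / ‖μ₁‖) • hor μ₁ - (1 / ‖μ₂‖) • hor μ₂ =
      (Δ / ‖μ₂‖) • v + (r / ‖μ₁‖) • hor μ₁ := by
    have e1 : hor μ₂ = hor μ₁ - Δ • v := by
      rw [hμ₁, hμ₂, hor_join, hor_join, hΔ, sub_smul]; abel
    rw [e1, smul_sub, smul_smul, sub_sub_eq_add_sub, add_sub_right_comm, ← sub_smul, add_comm]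
    congr 2
    · ring
    · rw [hr]; field_simp
  have hhor' : ‖(1 / ‖μ₁‖) • hor μ₁ - (1 / ‖μ₂‖) • hor μ₂‖ ≤ 11 / 10 * (|Δ| / ‖μ₂‖) := by
    rw [hhor]
    refine (norm_add_le _ _).trans ?_
    rw [norm_smul, norm_smul, Real.norm_eq_abs, Real.norm_eq_abs, abs_div, abs_div, abs_norm,
      abs_norm]
    have h3 : |Δ| / ‖μ₂‖ * ‖v‖ ≤ |Δ| / ‖μ₂‖ * (1 / 20) := by gcongr
    have h4 : |r| / ‖μ₁‖ * ‖hor μ₁‖ ≤ |r| := by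
      rw [div_mul_eq_mul_div, div_le_iff₀ h10]; gcongr; exact norm_hor_le μ₁
    have e : 21 / 20 * |Δ| / ‖μ₂‖ = 21 / 20 * (|Δ| / ‖μ₂‖) := by ring
    linarith
  have hGd : |G (c' - (σ * (Λ / ‖μ₁‖)) • hor μ₁) - G (c' - (σ * (Λ / ‖μ₂‖)) • hor μ₂)| ≤
      Λ * (11 / 200 * (|Δ| / ‖μ₂‖)) := by
    refine (hG _ _).trans ?_
    have e : c' - (σ * (Λ / ‖μ₁‖)) • hor μ₁ - (c' - (σ * (Λ / ‖μ₂‖)) • hor μ₂) =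
        -((σ * Λ) • ((1 / ‖μ₁‖) • hor μ₁ - (1 / ‖μ₂‖) • hor μ₂)) := by
      rw [smul_sub, smul_smul, smul_smul, show σ * Λ * (1 / ‖μ₁‖) = σ * (Λ / ‖μ₁‖) by ring,
        show σ * Λ * (1 / ‖μ₂‖) = σ * (Λ / ‖μ₂‖) by ring]
      abel
    rw [e, norm_neg, norm_smul, Real.norm_eq_abs, abs_mul, hσ, one_mul, abs_of_pos hΛ]
    calc _ ≤ 1 / 20 * (Λ * (11 / 10 * (|Δ| / ‖μ₂‖))) := by gcongr
      _ = _ := by ring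
  -- Since `‖μ₂‖ ≤ 3Λ`, the rate `4/5 ≤ 21/25` becomes at least `4/15`, which exceeds `1/4`.
  have hfin : |τ₁ - τ₂| / 4 ≤ Λ * (4 / 5 * (|Δ| / ‖μ₂‖)) := by
    rw [abs_sub_comm, ← hΔ, ← mul_div_assoc, ← mul_div_assoc, le_div_iff₀ h20]
    nlinarith [abs_nonneg Δ, mul_le_mul_of_nonneg_left h2 (abs_nonneg Δ)]
  have hv1 : ver μ₁ = τ₁ := ver_join _ _
  have hv2 : ver μ₂ = τ₂ := ver_join _ _
  have hsplit : flowHeight σ Λ G c' μ₁ - flowHeight σ Λ G c' μ₂ =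
      (G (c' - (σ * (Λ / ‖μ₁‖)) • hor μ₁) - G (c' - (σ * (Λ / ‖μ₂‖)) • hor μ₂)) -
        σ * Λ * (τ₂ / ‖μ₂‖ - τ₁ / ‖μ₁‖) := by
    rw [flowHeight, flowHeight, hv1, hv2]; ring
  have hlow : Λ * ((179 / 200) * (|Δ| / ‖μ₂‖)) ≤ |σ * Λ * (τ₂ / ‖μ₂‖ - τ₁ / ‖μ₁‖)| := by
    rw [abs_mul, abs_mul, hσ, one_mul, abs_of_pos hΛ]; gcongr
  refine hfin.trans ?_
  rw [hsplit]
  have h5 := abs_sub_abs_le_abs_sub (σ * Λ * (τ₂ / ‖μ₂‖ - τ₁ / ‖μ₁‖))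
    (G (c' - (σ * (Λ / ‖μ₁‖)) • hor μ₁) - G (c' - (σ * (Λ / ‖μ₂‖)) • hor μ₂))
  have e3 : Λ * ((179 / 200) * (|Δ| / ‖μ₂‖)) - Λ * (11 / 200 * (|Δ| / ‖μ₂‖)) =
    Λ * (21 / 25 * (|Δ| / ‖μ₂‖)) := by ring
  have e4 : 0 ≤ Λ * (|Δ| / ‖μ₂‖) := by positivity
  rw [abs_sub_comm (σ * Λ * (τ₂ / ‖μ₂‖ - τ₁ / ‖μ₁‖)) (G _ - G _)] at h5
  linarith

/-- An expanding function grows linearly away from a point where its modulus is nearly minimal. Only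
an infimum up to `1` is used, as neither closedness of `A` nor continuity of `κ` is available; the
bound is `|τ - τ₀| ≤ 4(|κ τ| + |κ τ₀|) ≤ 4(2|κ τ| + 1)`. -/
theorem exists_forall_one_add_abs_le {A : Set ℝ} (hA : A.Nonempty) {κ : ℝ → ℝ}
    (h : ∀ τ₁ ∈ A, ∀ τ₂ ∈ A, |τ₁ - τ₂| / 4 ≤ |κ τ₁ - κ τ₂|) :
    ∃ τ₀, ∀ τ ∈ A, 1 + |τ - τ₀| ≤ 8 * (1 + |κ τ|) := by
  have hbd : BddBelow ((fun τ => |κ τ|) '' A) := ⟨0, by rintro _ ⟨τ, -, rfl⟩; positivity⟩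
  obtain ⟨_, ⟨τ₀, h0, rfl⟩, h1⟩ := exists_lt_of_csInf_lt (hA.image fun τ => |κ τ|)
    (lt_add_one (sInf ((fun τ => |κ τ|) '' A)))
  refine ⟨τ₀, fun τ hτ => ?_⟩
  have h2 := csInf_le hbd ⟨τ, hτ, rfl⟩
  have h3 := h τ hτ τ₀ h0
  have h4 := abs_sub (κ τ) (κ τ₀)
  simp only at h1 h2
  linarith

/-- This is the integrability of the weight transversally to the tangent plane. Steep frequencies
contribute `O(1/Λ)` over a length `6Λ`. For the others the flow height grows linearly away from some
`τ₀`, so its inverse square is integrable uniformly in `Λ`. -/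
theorem exists_lintegral_cellWeight_le (n : ℕ) :
    ∃ W : ℝ≥0, ∀ G : Eucl n → ℝ, (∀ x y, |G x - G y| ≤ 1 / 20 * ‖x - y‖) →
      ∀ σ : ℝ, |σ| = 1 → ∀ Λ : ℝ, 1 ≤ Λ → ∀ c' ω v : Eucl n, ‖v‖ ≤ 1 / 20 →
        ∫⁻ τ in Set.Icc (-(3 * Λ)) (3 * Λ), cellWeight σ Λ G c' (join (ω - τ • v) τ) ≤ W := by
  set I₁ := ∫⁻ c : Eucl n, ENNReal.ofReal (((1 + ‖c‖) ^ (n + 1))⁻¹) with hI₁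
  set I₂ := ∫⁻ τ : ℝ, ENNReal.ofReal (((1 + |τ|) ^ 2)⁻¹) with hI₂
  have hI₁t : I₁ ≠ ∞ := (lintegral_one_add_norm_inv_pow_lt_top n).ne
  have hI₂t : I₂ ≠ ∞ := lintegral_one_add_abs_inv_sq_lt_top.ne
  have hWt : (ENNReal.ofReal 9600 + ENNReal.ofReal 256 * I₂) * I₁ ≠ ∞ :=
    ENNReal.mul_ne_top (ENNReal.add_ne_top.2 ⟨ENNReal.ofReal_ne_top,
      ENNReal.mul_ne_top ENNReal.ofReal_ne_top hI₂t⟩) hI₁t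
  refine ⟨((ENNReal.ofReal 9600 + ENNReal.ofReal 256 * I₂) * I₁).toNNReal,
    fun G hG σ hσ Λ hΛ c' ω v hv => ?_⟩
  rw [ENNReal.coe_toNNReal hWt]
  have hΛ0 : 0 < Λ := by linarith
  set A : Set ℝ := {τ | (Λ / 4 ≤ ‖join (ω - τ • v) τ‖ ∧ ‖join (ω - τ • v) τ‖ ≤ 3 * Λ) ∧
    |τ| ≤ ‖join (ω - τ • v) τ‖ / 10} with hA
  set κ : ℝ → ℝ := fun τ => flowHeight σ Λ G c' (join (ω - τ • v) τ) with hκ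
  obtain ⟨τ₀, hτ₀⟩ : ∃ τ₀, ∀ τ ∈ A, 1 + |τ - τ₀| ≤ 8 * (1 + |κ τ|) := by
    by_cases hne : A.Nonempty
    · refine exists_forall_one_add_abs_le hne fun τ₁ h1 τ₂ h2 => ?_
      exact abs_flowHeight_sub_ge hG hσ hΛ0 c' ω hv (by linarith [h1.1.1]) (by linarith [h2.1.1])
        h2.1.2 h1.2
    · exact ⟨0, fun τ hτ => absurd ⟨τ, hτ⟩ hne⟩
  have hpt : ∀ τ, cellWeight σ Λ G c' (join (ω - τ • v) τ) ≤
      (ENNReal.ofReal (1600 / Λ) +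
        ENNReal.ofReal 256 * ENNReal.ofReal (((1 + |τ - τ₀|) ^ 2)⁻¹)) * I₁ := fun τ => by
    rw [cellWeight]
    by_cases hτ : Λ / 4 ≤ ‖join (ω - τ • v) τ‖ ∧ ‖join (ω - τ • v) τ‖ ≤ 3 * Λ
    · rw [Set.indicator_of_mem (by exact hτ)]
      refine (lintegral_cell_le hG σ Λ c' _).trans (mul_le_mul_left ?_ _)
      change ENNReal.ofReal (4 * ((1 + |κ τ|) ^ 2)⁻¹) ≤ _
      by_cases h10 : |τ| ≤ ‖join (ω - τ • v) τ‖ / 10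
      · refine le_add_left ?_
        rw [← ENNReal.ofReal_mul (by norm_num)]
        apply ENNReal.ofReal_le_ofReal
        have h8 := hτ₀ τ ⟨hτ, h10⟩
        have h9 : (1 + |τ - τ₀|) ^ 2 ≤ 64 * (1 + |κ τ|) ^ 2 := by
          calc _ ≤ (8 * (1 + |κ τ|)) ^ 2 := by gcongr
            _ = _ := by ring
        rw [← div_eq_mul_inv, ← div_eq_mul_inv, div_le_div_iff₀ (by positivity) (by positivity)]
        linarith
      · refine le_add_right ?_
        apply ENNReal.ofReal_le_ofReal
        have h8 : Λ / 20 ≤ |κ τ| := abs_flowHeight_ge hG hσ hΛ0.le c' (by linarith [hτ.1])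
          (by rw [ver_join]; exact not_le.1 h10)
        rw [← div_eq_mul_inv, div_le_div_iff₀ (by positivity) hΛ0]
        nlinarith [mul_nonneg hΛ0.le (abs_nonneg (κ τ))]
    · rw [Set.indicator_of_notMem (by exact hτ)]; exact zero_le
  refine (lintegral_mono hpt).trans ?_
  rw [lintegral_mul_const' _ _ hI₁t, lintegral_add_left measurable_const,
    lintegral_const_mul' _ _ ENNReal.ofReal_ne_top, setLIntegral_const, Real.volume_Icc,
    ← ENNReal.ofReal_mul (by positivity)]
  gcongr
  -- The steep part: `(1600/Λ) · 6Λ = 9600`.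
  · apply le_of_eq; field_simp; norm_num
  · refine (lintegral_mono' Measure.restrict_le_self le_rfl).trans_eq ?_
    exact lintegral_sub_right_eq_self (fun τ : ℝ => ENNReal.ofReal (((1 + |τ|) ^ 2)⁻¹)) τ₀

/-! ### Phase space decomposition of measures on a graph -/

/-- The inverse Fourier transform of `smallBump`. -/
def bumpTransform {m : ℕ} (p : Eucl m) : ℂ := ∫ s, ec (inner ℝ p s) * (smallBump m s : ℂ)

theorem continuous_bumpTransform {m : ℕ} : Continuous (bumpTransform (m := m)) :=
  continuous_integral_ec_mul (θ := fun s p : Eucl m => inner ℝ p s) integrable_smallBump.ofReal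
    (fun p => by fun_prop) (fun y => by fun_prop)

theorem norm_ec_sub_one_le (x : ℝ) : ‖ec x - 1‖ ≤ 2 * Real.pi * |x| := by
  have h := Real.norm_exp_I_mul_ofReal_sub_one_le (x := 2 * Real.pi * x)
  rw [mul_comm Complex.I] at h
  refine h.trans_eq ?_
  rw [Real.norm_eq_abs, abs_mul, abs_of_pos (by positivity)]

/-- On the support of the bump the phase is at most `2π · 2 · (1/32) = π/8 ≤ 1/2`, so the transform
stays within `1/2` of its value `1` at the origin. This permits division by it on pieces of graph
over unit balls. -/
theorem half_le_norm_bumpTransform {m : ℕ} {p : Eucl m} (hp : ‖p‖ ≤ 2) :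
    1 / 2 ≤ ‖bumpTransform p‖ := by
  have hi : Integrable fun s : Eucl m => ec (inner ℝ p s) * (smallBump m s : ℂ) :=
    integrable_smallBump.ofReal.mono' (by
      refine Measurable.aestronglyMeasurable ?_
      have := (contDiff_smallBump (m := m)).continuous.measurable
      fun_prop)
      (Filter.Eventually.of_forall fun s => by simp [abs_of_nonneg (smallBump_nonneg s)]) |>.congr
        (Filter.EventuallyEq.rfl)
  have h1 : bumpTransform p - 1 = ∫ s, (ec (inner ℝ p s) - 1) * (smallBump m s : ℂ) := by
    have h2 : (1 : ℂ) = ∫ s, ((smallBump m s : ℝ) : ℂ) := by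
      rw [integral_complex_ofReal, integral_smallBump, Complex.ofReal_one]
    have hk : Integrable fun s : Eucl m => ((smallBump m s : ℝ) : ℂ) := integrable_smallBump.ofReal
    rw [bumpTransform]
    nth_rewrite 1 [h2]
    rw [← integral_sub hi hk]
    congr 1; ext s; ring
  have h2 : ‖bumpTransform p - 1‖ ≤ ∫ s, (1 / 2) * smallBump m s := by
    rw [h1]
    refine norm_integral_le_of_norm_le (integrable_smallBump.const_mul _)
      (Filter.Eventually.of_forall fun s => ?_)
    rw [norm_mul, Complex.norm_real, Real.norm_eq_abs, abs_of_nonneg (smallBump_nonneg s)]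
    by_cases hs : smallBump m s = 0
    · simp [hs]
    refine mul_le_mul_of_nonneg_right ?_ (smallBump_nonneg s)
    refine (norm_ec_sub_one_le _).trans ?_
    have h3 : |inner ℝ p s| ≤ 2 * (1 / 32) := (abs_real_inner_le_norm p s).trans
      (mul_le_mul hp (norm_le_of_smallBump_ne_zero hs) (norm_nonneg _) (by norm_num))
    nlinarith [Real.pi_pos, Real.pi_le_four, abs_nonneg (inner ℝ p s : ℝ)]
  rw [integral_const_mul, integral_smallBump, mul_one] at h2
  have h3 := norm_sub_norm_le (1 : ℂ) (bumpTransform p)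
  rw [norm_one, norm_sub_rev] at h3
  linarith

/-- Graphs of slope at most `1/20` which stay within `K |y - c|²` of their tangent planes. -/
structure IsFlatGraph {n : ℕ} (K : ℝ) (G : Eucl n → ℝ) : Prop where
  lip : ∀ x y, |G x - G y| ≤ 1 / 20 * ‖x - y‖
  flat : ∀ c, ∃ v : Eucl n, ‖v‖ ≤ 1 / 20 ∧ ∀ y, |G y - G c - inner ℝ (y - c) v| ≤ K * ‖y - c‖ ^ 2

theorem IsFlatGraph.continuous {n : ℕ} {K : ℝ} {G : Eucl n → ℝ} (h : IsFlatGraph K G) :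
    Continuous G :=
  (LipschitzWith.of_dist_le_mul (K := 1 / 20) fun x y => by
    simpa [Real.dist_eq, dist_eq_norm] using h.lip x y).continuous

theorem IsFlatGraph.norm_graphPoint_sub_le {n : ℕ} {K : ℝ} {G : Eucl n → ℝ} (h : IsFlatGraph K G)
    {y c : Eucl n} (hyc : ‖y - c‖ ≤ 1) : ‖graphPoint G y - graphPoint G c‖ ≤ 2 := by
  refine (norm_le_hor_add_ver _).trans ?_
  simp only [hor_sub, ver_sub, graphPoint_eq_join, hor_join, ver_join]
  linarith [h.lip y c]

/-- The restriction of `f` to the unit ball about `c`, corrected by `bumpTransform`. -/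
def cellFun {n : ℕ} (G : Eucl n → ℝ) (f : Eucl n → ℂ) (c y : Eucl n) : ℂ :=
  {p : Eucl n × Eucl n | ‖p.2 - p.1‖ ≤ 1}.indicator
    (fun p => (bumpTransform (graphPoint G p.2 - graphPoint G p.1))⁻¹ * f p.2) (c, y)

theorem cellFun_of_le {n : ℕ} (G : Eucl n → ℝ) (f : Eucl n → ℂ) {c y : Eucl n}
    (h : ‖y - c‖ ≤ 1) :
    cellFun G f c y = (bumpTransform (graphPoint G y - graphPoint G c))⁻¹ * f y :=
  Set.indicator_of_mem (by exact h) _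

theorem cellFun_of_not_le {n : ℕ} (G : Eucl n → ℝ) (f : Eucl n → ℂ) {c y : Eucl n}
    (h : ¬ ‖y - c‖ ≤ 1) : cellFun G f c y = 0 :=
  Set.indicator_of_notMem (by exact h) _

theorem measurableSet_near {n : ℕ} :
    MeasurableSet {p : Eucl n × Eucl n | ‖p.2 - p.1‖ ≤ 1} :=
  measurableSet_Iic.preimage (f := fun p : Eucl n × Eucl n => ‖p.2 - p.1‖) (by fun_prop)

theorem measurable_cellFun {n : ℕ} {G : Eucl n → ℝ} (hG : Measurable G) {f : Eucl n → ℂ}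
    (hf : Measurable f) : Measurable fun p : Eucl n × Eucl n => cellFun G f p.1 p.2 := by
  have h1 := measurable_graphPoint hG
  have h2 := (continuous_bumpTransform (m := n + 1)).measurable
  exact Measurable.indicator (f := fun p : Eucl n × Eucl n =>
    (bumpTransform (graphPoint G p.2 - graphPoint G p.1))⁻¹ * f p.2) (by fun_prop)
    measurableSet_near

attribute [irreducible] cellFun

theorem norm_cellFun_le {n : ℕ} {K : ℝ} {G : Eucl n → ℝ} (hG : IsFlatGraph K G) (f : Eucl n → ℂ)
    (c y : Eucl n) : ‖cellFun G f c y‖ ≤ {p : Eucl n × Eucl n | ‖p.2 - p.1‖ ≤ 1}.indicator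
      (fun p => 2 * ‖f p.2‖) (c, y) := by
  by_cases h : ‖y - c‖ ≤ 1
  · rw [cellFun_of_le G f h, Set.indicator_of_mem (by exact h), norm_mul, norm_inv]
    have h1 := half_le_norm_bumpTransform (hG.norm_graphPoint_sub_le h)
    gcongr
    rw [inv_le_comm₀ (by linarith) (by norm_num)]
    linarith
  · rw [cellFun_of_not_le G f h, Set.indicator_of_notMem (by exact h), norm_zero]

theorem norm_cellFun_le' {n : ℕ} {K : ℝ} {G : Eucl n → ℝ} (hG : IsFlatGraph K G) (f : Eucl n → ℂ)
    (c y : Eucl n) : ‖cellFun G f c y‖ ≤ 2 * ‖f y‖ :=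
  (norm_cellFun_le hG f c y).trans (Set.indicator_apply_le' (fun _ => le_rfl)
    (fun _ => by positivity))

theorem norm_sub_le_of_cellFun_ne_zero {n : ℕ} {G : Eucl n → ℝ} {f : Eucl n → ℂ} {c y : Eucl n}
    (h : cellFun G f c y ≠ 0) : ‖y - c‖ ≤ 1 := by
  by_contra h'
  exact h (cellFun_of_not_le G f h')

theorem bddSupp_cellFun {n : ℕ} {K : ℝ} {G : Eucl n → ℝ} (hG : IsFlatGraph K G) {f : Eucl n → ℂ}
    (hf : BddSupp f) (c : Eucl n) : BddSupp (cellFun G f c) := by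
  obtain ⟨B, hB⟩ := hf.bdd
  obtain ⟨R, hR⟩ := hf.supp
  have hm : Measurable ((fun p : Eucl n × Eucl n => cellFun G f p.1 p.2) ∘ fun y => (c, y)) :=
    (measurable_cellFun hG.continuous.measurable hf.meas).comp (by fun_prop)
  refine ⟨hm, ⟨2 * B, fun y => ?_⟩, R, fun y hy => ?_⟩
  · exact (norm_cellFun_le' hG f c y).trans (by linarith [hB y])
  · have := norm_cellFun_le' hG f c y
    rw [hR y hy, norm_zero, mul_zero] at this
    exact norm_le_zero_iff.1 this

/-- The phase space coefficients of `f`. -/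
def cellCoeff {n : ℕ} (G : Eucl n → ℝ) (f : Eucl n → ℂ) (p : Eucl n × Eucl (n + 1)) : ℂ :=
  ∫ y, ec (-inner ℝ (graphPoint G y - graphPoint G p.1) p.2) * cellFun G f p.1 y

theorem measurable_cellCoeff {n : ℕ} {G : Eucl n → ℝ} (hG : Measurable G) {f : Eucl n → ℂ}
    (hf : Measurable f) : Measurable (cellCoeff G f) := by
  have h1 := measurable_graphPoint hG
  have h2 := measurable_cellFun hG hf
  have h3 : Measurable fun q : (Eucl n × Eucl (n + 1)) × Eucl n =>
      ec (-inner ℝ (graphPoint G q.2 - graphPoint G q.1.1) q.1.2) * cellFun G f q.1.1 q.2 := by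
    have h4 : Measurable fun q : (Eucl n × Eucl (n + 1)) × Eucl n => cellFun G f q.1.1 q.2 :=
      h2.comp (by fun_prop : Measurable fun q : (Eucl n × Eucl (n + 1)) × Eucl n => (q.1.1, q.2))
    fun_prop
  exact h3.stronglyMeasurable.integral_prod_right'.measurable

theorem exists_norm_cellCoeff_le {n : ℕ} {K : ℝ} {G : Eucl n → ℝ} (hG : IsFlatGraph K G)
    {f : Eucl n → ℂ} (hf : BddSupp f) :
    ∃ B R : ℝ, 0 ≤ B ∧ ∀ p : Eucl n × Eucl (n + 1),
      ‖cellCoeff G f p‖ ≤ (Metric.closedBall (0 : Eucl n) R).indicator (fun _ => B) p.1 := by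
  obtain ⟨R, hR⟩ := hf.supp
  refine ⟨∫ y, 2 * ‖f y‖, R + 1, by positivity, fun p => ?_⟩
  by_cases hp : ‖p.1‖ ≤ R + 1
  · rw [Set.indicator_of_mem (by simpa using hp)]
    refine norm_integral_le_of_norm_le (hf.integrable.norm.const_mul 2)
      (Filter.Eventually.of_forall fun y => ?_)
    rw [norm_mul, norm_ec, one_mul]
    exact norm_cellFun_le' hG f p.1 y
  · rw [Set.indicator_of_notMem (by simpa using hp)]
    have h0 : ∀ y, cellFun G f p.1 y = 0 := fun y => by
      by_contra h
      have h1 := norm_sub_le_of_cellFun_ne_zero h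
      have h2 : f y = 0 := hR y (by
        have := norm_sub_norm_le p.1 y
        rw [norm_sub_rev] at this
        linarith [not_le.1 hp])
      have h3 := norm_cellFun_le' hG f p.1 y
      rw [h2, norm_zero, mul_zero] at h3
      exact h (norm_le_zero_iff.1 h3)
    simp [cellCoeff, h0]

/-- Smearing the frequency by `smallBump` multiplies the density on the spatial side by
`bumpTransform`, and `cellFun` was divided by exactly this factor in advance. The smeared
coefficients thus reproduce the transform of the localized density without error. -/
theorem integral_smallBump_mul_cellCoeff {n : ℕ} {K : ℝ} {G : Eucl n → ℝ} (hG : IsFlatGraph K G)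
    {f : Eucl n → ℂ} (hf : BddSupp f) (c : Eucl n) (ζ : Eucl (n + 1)) :
    ∫ μ, (smallBump (n + 1) (ζ - μ) : ℂ) * cellCoeff G f (c, μ) =
      ∫ y, {p : Eucl n × Eucl n | ‖p.2 - p.1‖ ≤ 1}.indicator
        (fun p => ec (-inner ℝ (graphPoint G p.2 - graphPoint G p.1) ζ) * f p.2) (c, y) := by
  have hGm := measurable_graphPoint hG.continuous.measurable
  have hκ := (contDiff_smallBump (m := n + 1)).continuous.measurable
  have hc := bddSupp_cellFun hG hf c
  have hcm := hc.meas
  have hκi : Integrable fun μ : Eucl (n + 1) => smallBump (n + 1) (ζ - μ) :=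
    integrable_smallBump.comp_sub_left ζ
  simp only [cellCoeff]
  simp_rw [← integral_const_mul]
  rw [integral_integral_swap]
  · congr 1; ext y
    by_cases hy : ‖y - c‖ ≤ 1
    · rw [Set.indicator_of_mem (by exact hy)]
      set p := graphPoint G y - graphPoint G c with hp
      have hne : bumpTransform p ≠ 0 := by
        have := half_le_norm_bumpTransform (hG.norm_graphPoint_sub_le hy)
        rw [← norm_pos_iff]; linarith
      have e1 : cellFun G f c y = (bumpTransform p)⁻¹ * f y := cellFun_of_le G f hy
      rw [e1, ← integral_sub_left_eq_self _ volume ζ]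
      have e2 : ∀ s, (smallBump (n + 1) (ζ - (ζ - s)) : ℂ) *
          (ec (-inner ℝ p (ζ - s)) * ((bumpTransform p)⁻¹ * f y)) =
          (ec (-inner ℝ p ζ) * ((bumpTransform p)⁻¹ * f y)) *
            (ec (inner ℝ p s) * (smallBump (n + 1) s : ℂ)) := fun s => by
        rw [sub_sub_cancel, inner_sub_right, neg_sub, sub_eq_add_neg, ec_add]; ring
      simp_rw [e2]
      rw [integral_const_mul]
      change _ * bumpTransform p = _
      field_simp
    · rw [Set.indicator_of_notMem (by exact hy)]
      have e1 : cellFun G f c y = 0 := cellFun_of_not_le G f hy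
      simp [e1]
  · refine (hκi.mul_prod hc.integrable.norm).mono' (Measurable.aestronglyMeasurable ?_)
      (Filter.Eventually.of_forall fun q => ?_)
    · simp only [Function.uncurry_def]; fun_prop
    · simp [Function.uncurry, abs_of_nonneg (smallBump_nonneg _)]

/-- Each `y` lies in the unit balls about a set of centres `c` of volume that of the unit ball, so
integrating the localized identities over `c` counts every point equally. The outer exponential
undoes the recentring at `graphPoint G c`. -/
theorem gHat_eq_integral_cellCoeff {n : ℕ} {K : ℝ} {G : Eucl n → ℝ} (hG : IsFlatGraph K G)
    {f : Eucl n → ℂ} (hf : BddSupp f) (ζ : Eucl (n + 1)) :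
    ((volume (Metric.closedBall (0 : Eucl n) 1)).toReal : ℂ) * gHat G f ζ =
      ∫ c, ∫ μ, ec (-inner ℝ (graphPoint G c) ζ) *
        ((smallBump (n + 1) (ζ - μ) : ℂ) * cellCoeff G f (c, μ)) := by
  have hGm := measurable_graphPoint hG.continuous.measurable
  have hfm := hf.meas
  obtain ⟨R, hR⟩ := hf.supp
  simp_rw [integral_const_mul, integral_smallBump_mul_cellCoeff hG hf, ← integral_const_mul]
  have e1 : ∀ c y : Eucl n, ec (-inner ℝ (graphPoint G c) ζ) *
      {p : Eucl n × Eucl n | ‖p.2 - p.1‖ ≤ 1}.indicator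
        (fun p => ec (-inner ℝ (graphPoint G p.2 - graphPoint G p.1) ζ) * f p.2) (c, y) =
      (Metric.closedBall y 1).indicator (fun _ => ec (-inner ℝ (graphPoint G y) ζ) * f y) c :=
    fun c y => by
    have hiff : c ∈ Metric.closedBall y 1 ↔ ‖y - c‖ ≤ 1 := by
      rw [mem_closedBall_iff_norm, norm_sub_rev]
    by_cases hy : ‖y - c‖ ≤ 1
    · rw [Set.indicator_of_mem (by exact hy), Set.indicator_of_mem (hiff.2 hy), ← mul_assoc,
        ← ec_add]
      congr 2
      rw [inner_sub_left]; ring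
    · rw [Set.indicator_of_notMem (by exact hy), Set.indicator_of_notMem (fun h => hy (hiff.1 h)),
        mul_zero]
  simp_rw [e1]
  rw [integral_integral_swap]
  · rw [gHat, ← integral_const_mul]
    congr 1; ext y
    rw [integral_indicator Metric.isClosed_closedBall.measurableSet, setIntegral_const,
      Measure.addHaar_real_closedBall_center, Measure.real, Complex.real_smul]
  · have h2 : Integrable fun p : Eucl n × Eucl n =>
        (Metric.closedBall (0 : Eucl n) (R + 1)).indicator (fun _ => (1 : ℝ)) p.1 * ‖f p.2‖ := by
      refine Integrable.mul_prod ?_ hf.integrable.norm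
      exact (integrable_indicator_iff Metric.isClosed_closedBall.measurableSet).2
        (integrableOn_const measure_closedBall_lt_top.ne)
    have e2 : Function.uncurry (fun c y : Eucl n => (Metric.closedBall y 1).indicator
        (fun _ => ec (-inner ℝ (graphPoint G y) ζ) * f y) c) =
        {p : Eucl n × Eucl n | ‖p.2 - p.1‖ ≤ 1}.indicator fun q =>
          ec (-inner ℝ (graphPoint G q.2) ζ) * f q.2 := by
      ext q
      simp only [Function.uncurry, Set.indicator, mem_closedBall_iff_norm, Set.mem_ofPred_eq,
        norm_sub_rev q.1]
    rw [e2]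
    refine h2.mono' (Measurable.aestronglyMeasurable (Measurable.indicator (by fun_prop)
      measurableSet_near)) (Filter.Eventually.of_forall fun q => ?_)
    by_cases hq : ‖q.2 - q.1‖ ≤ 1
    · rw [Set.indicator_of_mem (by exact hq), norm_mul, norm_ec, one_mul]
      by_cases hR' : R < ‖q.2‖
      · rw [hR _ hR']; simp
      · rw [Set.indicator_of_mem, one_mul]
        rw [mem_closedBall_zero_iff]
        have := norm_sub_norm_le q.1 q.2
        rw [norm_sub_rev] at this
        linarith
    · rw [Set.indicator_of_notMem (by exact hq), norm_zero]
      exact mul_nonneg (Set.indicator_nonneg (fun _ _ => zero_le_one) _) (norm_nonneg _)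

attribute [local irreducible] annulusCutoff smallBump cellCoeff coneIntegral

/-! ### Bilinear forms and Schur's test -/

theorem integral_mul_mul_conj_eq {X Z : Type*} [MeasurableSpace X] [MeasurableSpace Z]
    {μ : Measure X} {ν : Measure Z} [SFinite μ] [SFinite ν] {a : Z → ℂ} (ha : Integrable a ν)
    {k : Z → X → ℂ} (hk : Measurable (Function.uncurry k)) {b : ℝ} (hb : ∀ z x, ‖k z x‖ ≤ b)
    {F G : X → ℂ} (hF : Integrable F μ) (hG : Integrable G μ) :
    ∫ z, a z * (∫ x, k z x * F x ∂μ) * (starRingEnd ℂ) (∫ x, k z x * G x ∂μ) ∂ν =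
      ∫ p, F p.1 * (starRingEnd ℂ) (G p.2) *
        (∫ z, a z * k z p.1 * (starRingEnd ℂ) (k z p.2) ∂ν) ∂(μ.prod μ) := by
  have e1 : ∀ z, a z * (∫ x, k z x * F x ∂μ) * (starRingEnd ℂ) (∫ x, k z x * G x ∂μ) =
      ∫ p, a z * ((k z p.1 * F p.1) * (starRingEnd ℂ) (k z p.2 * G p.2)) ∂(μ.prod μ) := fun z => by
    rw [integral_const_mul, integral_prod_mul (fun x => k z x * F x)
      (fun x => (starRingEnd ℂ) (k z x * G x)), integral_conj, mul_assoc]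
  simp_rw [e1]
  have hGc : Integrable (fun x => (starRingEnd ℂ) (G x)) μ :=
    (Complex.conjCLE.toContinuousLinearMap.integrable_comp hG)
  rw [integral_integral_swap]
  · congr 1; ext p
    rw [← integral_const_mul]
    congr 1; ext z
    rw [map_mul]; ring
  · have h1 : Integrable (fun q : Z × (X × X) => a q.1 * (F q.2.1 * (starRingEnd ℂ) (G q.2.2)))
        (ν.prod (μ.prod μ)) := ha.mul_prod (hF.mul_prod hGc)
    have hk1 : Measurable fun q : Z × (X × X) => k q.1 q.2.1 :=
      hk.comp (measurable_fst.prodMk (measurable_fst.comp measurable_snd))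
    have hk2 : Measurable fun q : Z × (X × X) => k q.1 q.2.2 :=
      hk.comp (measurable_fst.prodMk (measurable_snd.comp measurable_snd))
    have hcm : Measurable (starRingEnd ℂ) := Complex.continuous_conj.measurable
    refine (h1.bdd_mul (c := b * b) (f := fun q => k q.1 q.2.1 * (starRingEnd ℂ) (k q.1 q.2.2))
      (hk1.mul (hcm.comp hk2)).aestronglyMeasurable
      (Filter.Eventually.of_forall fun q => ?_)).congr (Filter.Eventually.of_forall fun q => ?_)
    · rw [norm_mul, RCLike.norm_conj]
      exact mul_le_mul (hb _ _) (hb _ _) (norm_nonneg _) ((norm_nonneg _).trans (hb q.1 q.2.1))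
    · simp only [Function.uncurry, map_mul]; ring

/-- Cauchy–Schwarz after splitting `J = J^{1/2} J^{1/2}`. The row and column sums are kept as
weights, since here they are not uniformly bounded. -/
theorem sq_lintegral_schur_le {X : Type*} [MeasurableSpace X] {μ : Measure X} [SFinite μ]
    {F G : X → ℝ≥0∞} (hF : Measurable F) (hG : Measurable G) {J : X × X → ℝ≥0∞}
    (hJ : Measurable J) {w₁ w₂ : X → ℝ≥0∞} (h₁ : ∀ x, ∫⁻ y, J (x, y) ∂μ ≤ w₁ x)
    (h₂ : ∀ y, ∫⁻ x, J (x, y) ∂μ ≤ w₂ y) :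
    (∫⁻ p, F p.1 * G p.2 * J p ∂(μ.prod μ)) ^ 2 ≤
      (∫⁻ x, w₁ x * F x ^ 2 ∂μ) * ∫⁻ y, w₂ y * G y ^ 2 ∂μ := by
  have hs : ∀ a : ℝ≥0∞, a ^ (1 / 2 : ℝ) * a ^ (1 / 2 : ℝ) = a := fun a => by
    rw [← ENNReal.rpow_add_of_nonneg _ _ (by norm_num) (by norm_num)]; norm_num
  have hs2 : ∀ a : ℝ≥0∞, (a ^ (1 / 2 : ℝ)) ^ 2 = a := fun a => by rw [sq, hs]
  have hF1 : Measurable fun p : X × X => F p.1 := hF.comp measurable_fst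
  have hG1 : Measurable fun p : X × X => G p.2 := hG.comp measurable_snd
  have e1 : ∀ p : X × X, F p.1 * G p.2 * J p =
      (F p.1 * J p ^ (1 / 2 : ℝ)) * (G p.2 * J p ^ (1 / 2 : ℝ)) := fun p => by
    nth_rewrite 1 [← hs (J p)]; ring
  simp_rw [e1]
  refine (sq_lintegral_mul_le (by fun_prop) (by fun_prop)).trans (mul_le_mul' ?_ ?_)
  · simp_rw [mul_pow, hs2]
    rw [lintegral_prod _ (by fun_prop)]
    refine lintegral_mono fun x => ?_
    change ∫⁻ y, F x ^ 2 * J (x, y) ∂μ ≤ _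
    rw [lintegral_const_mul _ (by fun_prop), mul_comm]
    exact mul_le_mul_left (h₁ x) _
  · simp_rw [mul_pow, hs2]
    rw [lintegral_prod_symm _ (by fun_prop)]
    refine lintegral_mono fun y => ?_
    change ∫⁻ x, G y ^ 2 * J (x, y) ∂μ ≤ _
    rw [lintegral_const_mul _ (by fun_prop), mul_comm]
    exact mul_le_mul_left (h₂ y) _

/-! ### The frequency-localized half-wave form between two measures on a graph -/

/-- The pairing of `e^{2πit|D|}`, localized to frequencies of size `ϱ`, with two measures carried
by the graph of `G`. -/
def waveForm {n : ℕ} (ϱ t : ℝ) (G : Eucl n → ℝ) (f g : Eucl n → ℂ) : ℂ :=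
  ∫ ζ, ((annulusCutoff (ϱ⁻¹ • ζ) : ℂ) * ec (t * ‖ζ‖)) * gHat G f ζ * (starRingEnd ℂ) (gHat G g ζ)

theorem measurable_annulusCutoff {m : ℕ} : Measurable (annulusCutoff (m := m)) :=
  contDiff_annulusCutoff.continuous.measurable

theorem measurable_smallBump {m : ℕ} : Measurable (smallBump m) :=
  contDiff_smallBump.continuous.measurable

theorem exists_smallBump_le (m : ℕ) : ∃ b : ℝ, ∀ s, smallBump m s ≤ b := by
  obtain ⟨C, hC⟩ := (isCompact_closedBall (0 : Eucl m) (1 / 32)).exists_bound_of_continuousOn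
    (contDiff_smallBump (m := m)).continuous.continuousOn
  refine ⟨max 0 C, fun s => ?_⟩
  by_cases h : smallBump m s = 0
  · rw [h]; exact le_max_left _ _
  · exact ((le_abs_self _).trans (hC s (by simpa using norm_le_of_smallBump_ne_zero h))).trans
      (le_max_right _ _)

theorem norm_le_of_annulusCutoff_ne_zero {m : ℕ} {ϱ : ℝ} (hϱ : 0 < ϱ) {ζ : Eucl m}
    (h : annulusCutoff (ϱ⁻¹ • ζ) ≠ 0) : ‖ζ‖ ≤ 5 / 2 * ϱ := by
  have h1 := (norm_mem_of_annulusCutoff_ne_zero h).2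
  rw [norm_smul, Real.norm_eq_abs, abs_of_pos (inv_pos.2 hϱ), inv_mul_le_iff₀ hϱ] at h1
  linarith

theorem integrable_annulusCutoff_ec {m : ℕ} {ϱ : ℝ} (hϱ : 0 < ϱ) (t : ℝ) :
    Integrable fun ζ : Eucl m => (annulusCutoff (ϱ⁻¹ • ζ) : ℂ) * ec (t * ‖ζ‖) := by
  have h1 : Integrable ((Metric.closedBall (0 : Eucl m) (5 / 2 * ϱ)).indicator
      fun _ => (1 : ℝ)) :=
    (integrable_indicator_iff Metric.isClosed_closedBall.measurableSet).2
      (integrableOn_const measure_closedBall_lt_top.ne)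
  refine h1.mono' (Measurable.aestronglyMeasurable ?_) (Filter.Eventually.of_forall fun ζ => ?_)
  · have := measurable_annulusCutoff (m := m)
    fun_prop
  · rw [norm_mul, norm_ec, mul_one, Complex.norm_real, Real.norm_eq_abs,
      abs_of_nonneg (annulusCutoff_nonneg _)]
    by_cases h : annulusCutoff (ϱ⁻¹ • ζ) = 0
    · rw [h]; exact Set.indicator_nonneg (fun _ _ => zero_le_one) _
    · rw [Set.indicator_of_mem (by simpa using norm_le_of_annulusCutoff_ne_zero hϱ h)]
      exact annulusCutoff_le_one _

/-- The phase space coefficients of `f` at frequencies at most `L`. -/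
def lowCoeff {n : ℕ} (L : ℝ) (G : Eucl n → ℝ) (f : Eucl n → ℂ) (p : Eucl n × Eucl (n + 1)) : ℂ :=
  {p : Eucl n × Eucl (n + 1) | ‖p.2‖ ≤ L}.indicator (cellCoeff G f) p

theorem measurableSet_low {n : ℕ} (L : ℝ) :
    MeasurableSet {p : Eucl n × Eucl (n + 1) | ‖p.2‖ ≤ L} :=
  measurableSet_Iic.preimage (f := fun p : Eucl n × Eucl (n + 1) => ‖p.2‖) (by fun_prop)

theorem measurable_lowCoeff {n : ℕ} (L : ℝ) {G : Eucl n → ℝ} (hG : Measurable G) {f : Eucl n → ℂ}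
    (hf : Measurable f) : Measurable (lowCoeff L G f) :=
  (measurable_cellCoeff hG hf).indicator (measurableSet_low L)

theorem integrable_lowCoeff {n : ℕ} (L : ℝ) {K : ℝ} {G : Eucl n → ℝ} (hG : IsFlatGraph K G)
    {f : Eucl n → ℂ} (hf : BddSupp f) :
    Integrable (lowCoeff L G f) (volume.prod volume) := by
  obtain ⟨B, R, hB, h⟩ := exists_norm_cellCoeff_le hG hf
  have hi : ∀ (m : ℕ) (c r : ℝ),
      Integrable ((Metric.closedBall (0 : Eucl m) r).indicator fun _ => c) := fun m c r =>
    (integrable_indicator_iff Metric.isClosed_closedBall.measurableSet).2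
      (integrableOn_const measure_closedBall_lt_top.ne)
  refine ((hi n B R).mul_prod (hi (n + 1) 1 L)).mono'
    (measurable_lowCoeff L hG.continuous.measurable hf.meas).aestronglyMeasurable
    (Filter.Eventually.of_forall fun p => ?_)
  rw [lowCoeff]
  by_cases hp : ‖p.2‖ ≤ L
  · rw [Set.indicator_of_mem (by exact hp),
      Set.indicator_of_mem (s := Metric.closedBall (0 : Eucl (n + 1)) L) (by simpa using hp), mul_one]
    exact h p
  · rw [Set.indicator_of_notMem (by exact hp), norm_zero]
    exact mul_nonneg (Set.indicator_nonneg (fun _ _ => hB) _)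
      (Set.indicator_nonneg (fun _ _ => zero_le_one) _)

/-- The kernel which reconstructs a measure on a graph from its phase space coefficients. -/
def cellKernel {n : ℕ} (G : Eucl n → ℝ) (ζ : Eucl (n + 1)) (p : Eucl n × Eucl (n + 1)) : ℂ :=
  ec (-inner ℝ (graphPoint G p.1) ζ) * (smallBump (n + 1) (ζ - p.2) : ℂ)

theorem measurable_cellKernel {n : ℕ} {G : Eucl n → ℝ} (hG : Measurable G) :
    Measurable (Function.uncurry (cellKernel G)) := by
  have h1 := measurable_graphPoint hG
  have h2 := measurable_smallBump (m := n + 1)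
  unfold cellKernel
  simp only [Function.uncurry_def]
  fun_prop

/-- Only frequencies within `1/32` of `ζ` enter the reconstruction, so truncation changes nothing
for smaller `ζ`. It makes the coefficients integrable on the whole phase space, which Fubini
requires. -/
theorem gHat_eq_integral_lowCoeff {n : ℕ} {K L : ℝ} {G : Eucl n → ℝ} (hG : IsFlatGraph K G)
    {f : Eucl n → ℂ} (hf : BddSupp f) {ζ : Eucl (n + 1)} (hζ : ‖ζ‖ + 1 / 32 ≤ L) :
    ((volume (Metric.closedBall (0 : Eucl n) 1)).toReal : ℂ) * gHat G f ζ =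
      ∫ p, cellKernel G ζ p * lowCoeff L G f p ∂(volume.prod volume) := by
  obtain ⟨b, hb⟩ := exists_smallBump_le (n + 1)
  rw [gHat_eq_integral_cellCoeff hG hf, integral_prod]
  · congr 1; ext c; congr 1; ext μ
    rw [cellKernel, mul_assoc]
    by_cases h : smallBump (n + 1) (ζ - μ) = 0
    · simp [h]
    · congr 2
      rw [lowCoeff, Set.indicator_of_mem]
      have h1 := norm_le_of_smallBump_ne_zero h
      have h2 := norm_sub_norm_le μ ζ
      rw [norm_sub_rev] at h2
      change ‖μ‖ ≤ L
      linarith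
  · refine (integrable_lowCoeff L hG hf).bdd_mul (c := b)
      ((measurable_cellKernel hG.continuous.measurable).comp
        (measurable_const.prodMk measurable_id)).aestronglyMeasurable
      (Filter.Eventually.of_forall fun p => ?_)
    rw [cellKernel, norm_mul, norm_ec, one_mul, Complex.norm_real, Real.norm_eq_abs,
      abs_of_nonneg (smallBump_nonneg _)]
    exact hb _

/-- Inserting the reconstruction in both slots exhibits `coneIntegral` as the matrix of the form
between cells. The truncation `3Λ` is harmless because the cutoff lives in `‖ζ‖ ≤ 5Λ/2` and `Λ ≥ 1`.
-/
theorem waveForm_eq_integral {n : ℕ} {K σ Λ : ℝ} {G : Eucl n → ℝ} (hG : IsFlatGraph K G)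
    (hΛ : 1 ≤ Λ) {f g : Eucl n → ℂ} (hf : BddSupp f) (hg : BddSupp g) :
    ((volume (Metric.closedBall (0 : Eucl n) 1)).toReal : ℂ) ^ 2 * waveForm Λ (σ * Λ) G f g =
      ∫ p : (Eucl n × Eucl (n + 1)) × (Eucl n × Eucl (n + 1)),
        lowCoeff (3 * Λ) G f p.1 * (starRingEnd ℂ) (lowCoeff (3 * Λ) G g p.2) *
          coneIntegral σ Λ (graphPoint G p.2.1 - graphPoint G p.1.1) p.1.2 p.2.2
        ∂((volume.prod volume).prod (volume.prod volume)) := by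
  have hΛ0 : 0 < Λ := by linarith
  obtain ⟨b, hb⟩ := exists_smallBump_le (n + 1)
  set V : ℝ := (volume (Metric.closedBall (0 : Eucl n) 1)).toReal with hV
  have e1 : (V : ℂ) ^ 2 * waveForm Λ (σ * Λ) G f g =
      ∫ ζ, ((annulusCutoff (Λ⁻¹ • ζ) : ℂ) * ec (σ * Λ * ‖ζ‖)) *
        (∫ p, cellKernel G ζ p * lowCoeff (3 * Λ) G f p ∂(volume.prod volume)) *
        (starRingEnd ℂ) (∫ p, cellKernel G ζ p * lowCoeff (3 * Λ) G g p ∂(volume.prod volume)) := by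
    rw [waveForm, ← integral_const_mul]
    congr 1; ext ζ
    by_cases h : annulusCutoff (Λ⁻¹ • ζ) = 0
    · simp [h]
    · have h1 := norm_le_of_annulusCutoff_ne_zero hΛ0 h
      rw [← gHat_eq_integral_lowCoeff hG hf (by linarith),
        ← gHat_eq_integral_lowCoeff hG hg (by linarith), ← hV, map_mul, Complex.conj_ofReal]
      ring
  rw [e1, integral_mul_mul_conj_eq (integrable_annulusCutoff_ec hΛ0 _)
    (measurable_cellKernel hG.continuous.measurable) (b := b) (fun ζ p => ?_)
    (integrable_lowCoeff _ hG hf) (integrable_lowCoeff _ hG hg)]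
  · congr 1; ext p
    congr 1
    rw [coneIntegral]
    congr 1; ext ζ
    rw [cellKernel, cellKernel, map_mul, conj_ec, Complex.conj_ofReal, inner_sub_left, neg_neg,
      ec_add, sub_eq_add_neg (inner ℝ _ _ : ℝ), ec_add, mul_assoc σ]
    push_cast
    ring
  · rw [cellKernel, norm_mul, norm_ec, one_mul, Complex.norm_real, Real.norm_eq_abs,
      abs_of_nonneg (smallBump_nonneg _)]
    exact hb _

/-! ### The fixed time estimate at unit scale -/

theorem measurable_coneIntegral {n : ℕ} (σ Λ : ℝ) {G : Eucl n → ℝ} (hG : Measurable G) :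
    Measurable fun p : (Eucl n × Eucl (n + 1)) × (Eucl n × Eucl (n + 1)) =>
      coneIntegral σ Λ (graphPoint G p.2.1 - graphPoint G p.1.1) p.1.2 p.2.2 := by
  have h1 := measurable_graphPoint hG
  have h2 := measurable_smallBump (m := n + 1)
  have h3 := measurable_annulusCutoff (m := n + 1)
  unfold coneIntegral
  refine StronglyMeasurable.measurable (StronglyMeasurable.integral_prod_right' (f := fun q :
    ((Eucl n × Eucl (n + 1)) × (Eucl n × Eucl (n + 1))) × Eucl (n + 1) =>
      ((annulusCutoff (Λ⁻¹ • q.2) * smallBump (n + 1) (q.2 - q.1.1.2) *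
        smallBump (n + 1) (q.2 - q.1.2.2) : ℝ) : ℂ) *
      ec (σ * (Λ * ‖q.2‖) + inner ℝ (graphPoint G q.1.2.1 - graphPoint G q.1.1.1) q.2)) ?_)
  exact (by fun_prop : Measurable _).stronglyMeasurable

/-- The row sum in Schur's test: in frequency only a ball of radius `1/16` contributes, and in
position the decay bound integrates to the cell weight. -/
theorem lintegral_enorm_le_cellWeight {n : ℕ} {C σ Λ : ℝ} {G : Eucl n → ℝ} (hG : Measurable G)
    (p : Eucl n × Eucl (n + 1)) {J : Eucl n × Eucl (n + 1) → ℂ}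
    (h0 : ∀ q, J q ≠ 0 → ‖q.2 - p.2‖ ≤ 1 / 16 ∧ Λ / 4 ≤ ‖p.2‖ ∧ ‖p.2‖ ≤ 3 * Λ)
    (hC : ∀ q, (1 + ‖graphPoint G q.1 - graphPoint G p.1 + (σ * (Λ / ‖p.2‖)) • p.2‖) ^ (n + 3) *
      ‖J q‖ ≤ C) :
    ∫⁻ q : Eucl n × Eucl (n + 1), ‖J q‖ₑ ∂(volume.prod volume) ≤
      ENNReal.ofReal C * volume (Metric.closedBall (0 : Eucl (n + 1)) (1 / 16)) *
        cellWeight σ Λ G p.1 p.2 := by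
  have hGm := measurable_graphPoint hG
  by_cases hp : Λ / 4 ≤ ‖p.2‖ ∧ ‖p.2‖ ≤ 3 * Λ
  · set φ : Eucl n → ℝ≥0∞ := fun c => ENNReal.ofReal
      (((1 + ‖graphPoint G c - graphPoint G p.1 + (σ * (Λ / ‖p.2‖)) • p.2‖) ^ (n + 3))⁻¹) with hφ
    have hφm : Measurable φ := by fun_prop
    have hpt : ∀ q : Eucl n × Eucl (n + 1), ‖J q‖ₑ ≤ (ENNReal.ofReal C * φ q.1) *
        (Metric.closedBall p.2 (1 / 16)).indicator (fun _ => 1) q.2 := fun q => by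
      by_cases h : J q = 0
      · simp [h]
      · rw [Set.indicator_of_mem, mul_one, hφ, ← ENNReal.ofReal_mul' (by positivity),
          ← ofReal_norm]
        · apply ENNReal.ofReal_le_ofReal
          rw [← div_eq_mul_inv, le_div_iff₀ (by positivity), mul_comm]
          exact hC q
        · rw [mem_closedBall_iff_norm]
          exact (h0 q h).1
    refine (lintegral_mono hpt).trans ?_
    rw [lintegral_prod_mul (f := fun c => ENNReal.ofReal C * φ c)
      (g := (Metric.closedBall p.2 (1 / 16)).indicator fun _ => 1) (by fun_prop)
      (measurable_const.indicator Metric.isClosed_closedBall.measurableSet).aemeasurable,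
      lintegral_const_mul _ hφm, lintegral_indicator Metric.isClosed_closedBall.measurableSet,
      setLIntegral_const, one_mul, Measure.addHaar_closedBall_center, cellWeight,
      Set.indicator_of_mem (by exact hp)]
    apply le_of_eq; ring
  · have h1 : ∀ q, J q = 0 := fun q => by
      by_contra h
      exact hp (h0 q h).2
    simp [h1]

theorem lintegral_cellFun_sq_le {n : ℕ} {K : ℝ} {G : Eucl n → ℝ} (hG : IsFlatGraph K G)
    {f : Eucl n → ℂ} (hf : Measurable f) :
    ∫⁻ c, ∫⁻ y, ‖cellFun G f c y‖ₑ ^ 2 ≤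
      4 * volume (Metric.closedBall (0 : Eucl n) 1) * ∫⁻ y, ‖f y‖ₑ ^ 2 := by
  have hpt : ∀ c y : Eucl n, ‖cellFun G f c y‖ₑ ^ 2 ≤
      (4 * ‖f y‖ₑ ^ 2) * (Metric.closedBall y 1).indicator (fun _ => 1) c := fun c y => by
    by_cases h : cellFun G f c y = 0
    · simp [h]
    · rw [Set.indicator_of_mem, mul_one]
      · calc _ ≤ (2 * ‖f y‖ₑ) ^ 2 := by
              gcongr
              rw [← ofReal_norm, ← ofReal_norm, show (2 : ℝ≥0∞) = ENNReal.ofReal 2 by simp,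
                ← ENNReal.ofReal_mul zero_le_two]
              exact ENNReal.ofReal_le_ofReal (norm_cellFun_le' hG f c y)
          _ = _ := by rw [mul_pow]; norm_num
      · rw [mem_closedBall_iff_norm, norm_sub_rev]
        exact norm_sub_le_of_cellFun_ne_zero h
  have hm := measurable_cellFun hG.continuous.measurable hf
  rw [lintegral_lintegral_swap (hm.enorm.pow_const 2).aemeasurable]
  calc _ ≤ ∫⁻ y, ∫⁻ c, (4 * ‖f y‖ₑ ^ 2) * (Metric.closedBall y 1).indicator (fun _ => 1) c :=
        lintegral_mono fun y => lintegral_mono fun c => hpt c y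
    _ = ∫⁻ y, (4 * ‖f y‖ₑ ^ 2) * volume (Metric.closedBall (0 : Eucl n) 1) := by
        refine lintegral_congr fun y => ?_
        rw [lintegral_const_mul _
          (measurable_const.indicator Metric.isClosed_closedBall.measurableSet),
          lintegral_indicator Metric.isClosed_closedBall.measurableSet, setLIntegral_const, one_mul,
          Measure.addHaar_closedBall_center]
    _ = _ := by
        rw [lintegral_mul_const _ (by fun_prop), lintegral_const_mul _ (by fun_prop)]; ring

/-- For each centre `c` this is `weighted_plancherel` applied to the piece of graph over the unit
ball about `c`, with slope that of its tangent plane. Integrating over `c` restores the norm of `f`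
with bounded overlap. -/
theorem lintegral_cellWeight_mul_lowCoeff_le {n : ℕ} {W : ℝ≥0∞}
    (hW : ∀ G : Eucl n → ℝ, (∀ x y, |G x - G y| ≤ 1 / 20 * ‖x - y‖) →
      ∀ σ : ℝ, |σ| = 1 → ∀ Λ : ℝ, 1 ≤ Λ → ∀ c' ω v : Eucl n, ‖v‖ ≤ 1 / 20 →
        ∫⁻ τ in Set.Icc (-(3 * Λ)) (3 * Λ), cellWeight σ Λ G c' (join (ω - τ • v) τ) ≤ W)
    {M Λ σ : ℝ} (hM : 0 ≤ M) (hΛ : 1 ≤ Λ) (hσ : |σ| = 1) {G : Eucl n → ℝ}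
    (hG : IsFlatGraph (M / Λ) G) {f : Eucl n → ℂ} (hf : BddSupp f) :
    ∫⁻ p : Eucl n × Eucl (n + 1),
        cellWeight σ Λ G p.1 p.2 * ‖lowCoeff (3 * Λ) G f p‖ₑ ^ 2 ∂(volume.prod volume) ≤
      W * ENNReal.ofReal (2 + 8 * (6 * Real.pi * M) ^ 2) *
        (4 * volume (Metric.closedBall (0 : Eucl n) 1)) * ∫⁻ y, ‖f y‖ₑ ^ 2 := by
  have hGm := hG.continuous.measurable
  have hΛ0 : 0 < Λ := by linarith
  have hwm := measurable_cellWeight σ Λ hGm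
  have hlm := measurable_lowCoeff (3 * Λ) hGm hf.meas
  rw [lintegral_prod _ (by fun_prop)]
  have hc : ∀ c : Eucl n, ∫⁻ μ, cellWeight σ Λ G c μ * ‖lowCoeff (3 * Λ) G f (c, μ)‖ₑ ^ 2 ≤
      W * (ENNReal.ofReal (2 + 8 * (6 * Real.pi * M) ^ 2) * ∫⁻ y, ‖cellFun G f c y‖ₑ ^ 2) :=
    fun c => by
    obtain ⟨v, hv, hflat⟩ := hG.flat c
    have hwc : Measurable ((fun p : Eucl n × Eucl (n + 1) => cellWeight σ Λ G p.1 p.2) ∘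
      fun μ => (c, μ)) := hwm.comp (by fun_prop)
    replace hwc : Measurable (cellWeight σ Λ G c) := hwc
    have hms : MeasurableSet {ζ : Eucl (n + 1) | |ver ζ| ≤ 3 * Λ} :=
      measurableSet_le (by fun_prop) measurable_const
    have key := weighted_plancherel (bddSupp_cellFun hG hf c)
      (ρ := fun y => G y - G c - inner ℝ (y - c) v) (by fun_prop) (b := M / Λ) (T := 3 * Λ)
      (by positivity) (fun y hy => ?_) (by positivity) hwc v
      (fun ω => hW G hG.lip σ hσ Λ hΛ c ω v hv)
    -- Frequencies of size `3Λ` against a deviation `M/Λ` from the plane: the product no longer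
    -- involves `Λ`.
    · rw [show 2 * Real.pi * (3 * Λ) * (M / Λ) = 6 * Real.pi * M by field_simp; ring] at key
      refine le_trans ?_ key
      rw [← lintegral_indicator hms]
      refine lintegral_mono fun μ => ?_
      simp only
      by_cases hμ : ‖μ‖ ≤ 3 * Λ
      · rw [Set.indicator_of_mem (by exact (abs_ver_le μ).trans hμ), lowCoeff,
          Set.indicator_of_mem (by exact hμ)]
        refine mul_le_mul_right (pow_le_pow_left' (le_of_eq ?_) 2) _
        unfold cellCoeff
        have e : ∀ y, ec (-inner ℝ (graphPoint G y - graphPoint G c) μ) * cellFun G f c y =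
            ec (inner ℝ c (hor μ + ver μ • v)) *
            (ec (-(inner ℝ y (hor μ + ver μ • v) + ver μ * (G y - G c - inner ℝ (y - c) v))) *
              cellFun G f c y) := fun y => by
          rw [← mul_assoc, ← ec_add]
          congr 2
          rw [inner_sub_left, inner_graphPoint, inner_graphPoint, inner_sub_left, inner_add_right,
            inner_add_right, inner_smul_right, inner_smul_right]
          ring
        simp_rw [e]
        rw [integral_const_mul, enorm_mul, enorm_ec, one_mul]
      · rw [lowCoeff, Set.indicator_of_notMem (by exact hμ)]
        simp
    · refine (hflat y).trans ?_
      have h1 := norm_sub_le_of_cellFun_ne_zero hy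
      have h2 : ‖y - c‖ ^ 2 ≤ 1 := pow_le_one₀ (norm_nonneg _) h1
      calc _ ≤ M / Λ * 1 := by gcongr
        _ = _ := mul_one _
  refine (lintegral_mono hc).trans ?_
  have hcm := (measurable_cellFun hGm hf.meas).enorm.pow_const 2
  have hcm' : Measurable fun c : Eucl n => ∫⁻ y, ‖cellFun G f c y‖ₑ ^ 2 :=
    hcm.lintegral_prod_right'
  simp_rw [← mul_assoc]
  rw [lintegral_const_mul _ hcm', mul_assoc (W * _), mul_assoc (W * _)]
  exact mul_le_mul_right ((lintegral_cellFun_sq_le hG hf.meas).trans_eq (by ring)) _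

/-- Schur's test for the cell matrix, whose row and column sums are multiples of cell weights,
followed by the weighted bound on the coefficients. The constant carries `V⁻⁴` because the
reconstruction is used twice and the result is squared. -/
theorem exists_waveForm_unit_scale_le (n : ℕ) {M : ℝ} (hM : 0 ≤ M) :
    ∃ C : ℝ≥0, ∀ σ : ℝ, σ = 1 ∨ σ = -1 → ∀ Λ : ℝ, 1 ≤ Λ → ∀ G : Eucl n → ℝ,
      IsFlatGraph (M / Λ) G → ∀ f g : Eucl n → ℂ, BddSupp f → BddSupp g →
        ‖waveForm Λ (σ * Λ) G f g‖ₑ ^ 2 ≤ C * (∫⁻ y, ‖f y‖ₑ ^ 2) * ∫⁻ y, ‖g y‖ₑ ^ 2 := by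
  obtain ⟨CJ, hCJ, hJ⟩ := exists_coneIntegral_decay (n + 1) (n + 3)
  obtain ⟨W, hW⟩ := exists_lintegral_cellWeight_le n
  set V := volume (Metric.closedBall (0 : Eucl n) 1) with hV
  have hV0 : V ≠ 0 := (Metric.measure_closedBall_pos _ _ one_pos).ne'
  have hVt : V ≠ ∞ := measure_closedBall_lt_top.ne
  set E : ℝ≥0∞ := ENNReal.ofReal CJ * volume (Metric.closedBall (0 : Eucl (n + 1)) (1 / 16)) with hE
  set D : ℝ≥0∞ := E *
    (W * ENNReal.ofReal (2 + 8 * (6 * Real.pi * M) ^ 2) * (4 * V)) with hD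
  have hDt : D ≠ ∞ := ENNReal.mul_ne_top
    (ENNReal.mul_ne_top ENNReal.ofReal_ne_top measure_closedBall_lt_top.ne)
    (ENNReal.mul_ne_top (ENNReal.mul_ne_top ENNReal.coe_ne_top ENNReal.ofReal_ne_top)
      (ENNReal.mul_ne_top (by norm_num) hVt))
  have hCt : (V ^ 4)⁻¹ * D ^ 2 ≠ ∞ := ENNReal.mul_ne_top
    (ENNReal.inv_ne_top.2 (pow_ne_zero _ hV0)) (ENNReal.pow_ne_top hDt)
  refine ⟨((V ^ 4)⁻¹ * D ^ 2).toNNReal, fun σ hσ Λ hΛ G hG f g hf hg => ?_⟩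
  rw [ENNReal.coe_toNNReal hCt]
  have hσ1 : |σ| = 1 := by rcases hσ with rfl | rfl <;> simp
  have hσ2 : |-σ| = 1 := by rw [abs_neg, hσ1]
  have hGm := hG.continuous.measurable
  have hlf := measurable_lowCoeff (3 * Λ) hGm hf.meas
  have hlg := measurable_lowCoeff (3 * Λ) hGm hg.meas
  have hJm := measurable_coneIntegral σ Λ hGm
  have hw1 := measurable_cellWeight σ Λ hGm
  have hw2 := measurable_cellWeight (-σ) Λ hGm
  have hX := waveForm_eq_integral (σ := σ) hG hΛ hf hg
  set Φ := waveForm Λ (σ * Λ) G f g with hΦ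
  have h1 : V ^ 2 * ‖Φ‖ₑ ≤ ∫⁻ p : (Eucl n × Eucl (n + 1)) × (Eucl n × Eucl (n + 1)),
      ‖lowCoeff (3 * Λ) G f p.1‖ₑ * ‖lowCoeff (3 * Λ) G g p.2‖ₑ *
        ‖coneIntegral σ Λ (graphPoint G p.2.1 - graphPoint G p.1.1) p.1.2 p.2.2‖ₑ
      ∂((volume.prod volume).prod (volume.prod volume)) := by
    have h2 := congrArg enorm hX
    rw [enorm_mul, enorm_pow] at h2
    have h3 : ‖((V.toReal : ℝ) : ℂ)‖ₑ = V := by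
      rw [← ofReal_norm, Complex.norm_real, Real.norm_eq_abs, abs_of_nonneg ENNReal.toReal_nonneg,
        ENNReal.ofReal_toReal hVt]
    rw [h3] at h2
    rw [h2]
    refine (enorm_integral_le_lintegral_enorm _).trans (lintegral_mono fun p => ?_)
    rw [enorm_mul, enorm_mul, ← ofReal_norm ((starRingEnd ℂ) _), RCLike.norm_conj, ofReal_norm]
  have hs := sq_lintegral_schur_le (μ := (volume : Measure (Eucl n)).prod
      (volume : Measure (Eucl (n + 1)))) hlf.enorm hlg.enorm hJm.enorm
    (w₁ := fun p => E * cellWeight σ Λ G p.1 p.2) (w₂ := fun q => E * cellWeight (-σ) Λ G q.1 q.2)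
    (fun p => lintegral_enorm_le_cellWeight hGm p (fun q h => coneIntegral_ne_zero hΛ h)
      fun q => hJ σ hσ Λ hΛ _ _ _)
    -- Column sums are row sums of the time-reversed flow: exchanging the cells reverses the
    -- displacement, and negating the vector in the decay bound amounts to replacing `σ` by `-σ`.
    (fun q => lintegral_enorm_le_cellWeight hGm q (fun p h => by
        rw [coneIntegral_swap] at h
        exact coneIntegral_ne_zero hΛ h) fun p => by
      have h4 := hJ σ hσ Λ hΛ (graphPoint G q.1 - graphPoint G p.1) q.2 p.2
      rw [← norm_neg, coneIntegral_swap] at h4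
      convert h4 using 4
      rw [neg_add, neg_sub, neg_mul, neg_smul])
  simp_rw [mul_assoc E] at hs
  rw [lintegral_const_mul _ (by fun_prop), lintegral_const_mul _ (by fun_prop)] at hs
  have h5 := lintegral_cellWeight_mul_lowCoeff_le hW hM hΛ hσ1 hG hf
  have h6 := lintegral_cellWeight_mul_lowCoeff_le hW hM hΛ hσ2 hG hg
  rw [← hV] at h5 h6
  have h7 : V ^ 4 * ‖Φ‖ₑ ^ 2 ≤ D ^ 2 * ((∫⁻ y, ‖f y‖ₑ ^ 2) * ∫⁻ y, ‖g y‖ₑ ^ 2) :=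
    calc V ^ 4 * ‖Φ‖ₑ ^ 2 = (V ^ 2 * ‖Φ‖ₑ) ^ 2 := by ring
      _ ≤ _ := pow_le_pow_left' h1 2
      _ ≤ _ := hs
      _ ≤ (E * (W * ENNReal.ofReal (2 + 8 * (6 * Real.pi * M) ^ 2) * (4 * V) *
            ∫⁻ y, ‖f y‖ₑ ^ 2)) *
          (E * (W * ENNReal.ofReal (2 + 8 * (6 * Real.pi * M) ^ 2) * (4 * V) *
            ∫⁻ y, ‖g y‖ₑ ^ 2)) :=
        mul_le_mul' (mul_le_mul_right h5 _) (mul_le_mul_right h6 _)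
      _ = _ := by rw [hD]; ring
  calc ‖Φ‖ₑ ^ 2 = (V ^ 4)⁻¹ * (V ^ 4 * ‖Φ‖ₑ ^ 2) := by
        rw [← mul_assoc, ENNReal.inv_mul_cancel (pow_ne_zero _ hV0) (ENNReal.pow_ne_top hVt),
          one_mul]
    _ ≤ (V ^ 4)⁻¹ * (D ^ 2 * ((∫⁻ y, ‖f y‖ₑ ^ 2) * ∫⁻ y, ‖g y‖ₑ ^ 2)) := mul_le_mul_right h7 _
    _ = _ := by ring

/-! ### Scaling and the fixed time estimate -/

theorem IsC11With.differentiable {n : ℕ} {M : ℝ≥0} {F : Eucl n → ℝ} (hF : IsC11With n M F) :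
    Differentiable ℝ F :=
  hF.contDiff.differentiable one_ne_zero

/-- The dilation preserves slopes and multiplies the Lipschitz constant of the gradient by `h`.
Flatness is the mean value inequality for `F` minus its differential at the centre, on a ball where
the gradient varies by at most `M` times the radius. -/
theorem IsC11With.isFlatGraph {n : ℕ} {M : ℝ≥0} {F : Eucl n → ℝ} (hF : IsC11With n M F)
    (hF' : ∀ x, ‖fderiv ℝ F x‖ ≤ 1 / 20) {h : ℝ} (hh : 0 < h) :
    IsFlatGraph (h * M) (fun y => F (h • y) / h) := by
  have hd := hF.differentiable
  refine ⟨fun x y => ?_, fun c => ⟨(InnerProductSpace.toDual ℝ (Eucl n)).symm (fderiv ℝ F (h • c)),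
    ?_, fun y => ?_⟩⟩
  · have h1 := convex_univ.norm_image_sub_le_of_norm_fderiv_le (fun z _ => hd z)
      (fun z _ => hF' z) (Set.mem_univ (h • y)) (Set.mem_univ (h • x))
    rw [← smul_sub, norm_smul, Real.norm_eq_abs, Real.norm_eq_abs, abs_of_pos hh] at h1
    rw [← sub_div, abs_div, abs_of_pos hh, div_le_iff₀ hh]
    linarith
  · simpa using hF' (h • c)
  · have hs : Convex ℝ (Metric.closedBall (h • c) ‖h • y - h • c‖) := convex_closedBall _ _
    have h1 := hs.norm_image_sub_le_of_norm_fderiv_le' (f := F) (φ := fderiv ℝ F (h • c))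
      (C := M * ‖h • y - h • c‖) (x := h • c) (y := h • y) (fun z _ => hd z) (fun z hz => by
        have h2 := hF.lipschitz_fderiv.dist_le_mul z (h • c)
        rw [dist_eq_norm, dist_eq_norm] at h2
        rw [mem_closedBall_iff_norm] at hz
        exact h2.trans (by gcongr)) (by simp) (by simp [dist_eq_norm])
    rw [real_inner_comm, InnerProductSpace.toDual_symm_apply]
    rw [← smul_sub, norm_smul, map_smul, Real.norm_eq_abs, Real.norm_eq_abs, abs_of_pos hh,
      smul_eq_mul] at h1
    have e : F (h • y) / h - F (h • c) / h - fderiv ℝ F (h • c) (y - c) =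
        (F (h • y) - F (h • c) - h * fderiv ℝ F (h • c) (y - c)) / h := by
      field_simp
    rw [e, abs_div, abs_of_pos hh, div_le_iff₀ hh]
    linarith

theorem graphPoint_smul {n : ℕ} (F : Eucl n → ℝ) {h : ℝ} (hh : h ≠ 0) (y : Eucl n) :
    graphPoint F (h • y) = h • graphPoint (fun y => F (h • y) / h) y := by
  ext i
  refine Fin.lastCases ?_ (fun j => ?_) i
  · simp [graphPoint]
    field_simp
  · simp [graphPoint]

theorem lintegral_comp_smul {m : ℕ} {f : Eucl m → ℝ≥0∞} (hf : Measurable f) {h : ℝ} (hh : 0 < h) :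
    ENNReal.ofReal (h ^ m) * ∫⁻ y, f (h • y) = ∫⁻ y, f y := by
  have h1 := lintegral_map (μ := (volume : Measure (Eucl m))) hf (measurable_const_smul h)
  rw [Measure.map_addHaar_smul _ hh.ne', lintegral_smul_measure, finrank_euclideanSpace_fin,
    abs_of_pos (by positivity)] at h1
  rw [← h1, smul_eq_mul, ← mul_assoc, ← ENNReal.ofReal_mul (by positivity),
    mul_inv_cancel₀ (by positivity), ENNReal.ofReal_one, one_mul]

theorem BddSupp.comp_smul {n : ℕ} {f : Eucl n → ℂ} (hf : BddSupp f) {h : ℝ} (hh : 0 < h) :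
    BddSupp fun y => f (h • y) := by
  obtain ⟨B, hB⟩ := hf.bdd
  obtain ⟨R, hR⟩ := hf.supp
  refine ⟨hf.meas.comp (measurable_const_smul h), ⟨B, fun y => hB _⟩, R / h, fun y hy => hR _ ?_⟩
  rw [norm_smul, Real.norm_eq_abs, abs_of_pos hh]
  rw [div_lt_iff₀ hh] at hy
  linarith

theorem gHat_eq_gHat_scaled {n : ℕ} (F : Eucl n → ℝ) (f : Eucl n → ℂ) {h : ℝ} (hh : 0 < h)
    (ζ : Eucl (n + 1)) :
    gHat F f ζ = ((h ^ n : ℝ) : ℂ) * gHat (fun y => F (h • y) / h) (fun y => f (h • y)) (h • ζ) := by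
  have h1 := Measure.integral_comp_smul (volume : Measure (Eucl n))
    (fun y => ec (-inner ℝ (graphPoint F y) ζ) * f y) h
  rw [finrank_euclideanSpace_fin, abs_of_pos (by positivity)] at h1
  have h2 : gHat (fun y => F (h • y) / h) (fun y => f (h • y)) (h • ζ) =
      (h ^ n)⁻¹ • gHat F f ζ := by
    rw [gHat, gHat, ← h1]
    congr 1; ext y
    rw [graphPoint_smul F hh.ne', inner_smul_left, inner_smul_right]
    simp
  rw [h2, Complex.real_smul, ← mul_assoc, ← Complex.ofReal_mul, mul_inv_cancel₀ (by positivity),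
    Complex.ofReal_one, one_mul]

theorem waveForm_eq_waveForm_scaled {n : ℕ} (F : Eucl n → ℝ) (f g : Eucl n → ℂ) {h : ℝ}
    (hh : 0 < h) (ϱ t : ℝ) :
    ((h ^ (n + 1) : ℝ) : ℂ) * waveForm ϱ t F f g = ((h ^ (2 * n) : ℝ) : ℂ) *
      waveForm (h * ϱ) (t / h) (fun y => F (h • y) / h) (fun y => f (h • y))
        (fun y => g (h • y)) := by
  set G := fun y => F (h • y) / h
  set f' := fun y => f (h • y)
  set g' := fun y => g (h • y)
  have h1 := Measure.integral_comp_smul (volume : Measure (Eucl (n + 1)))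
    (fun ζ => ((annulusCutoff ((h * ϱ)⁻¹ • ζ) : ℂ) * ec (t / h * ‖ζ‖)) * gHat G f' ζ *
      (starRingEnd ℂ) (gHat G g' ζ)) h
  rw [finrank_euclideanSpace_fin, abs_of_pos (by positivity), Complex.real_smul] at h1
  have h2 : waveForm ϱ t F f g = ((h ^ (2 * n) : ℝ) : ℂ) * ∫ ζ : Eucl (n + 1),
      ((annulusCutoff ((h * ϱ)⁻¹ • h • ζ) : ℂ) * ec (t / h * ‖h • ζ‖)) * gHat G f' (h • ζ) *
      (starRingEnd ℂ) (gHat G g' (h • ζ)) := by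
    rw [waveForm, ← integral_const_mul]
    congr 1; ext ζ
    rw [gHat_eq_gHat_scaled F f hh, gHat_eq_gHat_scaled F g hh, smul_smul, norm_smul,
      Real.norm_eq_abs, abs_of_pos hh, map_mul, Complex.conj_ofReal]
    have e1 : (h * ϱ)⁻¹ * h = ϱ⁻¹ := by field_simp
    have e2 : t / h * (h * ‖ζ‖) = t * ‖ζ‖ := by field_simp
    rw [e1, e2, two_mul, pow_add]
    push_cast
    ring
  rw [h2, h1, mul_left_comm, ← mul_assoc ((h ^ (n + 1) : ℝ) : ℂ), ← Complex.ofReal_mul,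
    mul_inv_cancel₀ (by positivity), Complex.ofReal_one, one_mul, waveForm]

/-- No oscillation in time is used: Cauchy–Schwarz and Plancherel on horizontal slices, over
vertical frequencies `|ver ζ| ≤ 5ϱ/2`. This serves the range `ϱ|t| < 1`. -/
theorem enorm_waveForm_sq_le {n : ℕ} {ϱ : ℝ} (hϱ : 0 < ϱ) (t : ℝ) {G : Eucl n → ℝ}
    (hG : Measurable G) {f g : Eucl n → ℂ} (hf : BddSupp f) (hg : BddSupp g) :
    ‖waveForm ϱ t G f g‖ₑ ^ 2 ≤
      ENNReal.ofReal (5 * ϱ) ^ 2 * (∫⁻ y, ‖f y‖ₑ ^ 2) * ∫⁻ y, ‖g y‖ₑ ^ 2 := by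
  have hmf := (continuous_gHat hG hf.integrable).measurable
  have hmg := (continuous_gHat hG hg.integrable).measurable
  have hms : MeasurableSet {ζ : Eucl (n + 1) | |ver ζ| ≤ 5 / 2 * ϱ} :=
    measurableSet_le (by fun_prop) measurable_const
  have h1 : ‖waveForm ϱ t G f g‖ₑ ≤
      ∫⁻ ζ in {ζ | |ver ζ| ≤ 5 / 2 * ϱ}, ‖gHat G f ζ‖ₑ * ‖gHat G g ζ‖ₑ := by
    rw [waveForm, ← lintegral_indicator hms]
    refine (enorm_integral_le_lintegral_enorm _).trans (lintegral_mono fun ζ => ?_)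
    by_cases h : annulusCutoff (ϱ⁻¹ • ζ) = 0
    · simp [h]
    · rw [Set.indicator_of_mem
        (by exact (abs_ver_le ζ).trans (norm_le_of_annulusCutoff_ne_zero hϱ h)), enorm_mul,
        enorm_mul, enorm_mul, enorm_ec, mul_one, ← ofReal_norm ((starRingEnd ℂ) _),
        RCLike.norm_conj, ofReal_norm]
      refine mul_le_mul_left (mul_le_of_le_one_left' ?_) _
      rw [← ofReal_norm, Complex.norm_real, Real.norm_eq_abs, abs_of_nonneg (annulusCutoff_nonneg _)]
      exact ENNReal.ofReal_le_one.2 (annulusCutoff_le_one _)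
  have h2 := lintegral_gHat_sq_le hG hf (5 / 2 * ϱ)
  have h3 := lintegral_gHat_sq_le hG hg (5 / 2 * ϱ)
  rw [show 2 * (5 / 2 * ϱ) = 5 * ϱ by ring] at h2 h3
  calc _ ≤ _ := pow_le_pow_left' h1 2
    _ ≤ _ := sq_lintegral_mul_le hmf.enorm.aemeasurable hmg.enorm.aemeasurable
    _ ≤ _ := mul_le_mul' h2 h3
    _ = _ := by ring

theorem exists_waveForm_le (n : ℕ) (M : ℝ≥0) :
    ∃ C : ℝ≥0, ∀ F : Eucl n → ℝ, IsC11With n M F → (∀ x, ‖fderiv ℝ F x‖ ≤ 1 / 20) →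
      ∀ ϱ t : ℝ, 0 < ϱ → t ≠ 0 → |t| ≤ 1 → ∀ f g : Eucl n → ℂ, BddSupp f → BddSupp g →
        ‖waveForm ϱ t F f g‖ₑ ^ 2 ≤
          C * ENNReal.ofReal (ϱ / |t|) * (∫⁻ y, ‖f y‖ₑ ^ 2) * ∫⁻ y, ‖g y‖ₑ ^ 2 := by
  obtain ⟨C, hC⟩ := exists_waveForm_unit_scale_le n (M := M) M.2
  refine ⟨C + 25, fun F hF hF' ϱ t hϱ ht ht1 f g hf hg => ?_⟩
  have ht0 : 0 < |t| := abs_pos.2 ht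
  by_cases hc : 1 ≤ ϱ * |t|
  -- This dilation equalizes the rescaled frequency `hϱ` and the rescaled time `|t|/h`; both become
  -- `Λ`. The unit scale bound then returns a factor `h⁻¹ = √(ϱ/|t|)`.
  · set h := √(|t| / ϱ) with hh
    set Λ := √(ϱ * |t|) with hΛ
    have hh0 : 0 < h := Real.sqrt_pos.2 (by positivity)
    have hΛ1 : 1 ≤ Λ := Real.one_le_sqrt.2 hc
    have hΛ0 : 0 < Λ := by linarith
    have hhh : h ^ 2 = |t| / ϱ := Real.sq_sqrt (by positivity)
    have hhΛ : h * Λ = |t| := by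
      rw [hh, hΛ, ← Real.sqrt_mul (by positivity), show |t| / ϱ * (ϱ * |t|) = |t| ^ 2 by field_simp,
        Real.sqrt_sq ht0.le]
    have hhϱ : h * ϱ = Λ := by
      have : h * (h * ϱ) = h * Λ := by rw [← mul_assoc, ← sq, hhh, hhΛ]; field_simp
      exact mul_left_cancel₀ hh0.ne' this
    set σ : ℝ := t / |t| with hσ
    have hσ1 : σ = 1 ∨ σ = -1 := by
      rcases lt_or_gt_of_ne ht with h0 | h0
      · right; rw [hσ, abs_of_neg h0]; field_simp
      · left; rw [hσ, abs_of_pos h0]; field_simp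
    have hth : t / h = σ * Λ := by
      rw [hσ, ← hhΛ]; field_simp
    have hG : IsFlatGraph (M / Λ) fun y => F (h • y) / h := by
      have h1 := hF.isFlatGraph hF' hh0
      refine ⟨h1.lip, fun c => ?_⟩
      obtain ⟨v, hv, hfl⟩ := h1.flat c
      refine ⟨v, hv, fun y => (hfl y).trans ?_⟩
      -- Here `|t| ≤ 1` enters: `hΛ = |t|`, so the curvature of the rescaled graph is as small as
      -- the unit scale estimate demands.
      have : h * M ≤ M / Λ := by
        rw [le_div_iff₀ hΛ0]
        calc h * M * Λ = M * (h * Λ) := by ring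
          _ ≤ M * 1 := by rw [hhΛ]; gcongr
          _ = M := mul_one _
      gcongr
    have key := hC σ hσ1 Λ hΛ1 _ hG _ _ (hf.comp_smul hh0) (hg.comp_smul hh0)
    have hsc := congrArg enorm (waveForm_eq_waveForm_scaled F f g hh0 ϱ t)
    rw [hhϱ, hth, enorm_mul, enorm_mul] at hsc
    have hof : ∀ m, ‖((h ^ m : ℝ) : ℂ)‖ₑ = ENNReal.ofReal h ^ m := fun m => by
      rw [← ofReal_norm, Complex.norm_real, Real.norm_eq_abs, abs_of_pos (by positivity),
        ENNReal.ofReal_pow hh0.le]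
    rw [hof, hof] at hsc
    have hif := lintegral_comp_smul (hf.meas.enorm.pow_const 2) hh0
    have hig := lintegral_comp_smul (hg.meas.enorm.pow_const 2) hh0
    rw [ENNReal.ofReal_pow hh0.le] at hif hig
    rw [← hif, ← hig]
    set A := ENNReal.ofReal h with hA
    have hA0 : A ≠ 0 := by simpa [hA] using hh0
    have hAt : A ≠ ∞ := ENNReal.ofReal_ne_top
    have hAϱ : A ^ 2 * ENNReal.ofReal (ϱ / |t|) = 1 := by
      rw [hA, ← ENNReal.ofReal_pow hh0.le, ← ENNReal.ofReal_mul (by positivity), hhh]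
      rw [show |t| / ϱ * (ϱ / |t|) = 1 by field_simp, ENNReal.ofReal_one]
    set X := ∫⁻ y, ‖f (h • y)‖ₑ ^ 2
    set Y := ∫⁻ y, ‖g (h • y)‖ₑ ^ 2
    have h1 : A ^ (2 * n + 2) * ‖waveForm ϱ t F f g‖ₑ ^ 2 ≤ A ^ (2 * n + 2) *
        (C * ENNReal.ofReal (ϱ / |t|) * (A ^ n * X) * (A ^ n * Y)) := by
      calc _ = (A ^ (n + 1) * ‖waveForm ϱ t F f g‖ₑ) ^ 2 := by ring
        _ = A ^ (4 * n) * ‖waveForm Λ (σ * Λ) (fun y => F (h • y) / h) (fun y => f (h • y))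
            (fun y => g (h • y))‖ₑ ^ 2 := by rw [hsc]; ring
        _ ≤ A ^ (4 * n) * (C * X * Y) := mul_le_mul_right key _
        _ = (A ^ 2 * ENNReal.ofReal (ϱ / |t|)) * A ^ (4 * n) * (C * X * Y) := by
            rw [hAϱ, one_mul]
        _ = _ := by ring
    refine ((ENNReal.mul_le_mul_iff_right (pow_ne_zero _ hA0) (ENNReal.pow_ne_top hAt)).1 h1).trans ?_
    gcongr
    exact le_self_add
  · refine (enorm_waveForm_sq_le hϱ t hF.contDiff.continuous.measurable hf hg).trans ?_
    gcongr
    calc ENNReal.ofReal (5 * ϱ) ^ 2 = ENNReal.ofReal (25 * ϱ ^ 2) := by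
          rw [← ENNReal.ofReal_pow (by positivity)]; congr 1; ring
      _ ≤ ENNReal.ofReal (25 * (ϱ / |t|)) := by
          apply ENNReal.ofReal_le_ofReal
          have : ϱ ^ 2 ≤ ϱ / |t| := by
            rw [le_div_iff₀ ht0]; nlinarith
          linarith
      _ = 25 * ENNReal.ofReal (ϱ / |t|) := by
          rw [ENNReal.ofReal_mul (by norm_num)]; norm_num
      _ ≤ _ := by gcongr; simp

/-! ### Fractional integration on an interval -/

theorem lintegral_inv_sqrt_abs_lt_top :
    ∫⁻ v in Set.Icc (-1 : ℝ) 1, ENNReal.ofReal (√|v|)⁻¹ < ∞ := by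
  have h1 : IntervalIntegrable (fun v : ℝ => (√|v|)⁻¹) volume 0 1 := by
    refine (intervalIntegral.intervalIntegrable_rpow' (r := -(1 / 2)) (by norm_num)).congr
      fun v hv => ?_
    rw [Set.uIoc_of_le zero_le_one] at hv
    rw [abs_of_pos hv.1, Real.sqrt_eq_rpow, Real.rpow_neg hv.1.le]
  have h2 : IntervalIntegrable (fun v : ℝ => (√|v|)⁻¹) volume (-1) 0 := by
    have := ((IntervalIntegrable.iff_comp_neg (by simp)).1 h1).symm
    simpa using this
  have h3 := (intervalIntegrable_iff_integrableOn_Icc_of_le (by norm_num)).1 (h2.trans h1)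
  exact h3.lintegral_lt_top

/-- A kernel which dominates fractional integration after an optimization. -/
def fracKernel (v : ℝ) : ℝ := if |v| ≤ 1 then (√|v|)⁻¹ else (v ^ 2)⁻¹

theorem measurable_fracKernel : Measurable fracKernel := by
  refine Measurable.ite (measurableSet_le (by fun_prop) measurable_const) ?_ ?_ <;> fun_prop

theorem lintegral_fracKernel_lt_top : ∫⁻ v, ENNReal.ofReal (fracKernel v) < ∞ := by
  have hm : MeasurableSet (Set.Icc (-1 : ℝ) 1) := measurableSet_Icc
  have hpt : ∀ v, ENNReal.ofReal (fracKernel v) ≤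
      (Set.Icc (-1 : ℝ) 1).indicator (fun v => ENNReal.ofReal (√|v|)⁻¹) v +
        4 * ENNReal.ofReal (((1 + |v|) ^ 2)⁻¹) := fun v => by
    unfold fracKernel
    split_ifs with h
    · rw [Set.indicator_of_mem (Set.mem_Icc.2 (abs_le.1 h))]
      exact le_self_add
    · have hv : 0 < |v| := by linarith [not_le.1 h]
      refine le_trans ?_ le_add_self
      rw [show (4 : ℝ≥0∞) = ENNReal.ofReal 4 by simp, ← ENNReal.ofReal_mul (by norm_num)]
      apply ENNReal.ofReal_le_ofReal
      rw [← sq_abs v, ← div_eq_mul_inv, le_div_iff₀ (by positivity), inv_mul_le_iff₀ (by positivity)]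
      nlinarith [not_le.1 h]
  refine (lintegral_mono hpt).trans_lt ?_
  rw [lintegral_add_right _ (by fun_prop), lintegral_indicator hm, lintegral_const_mul _ (by fun_prop)]
  exact ENNReal.add_lt_top.2 ⟨lintegral_inv_sqrt_abs_lt_top,
    ENNReal.mul_lt_top (by norm_num) lintegral_one_add_abs_inv_sq_lt_top⟩

theorem lintegral_comp_sub_mul {φ : ℝ → ℝ≥0∞} (hφ : Measurable φ) (t : ℝ) {c : ℝ} (hc : 0 < c) :
    ∫⁻ s, φ (c * (s - t)) = ENNReal.ofReal c⁻¹ * ∫⁻ v, φ v := by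
  rw [lintegral_sub_right_eq_self (fun s => φ (c * s)) t]
  have h1 := lintegral_map (μ := volume) hφ (measurable_const_mul c)
  rw [Real.map_volume_mul_left hc.ne', lintegral_smul_measure, abs_of_pos (by positivity)] at h1
  rw [← h1, smul_eq_mul]

/-- Put `k = |u|^{-1/2}`. If `k ≤ αx/N²` the first term suffices. Otherwise `x` is bounded both by
`α` and by `N²k/α`; the former is used for `|u| ≤ N⁴/α⁴` and the latter beyond, which produces the
integrable profile `fracKernel`. -/
theorem cube_div_sqrt_le {x α N u : ℝ} (hx : 0 ≤ x) (hxα : x ≤ α) (hα : 0 < α) (hN : 0 < N) :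
    x ^ 3 * (√|u|)⁻¹ ≤ α / N ^ 2 * x ^ 4 + α ^ 5 / N ^ 2 * fracKernel (α ^ 4 / N ^ 4 * u) := by
  have hk0 : 0 ≤ fracKernel (α ^ 4 / N ^ 4 * u) := by
    unfold fracKernel; split_ifs <;> positivity
  set k := (√|u|)⁻¹ with hk
  have hk1 : 0 ≤ k := by positivity
  by_cases h1 : k ≤ α / N ^ 2 * x
  · calc x ^ 3 * k ≤ x ^ 3 * (α / N ^ 2 * x) := by gcongr
      _ = α / N ^ 2 * x ^ 4 := by ring
      _ ≤ _ := le_add_of_nonneg_right (by positivity)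
  · refine le_trans ?_ (le_add_of_nonneg_left (by positivity))
    rw [not_le] at h1
    have hkpos : 0 < k := lt_of_le_of_lt (by positivity) h1
    have hu : 0 < |u| := by
      rw [hk, inv_pos, Real.sqrt_pos] at hkpos; exact hkpos
    have hc : |α ^ 4 / N ^ 4 * u| = α ^ 4 / N ^ 4 * |u| := by
      rw [abs_mul, abs_of_pos (by positivity)]
    unfold fracKernel
    split_ifs with h2
    · rw [hc, show α ^ 4 / N ^ 4 = (α ^ 2 / N ^ 2) ^ 2 by ring, Real.sqrt_mul (by positivity),
        Real.sqrt_sq (by positivity), mul_inv, ← hk]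
      calc x ^ 3 * k ≤ α ^ 3 * k := by gcongr
        _ = _ := by field_simp
    · have hx2 : x ≤ k * (N ^ 2 / α) := by
        have h3 : x * (α / N ^ 2) ≤ k := by linarith
        calc x = x * (α / N ^ 2) * (N ^ 2 / α) := by field_simp
          _ ≤ _ := by gcongr
      have hk4 : k ^ 4 = (u ^ 2)⁻¹ := by
        rw [hk, inv_pow, show (√|u|) ^ 4 = ((√|u|) ^ 2) ^ 2 by ring, Real.sq_sqrt hu.le, sq_abs]
      calc x ^ 3 * k ≤ (k * (N ^ 2 / α)) ^ 3 * k := by gcongr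
        _ = N ^ 6 / α ^ 3 * k ^ 4 := by ring
        _ = α ^ 5 / N ^ 2 * ((α ^ 4 / N ^ 4 * u) ^ 2)⁻¹ := by
          rw [hk4, mul_pow, mul_inv]; field_simp
        _ ≤ _ := le_rfl

/-- The Hardy–Littlewood–Sobolev inequality from `L^{4/3}` to `L^4`, for the densities `a³`: their
`L^{4/3}` norm to the power `4/3` is `∫ a⁴`, so `N⁶` is the bound for its square. By symmetry one
may assume `a s ≤ a t`. The pointwise inequality with `α = a t` then integrates in `s` to a multiple
of `α N²`, and the remaining `α³` gives `∫ α⁴ N²`. -/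
theorem exists_lintegral_cube_mul_cube_le :
    ∃ C : ℝ≥0, ∀ a : ℝ → ℝ, Measurable a → (∀ t, 0 ≤ a t) → ∀ N : ℝ, 0 < N →
      ∫⁻ t in Set.Icc (0 : ℝ) 1, ENNReal.ofReal (a t ^ 4) ≤ ENNReal.ofReal (N ^ 4) →
      ∫⁻ p : ℝ × ℝ, ENNReal.ofReal (a p.1 ^ 3 * a p.2 ^ 3 * (√|p.2 - p.1|)⁻¹)
        ∂((volume.restrict (Set.Icc 0 1)).prod (volume.restrict (Set.Icc 0 1))) ≤
        C * ENNReal.ofReal (N ^ 6) := by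
  set K := ∫⁻ v, ENNReal.ofReal (fracKernel v) with hK
  have hKt : K ≠ ∞ := lintegral_fracKernel_lt_top.ne
  refine ⟨2 * (1 + K.toNNReal), fun a ha ha0 N hN hI => ?_⟩
  set ν : Measure ℝ := volume.restrict (Set.Icc 0 1) with hν
  have hfm := measurable_fracKernel
  set φ : ℝ × ℝ → ℝ≥0∞ := fun p => ENNReal.ofReal (a p.1 ^ 3 * a p.2 ^ 3 * (√|p.2 - p.1|)⁻¹) with hφ
  have hφm : Measurable φ := by fun_prop
  have hms : MeasurableSet {p : ℝ × ℝ | a p.2 ≤ a p.1} := measurableSet_le (by fun_prop) (by fun_prop)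
  set ψ := {p : ℝ × ℝ | a p.2 ≤ a p.1}.indicator φ with hψ
  have hψm : Measurable ψ := hφm.indicator hms
  have hle : ∀ p, φ p ≤ ψ p + ψ p.swap := fun p => by
    rcases le_total (a p.2) (a p.1) with h | h
    · rw [hψ, Set.indicator_of_mem (by exact h)]; exact le_self_add
    · rw [hψ, Set.indicator_of_mem (a := p.swap) (by exact h)]
      refine le_trans (le_of_eq ?_) le_add_self
      simp only [hφ, Prod.fst_swap, Prod.snd_swap]
      rw [abs_sub_comm, mul_comm (a p.1 ^ 3)]
  have hfix : ∀ t, ∫⁻ s, ψ (t, s) ∂ν ≤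
      ENNReal.ofReal (a t ^ 4) * ((1 + K) * ENNReal.ofReal (N ^ 2)) := fun t => by
    set α := a t with hα
    rcases (ha0 t).eq_or_lt with h0 | h0
    · have : ∀ s, ψ (t, s) = 0 := fun s => by
        have : φ (t, s) = 0 := by simp [hφ, ← h0]
        rw [hψ, Set.indicator_apply, this, ite_self]
      simp [this]
    · rw [← hα] at h0
      have hpt : ∀ s, ψ (t, s) ≤ ENNReal.ofReal (α ^ 3) * (ENNReal.ofReal (α / N ^ 2) *
          ENNReal.ofReal (a s ^ 4) + ENNReal.ofReal (α ^ 5 / N ^ 2) *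
            ENNReal.ofReal (fracKernel (α ^ 4 / N ^ 4 * (s - t)))) := fun s => by
        by_cases hs : a s ≤ α
        · rw [hψ, Set.indicator_of_mem (by exact hs), hφ]
          simp only
          have h := cube_div_sqrt_le (u := s - t) (ha0 s) hs h0 hN
          have hk0 : 0 ≤ fracKernel (α ^ 4 / N ^ 4 * (s - t)) := by
            unfold fracKernel; split_ifs <;> positivity
          have := ha0 s
          rw [← ENNReal.ofReal_mul (by positivity), ← ENNReal.ofReal_mul (by positivity),
            ← ENNReal.ofReal_add (by positivity) (by positivity),
            ← ENNReal.ofReal_mul (by positivity), mul_assoc]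
          exact ENNReal.ofReal_le_ofReal (mul_le_mul_of_nonneg_left h (by positivity))
        · rw [hψ, Set.indicator_of_notMem (by exact hs)]; exact zero_le
      refine (lintegral_mono hpt).trans ?_
      rw [lintegral_const_mul _ (by fun_prop), lintegral_add_left (by fun_prop),
        lintegral_const_mul _ (by fun_prop), lintegral_const_mul _ (by fun_prop)]
      have hk : ∫⁻ s, ENNReal.ofReal (fracKernel (α ^ 4 / N ^ 4 * (s - t))) ∂ν ≤
          ENNReal.ofReal (α ^ 4 / N ^ 4)⁻¹ * K := by
        refine (setLIntegral_le_lintegral _ _).trans_eq ?_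
        rw [lintegral_comp_sub_mul (φ := fun v => ENNReal.ofReal (fracKernel v)) (by fun_prop) t
          (by positivity)]
      calc _ ≤ ENNReal.ofReal (α ^ 3) * (ENNReal.ofReal (α / N ^ 2) * ENNReal.ofReal (N ^ 4) +
              ENNReal.ofReal (α ^ 5 / N ^ 2) * (ENNReal.ofReal (α ^ 4 / N ^ 4)⁻¹ * K)) := by
            gcongr
        _ = _ := by
            rw [← mul_assoc (ENNReal.ofReal (α ^ 5 / N ^ 2)), ← ENNReal.ofReal_mul (by positivity),
              ← ENNReal.ofReal_mul (by positivity),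
              show α / N ^ 2 * N ^ 4 = α * N ^ 2 by field_simp,
              show α ^ 5 / N ^ 2 * (α ^ 4 / N ^ 4)⁻¹ = α * N ^ 2 by field_simp,
              show ENNReal.ofReal (α * N ^ 2) + ENNReal.ofReal (α * N ^ 2) * K =
                ENNReal.ofReal (α * N ^ 2) * (1 + K) by ring, ← mul_assoc,
              ← ENNReal.ofReal_mul (by positivity),
              show α ^ 3 * (α * N ^ 2) = α ^ 4 * N ^ 2 by ring, ENNReal.ofReal_mul (by positivity)]
            ring
  calc ∫⁻ p, φ p ∂(ν.prod ν) ≤ ∫⁻ p, (ψ p + ψ p.swap) ∂(ν.prod ν) := lintegral_mono hle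
    _ = 2 * ∫⁻ p, ψ p ∂(ν.prod ν) := by
        rw [lintegral_add_left hψm, lintegral_prod_swap, two_mul]
    _ = 2 * ∫⁻ t, ∫⁻ s, ψ (t, s) ∂ν ∂ν := by rw [lintegral_prod _ hψm.aemeasurable]
    _ ≤ 2 * ∫⁻ t, ENNReal.ofReal (a t ^ 4) * ((1 + K) * ENNReal.ofReal (N ^ 2)) ∂ν :=
        mul_le_mul_right (lintegral_mono hfix) _
    _ ≤ 2 * (ENNReal.ofReal (N ^ 4) * ((1 + K) * ENNReal.ofReal (N ^ 2))) := by
        rw [lintegral_mul_const _ (by fun_prop)]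
        gcongr
    _ = _ := by
        rw [show N ^ 6 = N ^ 4 * N ^ 2 by ring, ENNReal.ofReal_mul (by positivity)]
        push_cast
        rw [ENNReal.coe_toNNReal hKt]
        ring

/-! ### The dual square function estimate -/

/-- Uniformly bounded and boundedly supported densities depending on a parameter. -/
structure BddSuppFamily {n : ℕ} (g : ℝ → Eucl n → ℂ) : Prop where
  meas : Measurable (Function.uncurry g)
  bdd : ∃ B : ℝ, ∀ t y, ‖g t y‖ ≤ B
  supp : ∃ R : ℝ, ∀ t y, R < ‖y‖ → g t y = 0

theorem BddSuppFamily.bddSupp {n : ℕ} {g : ℝ → Eucl n → ℂ} (hg : BddSuppFamily g) (t : ℝ) :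
    BddSupp (g t) := by
  obtain ⟨B, hB⟩ := hg.bdd
  obtain ⟨R, hR⟩ := hg.supp
  have hm : Measurable (Function.uncurry g ∘ fun y => (t, y)) := hg.meas.comp (by fun_prop)
  exact ⟨hm, ⟨B, hB t⟩, R, hR t⟩

theorem BddSuppFamily.exists_norm_gHat_le {n : ℕ} {g : ℝ → Eucl n → ℂ} (hg : BddSuppFamily g)
    (F : Eucl n → ℝ) : ∃ b : ℝ, ∀ t ζ, ‖gHat F (g t) ζ‖ ≤ b := by
  obtain ⟨B, hB⟩ := hg.bdd
  obtain ⟨R, hR⟩ := hg.supp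
  refine ⟨∫ y, (Metric.closedBall (0 : Eucl n) R).indicator (fun _ => B) y, fun t ζ =>
    (norm_gHat_le F (g t) ζ).trans (integral_mono (hg.bddSupp t).integrable.norm
      ((integrable_indicator_iff Metric.isClosed_closedBall.measurableSet).2
        (integrableOn_const measure_closedBall_lt_top.ne)) fun y => ?_)⟩
  by_cases hy : ‖y‖ ≤ R
  · rw [Set.indicator_of_mem (by simpa using hy)]; exact hB t y
  · simp only
    rw [hR t y (not_le.1 hy), norm_zero]
    exact Set.indicator_nonneg (fun _ _ => (norm_nonneg _).trans (hB t y)) _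

/-- The adjoint of the half-wave flow restricted to the graph of `F`, over the time interval
`[0, 1]`, on the Fourier side. -/
def waveSum {n : ℕ} (σ : ℝ) (F : Eucl n → ℝ) (g : ℝ → Eucl n → ℂ) (ξ : Eucl (n + 1)) : ℂ :=
  ∫ t in Set.Icc (0 : ℝ) 1, ec (-(σ * t * ‖ξ‖)) * gHat F (g t) ξ

theorem measurable_gHat_family {n : ℕ} {F : Eucl n → ℝ} (hF : Measurable F)
    {g : ℝ → Eucl n → ℂ} (hg : Measurable (Function.uncurry g)) :
    Measurable fun p : Eucl (n + 1) × ℝ => gHat F (g p.2) p.1 := by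
  have h1 := measurable_graphPoint hF
  have h2 : Measurable fun q : (Eucl (n + 1) × ℝ) × Eucl n => g q.1.2 q.2 :=
    hg.comp ((measurable_snd.comp measurable_fst).prodMk measurable_snd)
  refine StronglyMeasurable.measurable (StronglyMeasurable.integral_prod_right'
    (f := fun q : (Eucl (n + 1) × ℝ) × Eucl n =>
      ec (-inner ℝ (graphPoint F q.2) q.1.1) * g q.1.2 q.2) ?_)
  exact (by fun_prop : Measurable _).stronglyMeasurable

/-- The `T T*` identity: expanding the square of the time integral, the two phases combine into a
half-wave at the time difference. -/
theorem lintegral_cutoff_mul_waveSum_sq_le {n : ℕ} {ϱ σ : ℝ} (hϱ : 0 < ϱ) {F : Eucl n → ℝ}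
    (hF : Measurable F) {g : ℝ → Eucl n → ℂ} (hg : BddSuppFamily g) :
    ∫⁻ ξ, ENNReal.ofReal (annulusCutoff (ϱ⁻¹ • ξ)) * ‖waveSum σ F g ξ‖ₑ ^ 2 ≤
      ∫⁻ p : ℝ × ℝ, ‖waveForm ϱ (σ * (p.2 - p.1)) F (g p.1) (g p.2)‖ₑ
        ∂((volume.restrict (Set.Icc 0 1)).prod (volume.restrict (Set.Icc 0 1))) := by
  set ν : Measure ℝ := volume.restrict (Set.Icc 0 1) with hν
  obtain ⟨b, hb⟩ := hg.exists_norm_gHat_le F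
  set k : Eucl (n + 1) → ℝ → ℂ := fun ξ t => ec (-(σ * t * ‖ξ‖)) * gHat F (g t) ξ with hk
  have hkm : Measurable (Function.uncurry k) := by
    have := measurable_gHat_family hF hg.meas
    simp only [hk, Function.uncurry_def]
    fun_prop
  have hkb : ∀ ξ t, ‖k ξ t‖ ≤ b := fun ξ t => by
    rw [hk]; simp only [norm_mul, norm_ec, one_mul]; exact hb t ξ
  have hH : ∀ ξ, waveSum σ F g ξ = ∫ t, k ξ t * 1 ∂ν := fun ξ => by simp only [mul_one]; rfl
  have hHm : Measurable (waveSum σ F g) :=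
    (hkm.stronglyMeasurable.integral_prod_right' (f := Function.uncurry k)).measurable
  have ha : Integrable fun ξ : Eucl (n + 1) => (annulusCutoff (ϱ⁻¹ • ξ) : ℂ) := by
    simpa using integrable_annulusCutoff_ec (m := n + 1) hϱ 0
  have key := integral_mul_mul_conj_eq ha hkm hkb (F := fun _ => 1) (G := fun _ => 1) (μ := ν)
    (integrable_const _) (integrable_const _)
  simp_rw [← hH] at key
  have hHb : ∀ ξ, ‖waveSum σ F g ξ‖ ≤ b := fun ξ => by
    have := norm_integral_le_of_norm_le_const (μ := ν) (f := k ξ)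
      (Filter.Eventually.of_forall (hkb ξ))
    rw [hH]
    simpa [hν] using this
  have e1 : ∀ ξ, (annulusCutoff (ϱ⁻¹ • ξ) : ℂ) * waveSum σ F g ξ *
      (starRingEnd ℂ) (waveSum σ F g ξ) =
      ((annulusCutoff (ϱ⁻¹ • ξ) * ‖waveSum σ F g ξ‖ ^ 2 : ℝ) : ℂ) := fun ξ => by
    rw [mul_assoc, Complex.mul_conj, Complex.normSq_eq_norm_sq]
    push_cast; ring
  have hint : Integrable fun ξ => annulusCutoff (ϱ⁻¹ • ξ) * ‖waveSum σ F g ξ‖ ^ 2 := by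
    have h1 : Integrable fun ξ : Eucl (n + 1) => annulusCutoff (ϱ⁻¹ • ξ) := ha.re
    refine (h1.bdd_mul (c := b ^ 2) (f := fun ξ => ‖waveSum σ F g ξ‖ ^ 2)
      (by fun_prop) (Filter.Eventually.of_forall fun ξ => ?_)).congr
      (Filter.Eventually.of_forall fun ξ => mul_comm _ _)
    rw [Real.norm_eq_abs, abs_of_nonneg (by positivity)]
    have := hHb ξ
    gcongr
  have h0 : ∀ ξ, 0 ≤ annulusCutoff (ϱ⁻¹ • ξ) * ‖waveSum σ F g ξ‖ ^ 2 := fun ξ =>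
    mul_nonneg (annulusCutoff_nonneg _) (by positivity)
  have e2 : ∫⁻ ξ, ENNReal.ofReal (annulusCutoff (ϱ⁻¹ • ξ)) * ‖waveSum σ F g ξ‖ₑ ^ 2 =
      ‖∫ ξ, (annulusCutoff (ϱ⁻¹ • ξ) : ℂ) * waveSum σ F g ξ *
        (starRingEnd ℂ) (waveSum σ F g ξ)‖ₑ := by
    simp_rw [e1]
    rw [integral_complex_ofReal, ← ofReal_norm, Complex.norm_real, Real.norm_eq_abs,
      abs_of_nonneg (integral_nonneg h0), ofReal_integral_eq_lintegral_ofReal hint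
        (Filter.Eventually.of_forall h0)]
    refine lintegral_congr fun ξ => ?_
    rw [ENNReal.ofReal_mul (annulusCutoff_nonneg _), ENNReal.ofReal_pow (norm_nonneg _),
      ofReal_norm]
  rw [e2, key]
  refine (enorm_integral_le_lintegral_enorm _).trans_eq (lintegral_congr fun p => ?_)
  congr 1
  rw [map_one, mul_one, one_mul, waveForm]
  congr 1; ext ξ
  rw [hk]
  simp only
  rw [map_mul, conj_ec, neg_neg, show σ * (p.2 - p.1) * ‖ξ‖ = -(σ * p.1 * ‖ξ‖) + σ * p.2 * ‖ξ‖ by ring,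
    ec_add]
  ring

theorem prod_restrict_diagonal_eq_zero (s : Set ℝ) :
    ((volume.restrict s).prod (volume.restrict s)) {p : ℝ × ℝ | p.1 = p.2} = 0 := by
  rw [Measure.measure_prod_null (measurableSet_eq_fun measurable_fst measurable_snd)]
  refine Filter.Eventually.of_forall fun t => ?_
  have : Prod.mk t ⁻¹' {p : ℝ × ℝ | p.1 = p.2} = {t} := by ext s; simp [eq_comm]
  simp [this]

/-- The fixed time bound under the double time integral, then fractional integration. The functions
`a` bound the spatial norms by `‖g t‖₂ ≤ a³`. Coinciding times are excluded from the fixed time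
bound but form a null set. -/
theorem exists_lintegral_waveSum_sq_le (n : ℕ) (M : ℝ≥0) :
    ∃ C : ℝ≥0, ∀ F : Eucl n → ℝ, IsC11With n M F → (∀ x, ‖fderiv ℝ F x‖ ≤ 1 / 20) →
      ∀ ϱ : ℝ, 0 < ϱ → ∀ σ : ℝ, σ = 1 ∨ σ = -1 → ∀ g : ℝ → Eucl n → ℂ, BddSuppFamily g →
      ∀ a : ℝ → ℝ, Measurable a → (∀ t, 0 ≤ a t) →
      (∀ t ∈ Set.Icc (0 : ℝ) 1, ∫⁻ y, ‖g t y‖ₑ ^ 2 ≤ ENNReal.ofReal (a t ^ 6)) →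
      ∀ N : ℝ, 0 < N → ∫⁻ t in Set.Icc (0 : ℝ) 1, ENNReal.ofReal (a t ^ 4) ≤ ENNReal.ofReal (N ^ 4) →
        ∫⁻ ξ, ENNReal.ofReal (annulusCutoff (ϱ⁻¹ • ξ)) * ‖waveSum σ F g ξ‖ₑ ^ 2 ≤
          C * ENNReal.ofReal (√ϱ * N ^ 6) := by
  obtain ⟨C₁, h₁⟩ := exists_waveForm_le n M
  obtain ⟨C₂, h₂⟩ := exists_lintegral_cube_mul_cube_le
  refine ⟨NNReal.sqrt C₁ * C₂, fun F hF hF' ϱ hϱ σ hσ g hg a ha ha0 hga N hN hI => ?_⟩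
  refine (lintegral_cutoff_mul_waveSum_sq_le hϱ hF.contDiff.continuous.measurable hg).trans ?_
  set c : ℝ := ((NNReal.sqrt C₁ : ℝ≥0) : ℝ) with hc
  have hc0 : 0 ≤ c := NNReal.coe_nonneg _
  have hc2 : c ^ 2 = C₁ := by rw [hc, ← NNReal.coe_pow, NNReal.sq_sqrt]
  have hae : ∀ᵐ p : ℝ × ℝ ∂((volume.restrict (Set.Icc 0 1)).prod (volume.restrict (Set.Icc 0 1))),
      ‖waveForm ϱ (σ * (p.2 - p.1)) F (g p.1) (g p.2)‖ₑ ≤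
        ENNReal.ofReal (c * √ϱ) * ENNReal.ofReal (a p.1 ^ 3 * a p.2 ^ 3 * (√|p.2 - p.1|)⁻¹) := by
    have hd : ∀ᵐ p : ℝ × ℝ ∂((volume.restrict (Set.Icc 0 1)).prod
        (volume.restrict (Set.Icc 0 1))), p.1 ≠ p.2 := by
      rw [ae_iff]; simpa using prod_restrict_diagonal_eq_zero (Set.Icc 0 1)
    have hI : ∀ᵐ p : ℝ × ℝ ∂((volume.restrict (Set.Icc 0 1)).prod
        (volume.restrict (Set.Icc 0 1))), p ∈ Set.Icc (0 : ℝ) 1 ×ˢ Set.Icc (0 : ℝ) 1 := by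
      rw [Measure.prod_restrict]
      exact ae_restrict_mem (measurableSet_Icc.prod measurableSet_Icc)
    filter_upwards [hd, hI] with p hp hpI
    obtain ⟨⟨h1, h2⟩, h3, h4⟩ := hpI
    have hne : p.2 - p.1 ≠ 0 := sub_ne_zero.2 hp.symm
    have habs : |σ * (p.2 - p.1)| = |p.2 - p.1| := by
      rcases hσ with rfl | rfl <;> simp [abs_sub_comm]
    have h5 := h₁ F hF hF' ϱ (σ * (p.2 - p.1)) hϱ
      (mul_ne_zero (by rcases hσ with rfl | rfl <;> norm_num) hne)
      (by rw [habs, abs_le]; constructor <;> linarith) _ _ (hg.bddSupp p.1) (hg.bddSupp p.2)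
    rw [habs] at h5
    have ha1 := ha0 p.1
    have ha2 := ha0 p.2
    have hu : 0 < |p.2 - p.1| := abs_pos.2 hne
    rw [← ENNReal.ofReal_mul (by positivity)]
    refine (ENNReal.pow_le_pow_left_iff two_ne_zero).1 (h5.trans ?_)
    calc _ ≤ ENNReal.ofReal (c ^ 2) * ENNReal.ofReal (ϱ / |p.2 - p.1|) * ENNReal.ofReal (a p.1 ^ 6) *
          ENNReal.ofReal (a p.2 ^ 6) := by
          rw [hc2, ENNReal.ofReal_coe_nnreal]
          gcongr
          · exact hga _ ⟨h1, h2⟩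
          · exact hga _ ⟨h3, h4⟩
      _ = _ := by
          rw [← ENNReal.ofReal_mul (by positivity), ← ENNReal.ofReal_mul (by positivity),
            ← ENNReal.ofReal_mul (by positivity), ← ENNReal.ofReal_pow (by positivity)]
          congr 1
          rw [mul_pow, mul_pow c, mul_pow _ (√|p.2 - p.1|)⁻¹, inv_pow, Real.sq_sqrt hϱ.le,
            Real.sq_sqrt hu.le]
          ring
  refine (lintegral_mono_ae hae).trans ?_
  rw [lintegral_const_mul _ (by fun_prop)]
  refine (mul_le_mul_right (h₂ a ha ha0 N hN hI) _).trans_eq ?_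
  rw [ENNReal.ofReal_mul hc0, ENNReal.ofReal_mul (Real.sqrt_nonneg _), hc,
    ENNReal.ofReal_coe_nnreal]
  push_cast
  ring

/-! ### Duality -/

theorem norm_integral_mul_le {X : Type*} [MeasurableSpace X] {μ : Measure X} {k φ : X → ℂ}
    (hk : ∀ x, ‖k x‖ ≤ 1) (hφ : Integrable φ μ) : ‖∫ x, k x * φ x ∂μ‖ ≤ ∫ x, ‖φ x‖ ∂μ := by
  refine norm_integral_le_of_norm_le hφ.norm (Filter.Eventually.of_forall fun x => ?_)
  rw [norm_mul]
  exact mul_le_of_le_one_left (norm_nonneg _) (hk x)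

theorem measurable_integral_kernel_mul {X Z : Type*} [MeasurableSpace X] [MeasurableSpace Z]
    {ν : Measure Z} [SFinite ν] {k : X → Z → ℂ} (hk : Measurable (Function.uncurry k)) {φ : Z → ℂ}
    (hφ : Measurable φ) : Measurable fun x => ∫ z, k x z * φ z ∂ν := by
  refine StronglyMeasurable.measurable (StronglyMeasurable.integral_prod_right'
    (f := fun p : X × Z => k p.1 p.2 * φ p.2) ?_)
  exact (hk.mul (hφ.comp measurable_snd)).stronglyMeasurable

/-- Write `T` for the operator with kernel `k`. Then `∫ w |Tφ|² = ⟨φ, T*(w Tφ)⟩`, and Cauchy–Schwarz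
on the support of `φ` reduces a bound for `T` to one for `T*`. -/
theorem sq_lintegral_weight_mul_sq_le {X Z : Type*} [MeasurableSpace X] [MeasurableSpace Z]
    {μ : Measure X} {ν : Measure Z} [SFinite μ] [SFinite ν] {k : X → Z → ℂ}
    (hk : Measurable (Function.uncurry k)) (hk1 : ∀ x z, ‖k x z‖ ≤ 1) {φ : Z → ℂ}
    (hφm : Measurable φ) (hφ : Integrable φ ν) {w : X → ℝ} (hwm : Measurable w) (hw0 : ∀ x, 0 ≤ w x)
    (hw : Integrable w μ) {s : Set Z} (hs : MeasurableSet s) (hφs : ∀ z, φ z ≠ 0 → z ∈ s) :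
    (∫⁻ x, ENNReal.ofReal (w x) * ‖∫ z, k x z * φ z ∂ν‖ₑ ^ 2 ∂μ) ^ 2 ≤
      (∫⁻ z, ‖φ z‖ₑ ^ 2 ∂ν) *
        ∫⁻ z in s, ‖∫ x, (starRingEnd ℂ) (k x z) * (w x * ∫ z, k x z * φ z ∂ν) ∂μ‖ₑ ^ 2 ∂ν := by
  have hcm : Measurable (starRingEnd ℂ) := Complex.continuous_conj.measurable
  set U : X → ℂ := fun x => ∫ z, k x z * φ z ∂ν with hU
  set V : Z → ℂ := fun z => ∫ x, (starRingEnd ℂ) (k x z) * (w x * U x) ∂μ with hV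
  have hUm : Measurable U := measurable_integral_kernel_mul hk hφm
  have hwUm : Measurable fun x => (w x : ℂ) * U x := by fun_prop
  have hkc : Measurable (Function.uncurry fun z x => (starRingEnd ℂ) (k x z)) :=
    hcm.comp (hk.comp measurable_swap)
  have hVm : Measurable V := measurable_integral_kernel_mul hkc hwUm
  have hUb : ∀ x, ‖U x‖ ≤ ∫ z, ‖φ z‖ ∂ν := fun x => norm_integral_mul_le (hk1 x) hφ
  set b := ∫ z, ‖φ z‖ ∂ν with hb
  have hwU : Integrable (fun x => (w x : ℂ) * U x) μ := by
    refine (hw.ofReal.bdd_mul (𝕜 := ℂ) (c := b) (f := U) hUm.aestronglyMeasurable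
      (Filter.Eventually.of_forall hUb)).congr (Filter.Eventually.of_forall fun x => mul_comm _ _)
  have hwUc : Integrable (fun x => (starRingEnd ℂ) (w x * U x)) μ :=
    Complex.conjCLE.toContinuousLinearMap.integrable_comp hwU
  have hwUU : Integrable (fun x => w x * ‖U x‖ ^ 2) μ := by
    refine (hw.bdd_mul (c := b ^ 2) (f := fun x => ‖U x‖ ^ 2)
      (by fun_prop) (Filter.Eventually.of_forall fun x => ?_)).congr
      (Filter.Eventually.of_forall fun x => mul_comm _ _)
    rw [Real.norm_eq_abs, abs_of_nonneg (by positivity)]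
    have := hUb x
    gcongr
  have h0 : ∀ x, 0 ≤ w x * ‖U x‖ ^ 2 := fun x => mul_nonneg (hw0 x) (by positivity)
  have e1 : ∫⁻ x, ENNReal.ofReal (w x) * ‖U x‖ₑ ^ 2 ∂μ =
      ‖∫ x, U x * (starRingEnd ℂ) (w x * U x) ∂μ‖ₑ := by
    have e : ∀ x, U x * (starRingEnd ℂ) (w x * U x) = ((w x * ‖U x‖ ^ 2 : ℝ) : ℂ) := fun x => by
      rw [map_mul, Complex.conj_ofReal, mul_left_comm, Complex.mul_conj, Complex.normSq_eq_norm_sq]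
      push_cast; ring
    simp_rw [e]
    rw [integral_complex_ofReal, ← ofReal_norm, Complex.norm_real, Real.norm_eq_abs,
      abs_of_nonneg (integral_nonneg h0), ofReal_integral_eq_lintegral_ofReal hwUU
        (Filter.Eventually.of_forall h0)]
    refine lintegral_congr fun x => ?_
    rw [ENNReal.ofReal_mul (hw0 x), ENNReal.ofReal_pow (norm_nonneg _), ofReal_norm]
  have e2 : ∫ x, U x * (starRingEnd ℂ) (w x * U x) ∂μ = ∫ z, φ z * (starRingEnd ℂ) (V z) ∂ν := by
    simp_rw [hU, ← integral_mul_const]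
    rw [integral_integral_swap]
    · congr 1; ext z
      rw [hV, ← integral_conj, ← integral_const_mul]
      congr 1; ext x
      simp only [map_mul, Complex.conj_conj, hU]
      ring
    · have h1 := hwUc.mul_prod hφ
      refine (h1.bdd_mul (c := 1) (f := Function.uncurry k) hk.aestronglyMeasurable
        (Filter.Eventually.of_forall fun q => hk1 _ _)).congr
        (Filter.Eventually.of_forall fun q => ?_)
      simp only [Function.uncurry, hU]; ring
  have e3 : ‖∫ z, φ z * (starRingEnd ℂ) (V z) ∂ν‖ₑ ≤
      ∫⁻ z, ‖φ z‖ₑ * s.indicator (fun z => ‖V z‖ₑ) z ∂ν := by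
    refine (enorm_integral_le_lintegral_enorm _).trans (lintegral_mono fun z => ?_)
    by_cases h : φ z = 0
    · simp [h]
    · rw [Set.indicator_of_mem (hφs z h), enorm_mul, ← ofReal_norm ((starRingEnd ℂ) _),
        RCLike.norm_conj, ofReal_norm]
  rw [e1, e2]
  refine (pow_le_pow_left' e3 2).trans ((sq_lintegral_mul_le hφm.enorm.aemeasurable
    (hVm.enorm.indicator hs).aemeasurable).trans ?_)
  refine mul_le_mul_right (le_of_eq ?_) _
  rw [← lintegral_indicator hs]
  refine lintegral_congr fun z => ?_
  by_cases h : z ∈ s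
  · rw [Set.indicator_of_mem h, Set.indicator_of_mem h]
  · rw [Set.indicator_of_notMem h, Set.indicator_of_notMem h, zero_pow two_ne_zero]

/-! ### The square function estimate -/

/-- The half-wave evolution of a function with Fourier transform `φ`, on the graph of `F`. -/
def graphWave {n : ℕ} (σ : ℝ) (F : Eucl n → ℝ) (φ : Eucl (n + 1) → ℂ) (t : ℝ) (x : Eucl n) : ℂ :=
  ∫ ξ, ec (inner ℝ (graphPoint F x) ξ + σ * t * ‖ξ‖) * φ ξ

theorem measurable_graphWave {n : ℕ} (σ : ℝ) {F : Eucl n → ℝ} (hF : Measurable F)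
    {φ : Eucl (n + 1) → ℂ} (hφ : Measurable φ) :
    Measurable fun p : ℝ × Eucl n => graphWave σ F φ p.1 p.2 := by
  have hgp := measurable_graphPoint hF
  refine measurable_integral_kernel_mul (k := fun (p : ℝ × Eucl n) ξ =>
    ec (inner ℝ (graphPoint F p.2) ξ + σ * p.1 * ‖ξ‖)) ?_ hφ
  simp only [Function.uncurry_def]; fun_prop

theorem norm_graphWave_le {n : ℕ} (σ : ℝ) (F : Eucl n → ℝ) {φ : Eucl (n + 1) → ℂ}
    (hφ : Integrable φ) (t : ℝ) (x : Eucl n) : ‖graphWave σ F φ t x‖ ≤ ∫ ξ, ‖φ ξ‖ :=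
  norm_integral_mul_le (fun ξ => by simp) hφ

theorem integral_conj_mul_eq_waveSum {n : ℕ} (σ : ℝ) {F : Eucl n → ℝ} (hF : Measurable F)
    {h : ℝ × Eucl n → ℂ} (hh : Integrable h ((volume.restrict (Set.Icc 0 1)).prod volume))
    (ξ : Eucl (n + 1)) :
    ∫ p, (starRingEnd ℂ) (ec (inner ℝ (graphPoint F p.2) ξ + σ * p.1 * ‖ξ‖)) * h p
        ∂((volume.restrict (Set.Icc (0 : ℝ) 1)).prod volume) =
      waveSum σ F (fun t y => h (t, y)) ξ := by
  have hgp := measurable_graphPoint hF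
  have hk : Measurable fun p : ℝ × Eucl n =>
      (starRingEnd ℂ) (ec (inner ℝ (graphPoint F p.2) ξ + σ * p.1 * ‖ξ‖)) :=
    Complex.continuous_conj.measurable.comp (by fun_prop)
  rw [integral_prod _ (hh.bdd_mul (c := 1) hk.aestronglyMeasurable
    (Filter.Eventually.of_forall fun p => by rw [RCLike.norm_conj, norm_ec])), waveSum]
  congr 1; ext t
  rw [gHat, ← integral_const_mul]
  congr 1; ext y
  rw [← mul_assoc (ec _), ← ec_add, conj_ec, neg_add, add_comm]

/-- Duality with the extremal choice of test function. With `e(t)` the energy at time `t` and `N⁴ =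
I = ∫ e²`, weighting by `e` gives `I² ≤ P · C√ϱ N⁶`, where `P` is the squared norm of `φ`;
cancelling `N⁶` leaves `N² ≤ C√ϱ P`. Restriction to a ball keeps all quantities finite, which the
cancellation needs. -/
theorem exists_lintegral_graphWave_ball_le (n : ℕ) (M : ℝ≥0) :
    ∃ C : ℝ≥0, ∀ F : Eucl n → ℝ, IsC11With n M F → (∀ x, ‖fderiv ℝ F x‖ ≤ 1 / 20) →
      ∀ ϱ : ℝ, 0 < ϱ → ∀ σ : ℝ, σ = 1 ∨ σ = -1 → ∀ φ : Eucl (n + 1) → ℂ, Measurable φ →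
      Integrable φ → (∀ ξ, φ ξ ≠ 0 → 3 / 4 * ϱ ≤ ‖ξ‖ ∧ ‖ξ‖ ≤ 2 * ϱ) → ∀ R : ℝ,
        ∫⁻ t in Set.Icc (0 : ℝ) 1,
            (∫⁻ x in Metric.closedBall (0 : Eucl n) R, ‖graphWave σ F φ t x‖ₑ ^ 2) ^ 2 ≤
          (C * ENNReal.ofReal √ϱ * ∫⁻ ξ, ‖φ ξ‖ₑ ^ 2) ^ 2 := by
  obtain ⟨C, hC⟩ := exists_lintegral_waveSum_sq_le n M
  refine ⟨C, fun F hF hF' ϱ hϱ σ hσ φ hφm hφ hsupp R => ?_⟩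
  have hFm := hF.contDiff.continuous.measurable
  have hgp := measurable_graphPoint hFm
  set ν : Measure ℝ := volume.restrict (Set.Icc 0 1) with hν
  have hball : MeasurableSet (Metric.closedBall (0 : Eucl n) R) :=
    Metric.isClosed_closedBall.measurableSet
  set k : ℝ × Eucl n → Eucl (n + 1) → ℂ := fun p ξ =>
    ec (inner ℝ (graphPoint F p.2) ξ + σ * p.1 * ‖ξ‖) with hk
  have hkm : Measurable (Function.uncurry k) := by
    simp only [hk, Function.uncurry_def]; fun_prop
  have hk1 : ∀ p ξ, ‖k p ξ‖ ≤ 1 := fun p ξ => by simp [hk]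
  have hEm : Measurable fun p : ℝ × Eucl n => graphWave σ F φ p.1 p.2 :=
    measurable_graphWave σ hFm hφm
  set b := ∫ ξ, ‖φ ξ‖ with hb
  have hb0 : 0 ≤ b := integral_nonneg fun _ => norm_nonneg _
  have hEb : ∀ t x, ‖graphWave σ F φ t x‖ ≤ b := norm_graphWave_le σ F hφ
  set e : ℝ → ℝ≥0∞ := fun t =>
    ∫⁻ x in Metric.closedBall (0 : Eucl n) R, ‖graphWave σ F φ t x‖ₑ ^ 2 with he
  have hem : Measurable e :=
    (hEm.enorm.pow_const 2).lintegral_prod_right' (ν := volume.restrict (Metric.closedBall 0 R))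
  set B := ENNReal.ofReal b ^ 2 * volume (Metric.closedBall (0 : Eucl n) R) with hB
  have hBt : B ≠ ∞ := ENNReal.mul_ne_top (ENNReal.pow_ne_top ENNReal.ofReal_ne_top)
    measure_closedBall_lt_top.ne
  have heB : ∀ t, e t ≤ B := fun t => by
    rw [hB, ← setLIntegral_const]
    refine lintegral_mono fun x => pow_le_pow_left' ?_ 2
    rw [← ofReal_norm]; exact ENNReal.ofReal_le_ofReal (hEb t x)
  have het : ∀ t, e t ≠ ∞ := fun t => ((heB t).trans_lt hBt.lt_top).ne
  set a : ℝ → ℝ := fun t => √(e t).toReal with ha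
  have ham : Measurable a := by fun_prop
  have ha2 : ∀ t, a t ^ 2 = (e t).toReal := fun t => Real.sq_sqrt ENNReal.toReal_nonneg
  have hae : ∀ t m, ENNReal.ofReal (a t ^ (2 * m)) = e t ^ m := fun t m => by
    rw [pow_mul, ha2, ENNReal.ofReal_pow ENNReal.toReal_nonneg, ENNReal.ofReal_toReal (het t)]
  set I := ∫⁻ t, e t ^ 2 ∂ν with hI
  have hIt : I ≠ ∞ := by
    refine ((lintegral_mono fun t => pow_le_pow_left' (heB t) 2).trans_lt ?_).ne
    rw [lintegral_const]
    exact ENNReal.mul_lt_top (ENNReal.pow_lt_top hBt.lt_top) (by simp [hν])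
  by_cases hI0 : I = 0
  · rw [hI0]; exact zero_le
  set N := √√I.toReal with hN
  have hN0 : 0 < N := Real.sqrt_pos.2 (Real.sqrt_pos.2 (ENNReal.toReal_pos hI0 hIt))
  have hN4 : N ^ 4 = I.toReal := by
    rw [show N ^ 4 = (N ^ 2) ^ 2 by ring, hN, Real.sq_sqrt (Real.sqrt_nonneg _),
      Real.sq_sqrt ENNReal.toReal_nonneg]
  have hNI : ENNReal.ofReal (N ^ 4) = I := by rw [hN4, ENNReal.ofReal_toReal hIt]
  -- The energy itself as weight: the left side of the duality inequality becomes `∫ e² = I`, and `g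
  -- t` has squared norm `e³ = a⁶` with `a = √e`, matching the form of the dual estimate.
  set w : ℝ × Eucl n → ℝ := fun p =>
    (Metric.closedBall (0 : Eucl n) R).indicator (fun _ => (e p.1).toReal) p.2 with hw
  have hwm : Measurable w := by
    have h1 : Measurable fun p : ℝ × Eucl n => (e p.1).toReal := by fun_prop
    exact h1.indicator (hball.preimage measurable_snd)
  have hw0 : ∀ p, 0 ≤ w p := fun p => Set.indicator_nonneg (fun _ _ => ENNReal.toReal_nonneg) _
  have heBr : ∀ t, (e t).toReal ≤ B.toReal := fun t => ENNReal.toReal_mono hBt (heB t)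
  have hwi : Integrable w (ν.prod volume) := by
    have h1 : Integrable ((Metric.closedBall (0 : Eucl n) R).indicator fun _ => B.toReal) :=
      (integrable_indicator_iff hball).2 (integrableOn_const measure_closedBall_lt_top.ne)
    have h2 : Integrable (fun _ : ℝ => (1 : ℝ)) ν := integrable_const _
    refine (h2.mul_prod h1).mono' hwm.aestronglyMeasurable (Filter.Eventually.of_forall fun p => ?_)
    rw [Real.norm_eq_abs, abs_of_nonneg (hw0 p), one_mul]
    exact Set.indicator_le_indicator (heBr p.1)
  set g : ℝ → Eucl n → ℂ := fun t y => (w (t, y) : ℂ) * graphWave σ F φ t y with hg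
  have hgf : BddSuppFamily g := by
    refine ⟨?_, ⟨B.toReal * b, fun t y => ?_⟩, R, fun t y hy => ?_⟩
    · exact (Complex.measurable_ofReal.comp hwm).mul hEm
    · rw [hg]
      simp only [norm_mul, Complex.norm_real, Real.norm_eq_abs]
      rw [abs_of_nonneg (hw0 _)]
      refine mul_le_mul ?_ (hEb t y) (norm_nonneg _) ENNReal.toReal_nonneg
      exact Set.indicator_apply_le' (fun _ => heBr t) fun _ => ENNReal.toReal_nonneg
    · rw [hg, hw]
      simp only
      rw [Set.indicator_of_notMem (by simpa using hy)]
      simp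
  have hgsq : ∀ t, ∫⁻ y, ‖g t y‖ₑ ^ 2 ≤ ENNReal.ofReal (a t ^ 6) := fun t => by
    have e1 : ∀ y, ‖g t y‖ₑ ^ 2 = (Metric.closedBall (0 : Eucl n) R).indicator
        (fun y => e t ^ 2 * ‖graphWave σ F φ t y‖ₑ ^ 2) y := fun y => by
      rw [hg, hw]
      simp only
      by_cases hy : y ∈ Metric.closedBall (0 : Eucl n) R
      · rw [Set.indicator_of_mem hy, Set.indicator_of_mem hy, enorm_mul, mul_pow,
          ← ofReal_norm ((_ : ℝ) : ℂ), Complex.norm_real, Real.norm_eq_abs,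
          abs_of_nonneg ENNReal.toReal_nonneg, ENNReal.ofReal_toReal (het t)]
      · rw [Set.indicator_of_notMem hy, Set.indicator_of_notMem hy]; simp
    simp_rw [e1]
    rw [lintegral_indicator hball, lintegral_const_mul' _ _ (ENNReal.pow_ne_top (het t)),
      show (6 : ℕ) = 2 * 3 from rfl, hae, pow_succ (e t) 2]
  have key := hC F hF hF' ϱ hϱ σ hσ g hgf a ham (fun t => Real.sqrt_nonneg _)
    (fun t _ => hgsq t) N hN0 (by
      rw [hNI]
      exact le_of_eq (lintegral_congr fun t => hae t 2))
  set s : Set (Eucl (n + 1)) := {ξ | 3 / 4 * ϱ ≤ ‖ξ‖ ∧ ‖ξ‖ ≤ 2 * ϱ} with hs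
  have hsm : MeasurableSet s :=
    measurableSet_Icc.preimage (f := fun ξ : Eucl (n + 1) => ‖ξ‖) (by fun_prop)
  have hdual := sq_lintegral_weight_mul_sq_le (μ := ν.prod (volume : Measure (Eucl n))) hkm hk1 hφm
    hφ hwm hw0 hwi hsm hsupp
  have hleft : ∫⁻ p, ENNReal.ofReal (w p) * ‖∫ ξ, k p ξ * φ ξ‖ₑ ^ 2 ∂(ν.prod volume) = I := by
    have hm : Measurable fun p : ℝ × Eucl n =>
      ENNReal.ofReal (w p) * ‖graphWave σ F φ p.1 p.2‖ₑ ^ 2 := by fun_prop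
    change ∫⁻ p : ℝ × Eucl n, ENNReal.ofReal (w p) * ‖graphWave σ F φ p.1 p.2‖ₑ ^ 2 ∂_ = I
    rw [lintegral_prod _ hm.aemeasurable]
    refine lintegral_congr fun t => ?_
    have e1 : ∀ y, ENNReal.ofReal (w (t, y)) * ‖graphWave σ F φ t y‖ₑ ^ 2 =
        (Metric.closedBall (0 : Eucl n) R).indicator
        (fun y => e t * ‖graphWave σ F φ t y‖ₑ ^ 2) y := fun y => by
      rw [hw]
      simp only
      by_cases hy : y ∈ Metric.closedBall (0 : Eucl n) R
      · rw [Set.indicator_of_mem hy, Set.indicator_of_mem hy, ENNReal.ofReal_toReal (het t)]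
      · rw [Set.indicator_of_notMem hy, Set.indicator_of_notMem hy]; simp
    simp_rw [e1]
    rw [lintegral_indicator hball, lintegral_const_mul' _ _ (het t), sq]
  have hwU : Integrable (fun p : ℝ × Eucl n => (w p : ℂ) * graphWave σ F φ p.1 p.2)
      (ν.prod volume) :=
    (hwi.ofReal.bdd_mul (𝕜 := ℂ) (c := b) (f := fun p : ℝ × Eucl n => graphWave σ F φ p.1 p.2)
      hEm.aestronglyMeasurable (Filter.Eventually.of_forall fun p => hEb _ _)).congr
      (Filter.Eventually.of_forall fun p => mul_comm _ _)
  have hV : ∀ ξ, ∫ p, (starRingEnd ℂ) (k p ξ) * (w p * ∫ ξ, k p ξ * φ ξ) ∂(ν.prod volume) =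
      waveSum σ F g ξ := fun ξ => integral_conj_mul_eq_waveSum σ hFm hwU ξ
  rw [hleft] at hdual
  simp_rw [hV] at hdual
  have hcut : ∫⁻ ξ in s, ‖waveSum σ F g ξ‖ₑ ^ 2 ≤ C * ENNReal.ofReal (√ϱ * N ^ 6) := by
    refine le_trans ?_ key
    rw [← lintegral_indicator hsm]
    refine lintegral_mono fun ξ => ?_
    by_cases hξ : ξ ∈ s
    swap
    · rw [Set.indicator_of_notMem hξ]; exact zero_le
    -- On the support of `φ` the smooth cutoff equals one, so the localized dual estimate loses
    -- nothing.
    rw [Set.indicator_of_mem hξ, annulusCutoff_eq_one, ENNReal.ofReal_one, one_mul]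
    · rw [norm_smul, Real.norm_eq_abs, abs_of_pos (inv_pos.2 hϱ), le_inv_mul_iff₀ hϱ]
      linarith [hξ.1]
    · rw [norm_smul, Real.norm_eq_abs, abs_of_pos (inv_pos.2 hϱ), inv_mul_le_iff₀ hϱ]
      linarith [hξ.2]
  set P := ∫⁻ ξ, ‖φ ξ‖ₑ ^ 2 with hP
  have h1 : I ^ 2 ≤ P * (C * ENNReal.ofReal (√ϱ * N ^ 6)) := hdual.trans (mul_le_mul_right hcut _)
  rw [ENNReal.ofReal_mul (Real.sqrt_nonneg _), ← hNI, ENNReal.ofReal_pow hN0.le,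
    ENNReal.ofReal_pow hN0.le] at h1
  rw [← hNI, ENNReal.ofReal_pow hN0.le]
  set A := ENNReal.ofReal N with hA
  have hA0 : A ≠ 0 := by simpa [hA] using hN0
  have hAt : A ≠ ∞ := ENNReal.ofReal_ne_top
  have h2 : A ^ 6 * A ^ 2 ≤ A ^ 6 * (C * ENNReal.ofReal √ϱ * P) :=
    calc A ^ 6 * A ^ 2 = (A ^ 4) ^ 2 := by ring
      _ ≤ _ := h1
      _ = _ := by ring
  have h3 := (ENNReal.mul_le_mul_iff_right (pow_ne_zero _ hA0) (ENNReal.pow_ne_top hAt)).1 h2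
  calc A ^ 4 = (A ^ 2) ^ 2 := by ring
    _ ≤ _ := pow_le_pow_left' h3 2

theorem lintegral_graphWave_sq_sq_le_of_balls {n : ℕ} {σ : ℝ} {F : Eucl n → ℝ} (hF : Measurable F)
    {φ : Eucl (n + 1) → ℂ} (hφ : Measurable φ) {K : ℝ≥0∞}
    (h : ∀ R : ℝ, ∫⁻ t in Set.Icc (0 : ℝ) 1,
      (∫⁻ x in Metric.closedBall (0 : Eucl n) R, ‖graphWave σ F φ t x‖ₑ ^ 2) ^ 2 ≤ K) :
    ∫⁻ t in Set.Icc (0 : ℝ) 1, (∫⁻ x, ‖graphWave σ F φ t x‖ₑ ^ 2) ^ 2 ≤ K := by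
  have hm := (measurable_graphWave σ hF hφ).enorm.pow_const 2
  have hlim : ∀ t, Filter.Tendsto (fun j : ℕ => (∫⁻ x in Metric.closedBall (0 : Eucl n) (j : ℝ),
      ‖graphWave σ F φ t x‖ₑ ^ 2) ^ 2) Filter.atTop
      (nhds ((∫⁻ x, ‖graphWave σ F φ t x‖ₑ ^ 2) ^ 2)) := fun t => by
    refine ((ENNReal.continuous_pow 2).tendsto _).comp ?_
    have hU : (⋃ j : ℕ, Metric.closedBall (0 : Eucl n) (j : ℝ)) = Set.univ :=
      Metric.iUnion_closedBall_nat 0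
    have hmono : Monotone fun j : ℕ => Metric.closedBall (0 : Eucl n) (j : ℝ) :=
      fun i j hij => Metric.closedBall_subset_closedBall (by exact_mod_cast hij)
    have h1 := tendsto_measure_iUnion_atTop
      (μ := volume.withDensity fun x => ‖graphWave σ F φ t x‖ₑ ^ 2) hmono
    rw [hU, withDensity_apply _ MeasurableSet.univ, Measure.restrict_univ] at h1
    exact h1.congr fun j => withDensity_apply _ Metric.isClosed_closedBall.measurableSet
  have h2 := lintegral_tendsto_of_tendsto_of_monotone (μ := volume.restrict (Set.Icc (0 : ℝ) 1))
    (f := fun (j : ℕ) t => (∫⁻ x in Metric.closedBall (0 : Eucl n) (j : ℝ),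
      ‖graphWave σ F φ t x‖ₑ ^ 2) ^ 2)
    (fun j => ((Measurable.lintegral_prod_right' (ν := volume.restrict (Metric.closedBall 0 (j : ℝ)))
      hm).pow_const 2).aemeasurable)
    (Filter.Eventually.of_forall fun t i j hij => pow_le_pow_left'
      (lintegral_mono_set (Metric.closedBall_subset_closedBall (by exact_mod_cast hij))) 2)
    (Filter.Eventually.of_forall hlim)
  exact le_of_tendsto' h2 fun j => h j

theorem exists_lintegral_graphWave_le (n : ℕ) (M : ℝ≥0) :
    ∃ C : ℝ≥0, ∀ F : Eucl n → ℝ, IsC11With n M F → (∀ x, ‖fderiv ℝ F x‖ ≤ 1 / 20) →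
      ∀ ϱ : ℝ, 0 < ϱ → ∀ σ : ℝ, σ = 1 ∨ σ = -1 → ∀ φ : Eucl (n + 1) → ℂ, Measurable φ →
      Integrable φ → (∀ ξ, φ ξ ≠ 0 → 3 / 4 * ϱ ≤ ‖ξ‖ ∧ ‖ξ‖ ≤ 2 * ϱ) →
        ∫⁻ t in Set.Icc (0 : ℝ) 1, (∫⁻ x, ‖graphWave σ F φ t x‖ₑ ^ 2) ^ 2 ≤
          (C * ENNReal.ofReal √ϱ * ∫⁻ ξ, ‖φ ξ‖ₑ ^ 2) ^ 2 := by
  obtain ⟨C, hC⟩ := exists_lintegral_graphWave_ball_le n M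
  exact ⟨C, fun F hF hF' ϱ hϱ σ hσ φ hφm hφ hs => lintegral_graphWave_sq_sq_le_of_balls
    hF.contDiff.continuous.measurable hφm fun R => hC F hF hF' ϱ hϱ σ hσ φ hφm hφ hs R⟩

/-! ### The cosine propagator as the mean of the two half-waves -/

/-- The solution of the wave equation with initial position `𝓕⁻ φ` and initial velocity zero. -/
def cosWave {m : ℕ} (φ : Eucl m → ℂ) (t : ℝ) (x : Eucl m) : ℂ :=
  1 / 2 * ((∫ ξ, ec (inner ℝ x ξ + 1 * t * ‖ξ‖) * φ ξ) +
    ∫ ξ, ec (inner ℝ x ξ + -1 * t * ‖ξ‖) * φ ξ)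

theorem continuous_cosWave {m : ℕ} {φ : Eucl m → ℂ} (hφ : Integrable φ) :
    Continuous (Function.uncurry (cosWave φ)) := by
  have h : ∀ σ : ℝ, Continuous fun p : ℝ × Eucl m =>
      ∫ ξ, ec (inner ℝ p.2 ξ + σ * p.1 * ‖ξ‖) * φ ξ := fun σ =>
    continuous_integral_ec_mul hφ (θ := fun ξ (p : ℝ × Eucl m) => inner ℝ p.2 ξ + σ * p.1 * ‖ξ‖)
      (fun p => by fun_prop) (fun ξ => by fun_prop)
  exact continuous_const.mul ((h 1).add (h (-1)))

theorem cos_eq_ec (s : ℝ) : ((Real.cos (2 * Real.pi * s) : ℝ) : ℂ) = 1 / 2 * (ec s + ec (-s)) := by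
  rw [Complex.ofReal_cos, Complex.cos, ec, ec]
  push_cast
  ring_nf

theorem cosWave_eq_fourierInv {m : ℕ} {φ : Eucl m → ℂ} (hφ : Integrable φ) (t : ℝ) (x : Eucl m) :
    cosWave φ t x = 𝓕⁻ (fun ξ => ((Real.cos (t * (2 * Real.pi * ‖ξ‖)) : ℝ) : ℂ) * φ ξ) x := by
  have hi : ∀ σ : ℝ, Integrable fun ξ => ec (inner ℝ x ξ + σ * t * ‖ξ‖) * φ ξ := fun σ =>
    hφ.bdd_mul (c := 1) (measurable_ec.comp (by fun_prop)).aestronglyMeasurable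
      (Filter.Eventually.of_forall fun ξ => by simp)
  rw [fourierInv_eq_ec, cosWave, ← integral_add (hi 1) (hi (-1)), ← integral_const_mul]
  congr 1; ext ξ
  rw [show t * (2 * Real.pi * ‖ξ‖) = 2 * Real.pi * (t * ‖ξ‖) by ring, cos_eq_ec, one_mul, ec_add,
    ec_add, real_inner_comm x ξ, show -1 * t * ‖ξ‖ = -(t * ‖ξ‖) by ring]
  ring

theorem exists_lintegral_cosWave_le (n : ℕ) (M : ℝ≥0) :
    ∃ C : ℝ≥0, ∀ F : Eucl n → ℝ, IsC11With n M F → (∀ x, ‖fderiv ℝ F x‖ ≤ 1 / 20) →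
      ∀ ϱ : ℝ, 0 < ϱ → ∀ φ : Eucl (n + 1) → ℂ, Measurable φ →
      Integrable φ → (∀ ξ, φ ξ ≠ 0 → 3 / 4 * ϱ ≤ ‖ξ‖ ∧ ‖ξ‖ ≤ 2 * ϱ) →
        ∫⁻ t in Set.Icc (0 : ℝ) 1, (∫⁻ x, ‖cosWave φ t (graphPoint F x)‖ₑ ^ 2) ^ 2 ≤
          (C * ENNReal.ofReal √ϱ * ∫⁻ ξ, ‖φ ξ‖ₑ ^ 2) ^ 2 := by
  obtain ⟨C, hC⟩ := exists_lintegral_graphWave_le n M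
  refine ⟨C, fun F hF hF' ϱ hϱ φ hφm hφ hs => ?_⟩
  have hFm := hF.contDiff.continuous.measurable
  have h1 := hC F hF hF' ϱ hϱ 1 (Or.inl rfl) φ hφm hφ hs
  have h2 := hC F hF hF' ϱ hϱ (-1) (Or.inr rfl) φ hφm hφ hs
  set K := (C * ENNReal.ofReal √ϱ * ∫⁻ ξ, ‖φ ξ‖ₑ ^ 2) ^ 2
  have hm : ∀ σ, Measurable fun p : ℝ × Eucl n => ‖graphWave σ F φ p.1 p.2‖ₑ ^ 2 := fun σ =>
    (measurable_graphWave σ hFm hφm).enorm.pow_const 2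
  have hm' : ∀ σ, Measurable fun t => ∫⁻ x, ‖graphWave σ F φ t x‖ₑ ^ 2 := fun σ =>
    (hm σ).lintegral_prod_right'
  have hms : ∀ σ t, Measurable fun x => ‖graphWave σ F φ t x‖ₑ ^ 2 := fun σ t => by
    have h : Measurable ((fun p : ℝ × Eucl n => ‖graphWave σ F φ p.1 p.2‖ₑ ^ 2) ∘
      fun x => (t, x)) := (hm σ).comp (by fun_prop)
    exact h
  have h4 : ‖(1 / 2 : ℂ)‖ₑ = 2⁻¹ := by
    rw [one_div, enorm_inv two_ne_zero]
    congr 1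
    rw [← ofReal_norm, Complex.norm_ofNat]; simp
  have h22 : (2 : ℝ≥0∞)⁻¹ * 2 = 1 := ENNReal.inv_mul_cancel (by norm_num) (by norm_num)
  have hhalf : ∀ a b : ℝ≥0∞, (2⁻¹ * (a + b)) ^ 2 ≤ 2⁻¹ * (a ^ 2 + b ^ 2) := fun a b => by
    calc _ = 2⁻¹ ^ 2 * (a + b) ^ 2 := by ring
      _ ≤ 2⁻¹ ^ 2 * (2 * a ^ 2 + 2 * b ^ 2) := mul_le_mul_right (ENNReal.add_sq_le a b) _
      _ = (2⁻¹ * 2) * (2⁻¹ * (a ^ 2 + b ^ 2)) := by ring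
      _ = _ := by rw [h22, one_mul]
  have hpt : ∀ t x, ‖cosWave φ t (graphPoint F x)‖ₑ ^ 2 ≤
      2⁻¹ * (‖graphWave 1 F φ t x‖ₑ ^ 2 + ‖graphWave (-1) F φ t x‖ₑ ^ 2) := fun t x => by
    refine le_trans ?_ (hhalf _ _)
    rw [cosWave, enorm_mul, h4]
    exact pow_le_pow_left' (mul_le_mul_right (enorm_add_le _ _) _) 2
  calc _ ≤ ∫⁻ t in Set.Icc (0 : ℝ) 1, (2⁻¹ * ((∫⁻ x, ‖graphWave 1 F φ t x‖ₑ ^ 2) +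
          ∫⁻ x, ‖graphWave (-1) F φ t x‖ₑ ^ 2)) ^ 2 := by
        refine lintegral_mono fun t => pow_le_pow_left' ?_ 2
        refine (lintegral_mono (hpt t)).trans_eq ?_
        rw [lintegral_const_mul' _ _ (by norm_num), lintegral_add_left (hms _ _)]
    _ ≤ ∫⁻ t in Set.Icc (0 : ℝ) 1, 2⁻¹ * ((∫⁻ x, ‖graphWave 1 F φ t x‖ₑ ^ 2) ^ 2 +
          (∫⁻ x, ‖graphWave (-1) F φ t x‖ₑ ^ 2) ^ 2) := lintegral_mono fun t => hhalf _ _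
    _ = 2⁻¹ * ((∫⁻ t in Set.Icc (0 : ℝ) 1, (∫⁻ x, ‖graphWave 1 F φ t x‖ₑ ^ 2) ^ 2) +
          ∫⁻ t in Set.Icc (0 : ℝ) 1, (∫⁻ x, ‖graphWave (-1) F φ t x‖ₑ ^ 2) ^ 2) := by
        rw [lintegral_const_mul' _ _ (by norm_num),
          lintegral_add_left ((hm' _).pow_const 2)]
    _ ≤ 2⁻¹ * (K + K) := by gcongr
    _ = K := by rw [← two_mul, ← mul_assoc, h22, one_mul]

theorem exists_cosSqrtNegLaplacian_le (n : ℕ) (M : ℝ≥0) :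
    ∃ C : ℝ, 0 < C ∧
      ∀ F : Eucl n → ℝ, IsC11With n M F → (∀ x', ‖fderiv ℝ F x'‖ ≤ 1 / 20) →
      ∀ r : ℝ, 1 ≤ r →
      ∀ f : L2Eucl (n + 1), HasFrequencyNear r f →
        ∃ u : ℝ → Eucl (n + 1) → ℂ,
          Continuous (Function.uncurry u) ∧
          (∀ t : ℝ, u t =ᵐ[volume] cosSqrtNegLaplacian t f) ∧
          (∫⁻ t in Set.Icc (0 : ℝ) 1,
              (eLpNorm (fun x' : Eucl n => u t (graphPoint F x')) 2 volume) ^ (4 : ℕ))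
              ^ (1 / 4 : ℝ)
            ≤ ENNReal.ofReal (C * r ^ (1 / 4 : ℝ) * ‖f‖) := by
  obtain ⟨C, hC⟩ := exists_lintegral_cosWave_le n M
  refine ⟨C + 1, by positivity, fun F hF hF' r hr f hf => ?_⟩
  have hπ := Real.pi_pos
  have hr0 : 0 < r := by linarith
  set ϱ := r / (2 * Real.pi) with hϱ
  have hϱ0 : 0 < ϱ := by positivity
  set s : Set (Eucl (n + 1)) := {ξ | 3 / 4 * ϱ ≤ ‖ξ‖ ∧ ‖ξ‖ ≤ 3 / 2 * ϱ} with hs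
  have hsm : MeasurableSet s :=
    measurableSet_Icc.preimage (f := fun ξ : Eucl (n + 1) => ‖ξ‖) (by fun_prop)
  have hsfin : volume s < ∞ := (measure_mono fun ξ hξ => by
    simpa using hξ.2).trans_lt (measure_closedBall_lt_top (x := (0 : Eucl (n + 1))) (r := 3 / 2 * ϱ))
  -- A representative of the transform vanishing everywhere off the annulus, at frequency `ϱ =
  -- r/(2π)` in this normalization. Bounded support makes it integrable, hence the continuous
  -- representative of the solution.
  set φ : Eucl (n + 1) → ℂ := s.indicator (𝓕 f : L2Eucl (n + 1)) with hφ
  have hφm : Measurable φ := (Lp.stronglyMeasurable (𝓕 f)).measurable.indicator hsm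
  have hφ2 : MemLp φ 2 volume := (Lp.memLp (𝓕 f)).indicator hsm
  have hφi : Integrable φ := by
    rw [hφ, integrable_indicator_iff hsm]
    have : IsFiniteMeasure (volume.restrict s) := ⟨by simpa using hsfin⟩
    exact ((Lp.memLp (𝓕 f)).restrict s).integrable one_le_two
  have hφe : φ =ᵐ[volume] (𝓕 f : L2Eucl (n + 1)) := by
    filter_upwards [hf] with ξ hξ
    by_cases h : (𝓕 f : L2Eucl (n + 1)) ξ = 0
    · rw [hφ, Set.indicator_apply, h, ite_self]
    · obtain ⟨h1, h2⟩ := hξ h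
      rw [hφ, Set.indicator_of_mem]
      constructor
      · rw [hϱ, ← mul_div_assoc, div_le_iff₀ (by positivity)]; linarith
      · rw [hϱ, ← mul_div_assoc, le_div_iff₀ (by positivity)]; linarith
  have hφs : ∀ ξ, φ ξ ≠ 0 → 3 / 4 * ϱ ≤ ‖ξ‖ ∧ ‖ξ‖ ≤ 2 * ϱ := fun ξ hξ => by
    have h1 : ξ ∈ s := Set.mem_of_indicator_ne_zero hξ
    exact ⟨h1.1, h1.2.trans (by linarith)⟩
  have hnorm : ∫⁻ ξ, ‖φ ξ‖ₑ ^ 2 = ENNReal.ofReal ‖f‖ ^ 2 := by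
    rw [← eLpNorm_two_sq, eLpNorm_congr_ae hφe, ← Lp.enorm_def, ← ofReal_norm, Lp.norm_fourier_eq]
  have hmain := hC F hF hF' ϱ hϱ0 φ hφm hφi hφs
  refine ⟨cosWave φ, continuous_cosWave hφi, fun t => ?_, ?_⟩
  · have hcφ2 : MemLp (fun ξ => ((Real.cos (t * (2 * Real.pi * ‖ξ‖)) : ℝ) : ℂ) * φ ξ) 2 volume :=
      (memLp_cos_mul t (𝓕 f)).ae_eq (by filter_upwards [hφe] with ξ hξ; rw [hξ])
    have hcφ1 : Integrable fun ξ => ((Real.cos (t * (2 * Real.pi * ‖ξ‖)) : ℝ) : ℂ) * φ ξ :=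
      hφi.bdd_mul (c := 1) (Continuous.aestronglyMeasurable (by fun_prop))
        (Filter.Eventually.of_forall fun ξ => by
          rw [Complex.norm_real]; exact Real.abs_cos_le_one _)
    have h1 := fourierInv_toLp_ae_eq hcφ1 hcφ2
    rw [cosSqrtNegLaplacian, ← MemLp.toLp_congr hcφ2 (memLp_cos_mul t (𝓕 f))
      (by filter_upwards [hφe] with ξ hξ; rw [hξ])]
    filter_upwards [h1] with x hx
    rw [hx, cosWave_eq_fourierInv hφi]
  · have e1 : ∀ t, eLpNorm (fun x' : Eucl n => cosWave φ t (graphPoint F x')) 2 volume ^ 4 =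
        (∫⁻ x, ‖cosWave φ t (graphPoint F x)‖ₑ ^ 2) ^ 2 := fun t => by
      rw [← eLpNorm_two_sq, ← pow_mul]
    simp_rw [e1]
    have h2 : (C * ENNReal.ofReal √ϱ * ENNReal.ofReal ‖f‖ ^ 2) ^ 2 ≤
        ENNReal.ofReal ((C + 1) * r ^ (1 / 4 : ℝ) * ‖f‖) ^ 4 := by
      rw [← ENNReal.ofReal_coe_nnreal, ← ENNReal.ofReal_pow (norm_nonneg _),
        ← ENNReal.ofReal_mul (by positivity), ← ENNReal.ofReal_mul (by positivity),
        ← ENNReal.ofReal_pow (by positivity), ← ENNReal.ofReal_pow (by positivity)]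
      apply ENNReal.ofReal_le_ofReal
      have h3 : (r ^ (1 / 4 : ℝ)) ^ 4 = r := by
        rw [← Real.rpow_natCast, ← Real.rpow_mul hr0.le]; norm_num
      have h4 : ϱ ≤ r := div_le_self hr0.le (by nlinarith [Real.pi_gt_three])
      have h5 : (C : ℝ) ^ 2 ≤ ((C : ℝ) + 1) ^ 4 := by
        have : (0 : ℝ) ≤ C := C.2
        nlinarith [sq_nonneg ((C : ℝ) ^ 2), pow_nonneg this 3]
      calc (C * √ϱ * ‖f‖ ^ 2) ^ 2 = (C : ℝ) ^ 2 * (√ϱ ^ 2) * ‖f‖ ^ 4 := by ring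
        _ ≤ ((C : ℝ) + 1) ^ 4 * r * ‖f‖ ^ 4 := by rw [Real.sq_sqrt hϱ0.le]; gcongr
        _ = _ := by rw [mul_pow, mul_pow, h3]
    rw [hnorm] at hmain
    calc _ ≤ (ENNReal.ofReal ((C + 1) * r ^ (1 / 4 : ℝ) * ‖f‖) ^ 4) ^ (1 / 4 : ℝ) :=
          ENNReal.rpow_le_rpow (hmain.trans h2) (by norm_num)
      _ = _ := by
          rw [← ENNReal.rpow_natCast, ← ENNReal.rpow_mul]; norm_num

/-! ### Polar coordinates -/

theorem lintegral_eq_lintegral_toSphere {n : ℕ} {Φ : Eucl (n + 1) → ℝ≥0∞} (hΦ : Measurable Φ) :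
    ∫⁻ x, Φ x = ∫⁻ ω : Metric.sphere (0 : Eucl (n + 1)) 1, (∫⁻ s in Set.Ioi (0 : ℝ),
      ENNReal.ofReal (s ^ n) * Φ (s • (ω : Eucl (n + 1))))
        ∂((volume : Measure (Eucl (n + 1))).toSphere) := by
  have h1 := (volume : Measure (Eucl (n + 1))).measurePreserving_homeomorphUnitSphereProd
  rw [finrank_euclideanSpace_fin, Nat.add_sub_cancel] at h1
  set f : Metric.sphere (0 : Eucl (n + 1)) 1 × Set.Ioi (0 : ℝ) → ℝ≥0∞ :=
    fun p => Φ ((p.2 : ℝ) • (p.1 : Eucl (n + 1))) with hf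
  have hfm : Measurable f := hΦ.comp (by fun_prop)
  have h2 := h1.lintegral_comp hfm
  have h3 : ∀ x : ({0}ᶜ : Set (Eucl (n + 1))), f (homeomorphUnitSphereProd (Eucl (n + 1)) x) =
      Φ x := fun x => by
    rw [hf]
    simp only [homeomorphUnitSphereProd_apply_snd_coe, homeomorphUnitSphereProd_apply_fst_coe]
    rw [smul_inv_smul₀ (norm_ne_zero_iff.2 x.2)]
  simp_rw [h3] at h2
  rw [lintegral_subtype_comap (measurableSet_singleton _).compl, restrict_compl_singleton] at h2
  rw [h2, lintegral_prod _ hfm.aemeasurable]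
  refine lintegral_congr fun ω => ?_
  have hm : Measurable fun s : Set.Ioi (0 : ℝ) => f (ω, s) := hfm.comp (by fun_prop)
  rw [Measure.volumeIoiPow, lintegral_withDensity_eq_lintegral_mul _ (by fun_prop) hm]
  rw [← lintegral_subtype_comap measurableSet_Ioi
    fun s : ℝ => ENNReal.ofReal (s ^ n) * Φ (s • (ω : Eucl (n + 1)))]
  rfl

theorem lintegral_toSphere_shell_le {n : ℕ} {Φ : Eucl (n + 1) → ℝ≥0∞} (hΦ : Measurable Φ)
    {ϱ δ : ℝ} (hϱ : 0 < ϱ) :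
    ENNReal.ofReal (ϱ ^ n) * ∫⁻ ω : Metric.sphere (0 : Eucl (n + 1)) 1,
        (∫⁻ s in Set.Icc ϱ (ϱ + δ), Φ (s • (ω : Eucl (n + 1))))
          ∂((volume : Measure (Eucl (n + 1))).toSphere) ≤
      ∫⁻ x in {x | ϱ ≤ ‖x‖ ∧ ‖x‖ ≤ ϱ + δ}, Φ x := by
  have hm : MeasurableSet {x : Eucl (n + 1) | ϱ ≤ ‖x‖ ∧ ‖x‖ ≤ ϱ + δ} :=
    measurableSet_Icc.preimage (f := fun x : Eucl (n + 1) => ‖x‖) (by fun_prop)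
  rw [← lintegral_indicator hm, lintegral_eq_lintegral_toSphere (hΦ.indicator hm),
    ← lintegral_const_mul' _ _ ENNReal.ofReal_ne_top]
  refine lintegral_mono fun ω => ?_
  rw [← lintegral_const_mul' _ _ ENNReal.ofReal_ne_top]
  refine le_trans ?_ (lintegral_mono_set (fun s (hs : s ∈ Set.Icc ϱ (ϱ + δ)) => hϱ.trans_le hs.1))
  refine setLIntegral_mono' measurableSet_Icc fun s hs => ?_
  have hs0 : 0 < s := hϱ.trans_le hs.1
  have hn : ‖s • (ω : Eucl (n + 1))‖ = s := by
    rw [norm_smul, mem_sphere_zero_iff_norm.1 ω.2, mul_one, Real.norm_eq_abs, abs_of_pos hs0]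
  rw [Set.indicator_of_mem (by rw [Set.mem_ofPred_eq, hn]; exact hs)]
  have := hs.1
  gcongr

/-- One-dimensional Sobolev: express `ψ ϱ` by `ψ s` and the integral of `ψ'`, then average over `s`
in an interval of length `1/8`. The factor `16` is `2` divided by that length. -/
theorem enorm_sq_le_of_hasDerivAt {ψ ψ' : ℝ → ℂ} (hψ : ∀ s, HasDerivAt ψ (ψ' s) s)
    (hψ' : Continuous ψ') (ϱ : ℝ) :
    ‖ψ ϱ‖ₑ ^ 2 ≤ 16 * (∫⁻ s in Set.Icc ϱ (ϱ + 1 / 8), ‖ψ s‖ₑ ^ 2) +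
      ∫⁻ s in Set.Icc ϱ (ϱ + 1 / 8), ‖ψ' s‖ₑ ^ 2 := by
  set ν : Measure ℝ := volume.restrict (Set.Icc ϱ (ϱ + 1 / 8)) with hν
  have hνu : ν Set.univ = 8⁻¹ := by
    rw [hν, Measure.restrict_apply_univ, Real.volume_Icc]
    rw [add_sub_cancel_left, one_div, ENNReal.ofReal_inv_of_pos (by norm_num)]
    norm_num
  have h88 : (8 : ℝ≥0∞) * 8⁻¹ = 1 := ENNReal.mul_inv_cancel (by norm_num) (by norm_num)
  have hψc : Continuous ψ := continuous_iff_continuousAt.2 fun s => (hψ s).continuousAt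
  have h1 : ∀ s ∈ Set.Icc ϱ (ϱ + 1 / 8), ‖ψ ϱ‖ₑ ^ 2 ≤
      2 * ‖ψ s‖ₑ ^ 2 + 2 * (8⁻¹ * ∫⁻ s, ‖ψ' s‖ₑ ^ 2 ∂ν) := fun s hs => by
    have e : ψ ϱ = ψ s + -∫ τ in ϱ..s, ψ' τ := by
      rw [intervalIntegral.integral_eq_sub_of_hasDerivAt (fun τ _ => hψ τ)
        (hψ'.intervalIntegrable _ _)]
      ring
    rw [e]
    refine (pow_le_pow_left' (enorm_add_le _ _) 2).trans ((ENNReal.add_sq_le _ _).trans ?_)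
    refine add_le_add le_rfl (mul_le_mul_right ?_ _)
    rw [enorm_neg, intervalIntegral.integral_of_le hs.1, ← hνu]
    refine le_trans (pow_le_pow_left' ?_ 2) (sq_lintegral_le hψ'.enorm.aemeasurable)
    refine (enorm_integral_le_lintegral_enorm _).trans (lintegral_mono_set fun τ hτ => ?_)
    exact ⟨hτ.1.le, hτ.2.trans hs.2⟩
  have h2 := setLIntegral_mono' (μ := volume) measurableSet_Icc h1
  rw [lintegral_const, ← hν, hνu, lintegral_add_right _ measurable_const, lintegral_const, hνu,
    lintegral_const_mul _ (by fun_prop)] at h2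
  have h3 := mul_le_mul_right h2 8
  calc ‖ψ ϱ‖ₑ ^ 2 = (8 * 8⁻¹) * ‖ψ ϱ‖ₑ ^ 2 := by rw [h88, one_mul]
    _ = 8 * (‖ψ ϱ‖ₑ ^ 2 * 8⁻¹) := by ring
    _ ≤ _ := h3
    _ = 16 * (∫⁻ s, ‖ψ s‖ₑ ^ 2 ∂ν) + (8 * 8⁻¹) * (2 * 8⁻¹) * ∫⁻ s, ‖ψ' s‖ₑ ^ 2 ∂ν := by ring
    _ ≤ _ := by
        rw [h88, one_mul]
        refine add_le_add le_rfl (mul_le_of_le_one_left' ?_)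
        rw [← h88]; gcongr; norm_num

/-- The dual estimate applied to `h` modulated by `e^{2πitϱ}`, whose norm is constant in time. The
time integral then factors out as the mean of `e^{2πit(ϱ-‖ξ‖)}` over `[0,1]`, which is bounded below
as long as `‖ξ‖` stays within `1/8` of `ϱ`. -/
theorem exists_lintegral_shell_gHat_le (n : ℕ) (M : ℝ≥0) :
    ∃ C : ℝ≥0, ∀ F : Eucl n → ℝ, IsC11With n M F → (∀ x, ‖fderiv ℝ F x‖ ≤ 1 / 20) →
      ∀ ϱ : ℝ, 1 / 8 ≤ ϱ → ∀ h : Eucl n → ℂ, BddSupp h →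
        ∫⁻ ξ in {ξ | ϱ ≤ ‖ξ‖ ∧ ‖ξ‖ ≤ ϱ + 1 / 8}, ‖gHat F h ξ‖ₑ ^ 2 ≤
          C * ENNReal.ofReal √ϱ * ∫⁻ y, ‖h y‖ₑ ^ 2 := by
  obtain ⟨C, hC⟩ := exists_lintegral_waveSum_sq_le n M
  refine ⟨4 * C, fun F hF hF' ϱ hϱ h hh => ?_⟩
  have hϱ0 : 0 < ϱ := by linarith
  have hhm := hh.meas
  set P := ∫⁻ y, ‖h y‖ₑ ^ 2 with hP
  have hPt : P ≠ ∞ := hh.lintegral_sq_lt_top.ne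
  by_cases hP0 : P = 0
  · have h1 : ∀ᵐ y, h y = 0 := by
      have := (lintegral_eq_zero_iff (by fun_prop)).1 hP0
      filter_upwards [this] with y hy
      simpa using hy
    have h2 : ∀ ξ, gHat F h ξ = 0 := fun ξ => by
      rw [gHat]
      exact integral_eq_zero_of_ae (by filter_upwards [h1] with y hy; simp [hy])
    simp [h2]
  set N : ℝ := P.toReal ^ (1 / 6 : ℝ) with hN
  have hN0 : 0 < N := Real.rpow_pos_of_pos (ENNReal.toReal_pos hP0 hPt) _
  have hN6 : ENNReal.ofReal (N ^ 6) = P := by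
    rw [hN, ← Real.rpow_natCast, ← Real.rpow_mul ENNReal.toReal_nonneg]
    norm_num [ENNReal.ofReal_toReal hPt]
  set g : ℝ → Eucl n → ℂ := fun t y => ec (t * ϱ) * h y with hg
  have hgf : BddSuppFamily g := by
    obtain ⟨B, hB⟩ := hh.bdd
    obtain ⟨R, hR⟩ := hh.supp
    refine ⟨?_, ⟨B, fun t y => by simpa [hg] using hB y⟩, R, fun t y hy => by simp [hg, hR y hy]⟩
    simp only [hg, Function.uncurry_def]; fun_prop
  have key := hC F hF hF' ϱ hϱ0 1 (Or.inl rfl) g hgf (fun _ => N) measurable_const (fun _ => hN0.le)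
    (fun t _ => by rw [hN6]; simp [hg, enorm_mul, enorm_ec, hP]) N hN0 (by simp)
  have hw : ∀ ξ, waveSum 1 F g ξ =
      (∫ t in Set.Icc (0 : ℝ) 1, ec (t * (ϱ - ‖ξ‖))) * gHat F h ξ := fun ξ => by
    rw [waveSum, ← integral_mul_const]
    congr 1; ext t
    have : gHat F (g t) ξ = ec (t * ϱ) * gHat F h ξ := by
      rw [gHat, gHat, ← integral_const_mul]
      congr 1; ext y
      rw [hg]; ring
    rw [this, ← mul_assoc, ← ec_add]
    congr 2; ring
  have hlow : ∀ ξ ∈ {ξ : Eucl (n + 1) | ϱ ≤ ‖ξ‖ ∧ ‖ξ‖ ≤ ϱ + 1 / 8},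
      ‖gHat F h ξ‖ₑ ^ 2 ≤ 4 * (ENNReal.ofReal (annulusCutoff (ϱ⁻¹ • ξ)) *
        ‖waveSum 1 F g ξ‖ₑ ^ 2) := fun ξ hξ => by
    rw [annulusCutoff_eq_one, ENNReal.ofReal_one, one_mul, hw, enorm_mul, mul_pow, ← mul_assoc]
    · refine le_mul_of_one_le_left' ?_
      -- The phase is at most `2π/8 ≤ 1` in modulus, so its cosine is at least `1 - 1/2`.
      have h1 : (1 / 2 : ℝ) ≤ ‖∫ t in Set.Icc (0 : ℝ) 1, ec (t * (ϱ - ‖ξ‖))‖ := by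
        refine le_trans ?_ (Complex.re_le_norm _)
        have hi : IntegrableOn (fun t : ℝ => ec (t * (ϱ - ‖ξ‖))) (Set.Icc 0 1) :=
          (Continuous.continuousOn (by have := continuous_ec; fun_prop)).integrableOn_compact
            isCompact_Icc
        have hre : (∫ t in Set.Icc (0 : ℝ) 1, ec (t * (ϱ - ‖ξ‖))).re =
            ∫ t in Set.Icc (0 : ℝ) 1, (ec (t * (ϱ - ‖ξ‖))).re :=
          (integral_re hi).symm
        rw [hre]
        calc (1 / 2 : ℝ) = ∫ _ in Set.Icc (0 : ℝ) 1, (1 / 2 : ℝ) := by simp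
          _ ≤ _ := by
            refine setIntegral_mono_on (by simp) hi.re measurableSet_Icc fun t ht => ?_
            have hec : (ec (t * (ϱ - ‖ξ‖))).re = Real.cos (2 * Real.pi * (t * (ϱ - ‖ξ‖))) := by
              rw [ec, ← Complex.exp_ofReal_mul_I_re]
            rw [hec]
            refine le_trans ?_ Real.one_sub_sq_div_two_le_cos
            have h2 : |2 * Real.pi * (t * (ϱ - ‖ξ‖))| ≤ 1 := by
              rw [abs_mul, abs_of_pos Real.two_pi_pos, abs_mul, abs_of_nonneg ht.1]
              have h3 : |ϱ - ‖ξ‖| ≤ 1 / 8 := by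
                rw [abs_le]; constructor <;> linarith [hξ.1, hξ.2]
              have h4 : t * |ϱ - ‖ξ‖| ≤ 1 * (1 / 8) := by
                have := ht.2; gcongr
              nlinarith [Real.pi_lt_four, Real.pi_pos]
            nlinarith [sq_abs (2 * Real.pi * (t * (ϱ - ‖ξ‖))), abs_nonneg (2 * Real.pi * (t * (ϱ - ‖ξ‖)))]
      calc (1 : ℝ≥0∞) = 4 * ENNReal.ofReal (1 / 2) ^ 2 := by
            rw [← ENNReal.ofReal_pow (by norm_num), show (4 : ℝ≥0∞) = ENNReal.ofReal 4 by simp,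
              ← ENNReal.ofReal_mul (by norm_num)]
            norm_num
        _ ≤ _ := by
            rw [← ofReal_norm (∫ t in Set.Icc (0 : ℝ) 1, ec (t * (ϱ - ‖ξ‖)))]
            gcongr
    · rw [norm_smul, Real.norm_eq_abs, abs_of_pos (inv_pos.2 hϱ0), le_inv_mul_iff₀ hϱ0]
      linarith [hξ.1]
    · rw [norm_smul, Real.norm_eq_abs, abs_of_pos (inv_pos.2 hϱ0), inv_mul_le_iff₀ hϱ0]
      linarith [hξ.2]
  have hm : MeasurableSet {ξ : Eucl (n + 1) | ϱ ≤ ‖ξ‖ ∧ ‖ξ‖ ≤ ϱ + 1 / 8} :=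
    measurableSet_Icc.preimage (f := fun x : Eucl (n + 1) => ‖x‖) (by fun_prop)
  calc _ ≤ _ := setLIntegral_mono' hm hlow
    _ ≤ _ := setLIntegral_le_lintegral _ _
    _ = _ := lintegral_const_mul' _ _ (by norm_num)
    _ ≤ _ := mul_le_mul_right key _
    _ = _ := by
        rw [ENNReal.ofReal_mul (Real.sqrt_nonneg _), hN6]
        push_cast; ring

/-! ### Restriction to spheres of Fourier transforms of measures on a graph -/

theorem norm_graphPoint_sub_le {n : ℕ} {F : Eucl n → ℝ}
    (hF : ∀ x y, |F x - F y| ≤ 1 / 20 * ‖x - y‖) (x y : Eucl n) :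
    ‖graphPoint F x - graphPoint F y‖ ≤ 2 * ‖x - y‖ := by
  refine (norm_le_hor_add_ver _).trans ?_
  simp only [hor_sub, ver_sub, graphPoint_eq_join, hor_join, ver_join]
  linarith [hF x y, norm_nonneg (x - y)]

theorem BddSupp.coord_mul {n : ℕ} {F : Eucl n → ℝ} (hFm : Measurable F)
    (hF : ∀ x y, |F x - F y| ≤ 1 / 20 * ‖x - y‖) {h : Eucl n → ℂ} (hh : BddSupp h)
    (h1 : ∀ y, h y ≠ 0 → ‖y‖ ≤ 1) (i : Fin (n + 1)) :
    BddSupp fun y => (((graphPoint F y - graphPoint F 0) i : ℝ) : ℂ) * h y := by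
  have hg := measurable_graphPoint hFm
  refine hh.mul (b := 2) (by fun_prop) fun y hy => ?_
  rw [Complex.norm_real]
  refine (PiLp.norm_apply_le _ i).trans ((norm_graphPoint_sub_le hF y 0).trans ?_)
  rw [sub_zero]; linarith [h1 y hy]

theorem lintegral_coord_mul_sq_le {n : ℕ} {F : Eucl n → ℝ}
    (hF : ∀ x y, |F x - F y| ≤ 1 / 20 * ‖x - y‖) {h : Eucl n → ℂ}
    (h1 : ∀ y, h y ≠ 0 → ‖y‖ ≤ 1) (i : Fin (n + 1)) :
    ∫⁻ y, ‖(((graphPoint F y - graphPoint F 0) i : ℝ) : ℂ) * h y‖ₑ ^ 2 ≤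
      4 * ∫⁻ y, ‖h y‖ₑ ^ 2 := by
  rw [← lintegral_const_mul' _ _ (by norm_num)]
  refine lintegral_mono fun y => ?_
  by_cases hy : h y = 0
  · simp [hy]
  · rw [enorm_mul, mul_pow]
    refine mul_le_mul_left ?_ _
    have h2 : ‖(((graphPoint F y - graphPoint F 0) i : ℝ) : ℂ)‖ ≤ 2 := by
      rw [Complex.norm_real]
      refine (PiLp.norm_apply_le _ i).trans ((norm_graphPoint_sub_le hF y 0).trans ?_)
      rw [sub_zero]; linarith [h1 y hy]
    calc _ ≤ ENNReal.ofReal 2 ^ 2 := by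
          rw [← ofReal_norm]; gcongr
      _ = 4 := by norm_num

theorem hasDerivAt_integral_ec_mul {α : Type*} [MeasurableSpace α] {μ : Measure α} {p : α → ℝ}
    (hp : Measurable p) {h : α → ℂ} (hh : Integrable h μ) (hph : Integrable (fun y => (p y : ℂ) * h y) μ)
    (s : ℝ) :
    HasDerivAt (fun s : ℝ => ∫ y, ec (-(s * p y)) * h y ∂μ)
      (-(2 * Real.pi * Complex.I) * ∫ y, ec (-(s * p y)) * (p y * h y) ∂μ) s := by
  have hm : ∀ s : ℝ, Measurable fun y => ec (-(s * p y)) := fun s => by fun_prop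
  have key := hasDerivAt_integral_of_dominated_loc_of_deriv_le (μ := μ) (s := Set.univ) (x₀ := s)
    (F := fun s y => ec (-(s * p y)) * h y)
    (F' := fun s y => -(2 * Real.pi * Complex.I) * (ec (-(s * p y)) * (p y * h y)))
    (bound := fun y => 2 * Real.pi * ‖(p y : ℂ) * h y‖) Filter.univ_mem
    (Filter.Eventually.of_forall fun s => (hm s).aestronglyMeasurable.mul hh.1)
    (hh.bdd_mul (c := 1) (hm s).aestronglyMeasurable (Filter.Eventually.of_forall fun y => by simp))
    (((hm s).aestronglyMeasurable.mul hph.1).const_mul _)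
    (Filter.Eventually.of_forall fun y s _ => by
      rw [norm_mul, norm_mul, norm_ec, one_mul, norm_neg]
      simp [abs_of_pos Real.pi_pos])
    (hph.norm.const_mul _)
    (Filter.Eventually.of_forall fun y s _ => by
      have h1 : HasDerivAt (fun s : ℝ => -(s * p y)) (-(1 * p y)) s :=
        ((hasDerivAt_id s).mul_const (p y)).neg
      have h2 := ((hasDerivAt_ec (-(s * p y))).scomp s h1).mul_const (h y)
      refine h2.congr_deriv ?_
      rw [Complex.real_smul]
      push_cast; ring)
  rw [← integral_const_mul]
  exact key.2

/-- Along a ray, up to a unimodular factor from recentring at `graphPoint F 0`, differentiation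
multiplies the density by a component of `graphPoint F y - graphPoint F 0`. Recentring is essential,
as `F 0` is not controlled whereas differences over the unit ball are. Expanding in coordinates
gives densities independent of the direction `ω`, and Cauchy–Schwarz over coordinates costs `n + 1`.
-/
theorem enorm_gHat_ray_sq_le {n : ℕ} {F : Eucl n → ℝ} (hFm : Measurable F)
    (hF : ∀ x y, |F x - F y| ≤ 1 / 20 * ‖x - y‖) {h : Eucl n → ℂ} (hh : BddSupp h)
    (h1 : ∀ y, h y ≠ 0 → ‖y‖ ≤ 1) {ω : Eucl (n + 1)} (hω : ‖ω‖ = 1) (ϱ : ℝ) :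
    ‖gHat F h (ϱ • ω)‖ₑ ^ 2 ≤ ∫⁻ s in Set.Icc ϱ (ϱ + 1 / 8), (16 * ‖gHat F h (s • ω)‖ₑ ^ 2 +
      ENNReal.ofReal ((2 * Real.pi) ^ 2 * (n + 1)) * ∑ i, ‖gHat F (fun y =>
        (((graphPoint F y - graphPoint F 0) i : ℝ) : ℂ) * h y) (s • ω)‖ₑ ^ 2) := by
  have hgp := measurable_graphPoint hFm
  set q : Fin (n + 1) → Eucl n → ℝ := fun i y => (graphPoint F y - graphPoint F 0) i with hq
  have hqh : ∀ i, BddSupp fun y => (q i y : ℂ) * h y := fun i => hh.coord_mul hFm hF h1 i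
  set p : Eucl n → ℝ := fun y => inner ℝ (graphPoint F y - graphPoint F 0) ω with hp
  have hpq : ∀ y, p y = ∑ i, ω i * q i y := fun y => by
    simp only [hp, hq, PiLp.inner_apply, RCLike.inner_apply, conj_trivial]
  have hpm : Measurable p := by fun_prop
  have hray : ∀ (k : Eucl n → ℂ) (s : ℝ), ∫ y, ec (-(s * p y)) * k y =
      ec (s * inner ℝ (graphPoint F 0) ω) * gHat F k (s • ω) := fun k s => by
    rw [gHat, ← integral_const_mul]
    congr 1; ext y
    rw [← mul_assoc, ← ec_add, inner_smul_right, hp]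
    simp only [inner_sub_left]
    congr 2; ring
  have hph : Integrable fun y => (p y : ℂ) * h y := by
    have : (fun y => (p y : ℂ) * h y) = fun y => ∑ i, (ω i : ℂ) * ((q i y : ℂ) * h y) := by
      ext y
      rw [hpq, Complex.ofReal_sum, Finset.sum_mul]
      exact Finset.sum_congr rfl fun i _ => by push_cast; ring
    rw [this]
    exact integrable_finsetSum _ fun i _ => (hqh i).integrable.const_mul _
  have hsum : ∀ s : ℝ, ∫ y, ec (-(s * p y)) * (p y * h y) =
      ∑ i, (ω i : ℂ) * ∫ y, ec (-(s * p y)) * (q i y * h y) := fun s => by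
    simp_rw [← integral_const_mul]
    rw [← integral_finsetSum]
    · congr 1; ext y
      rw [hpq, Complex.ofReal_sum, Finset.sum_mul, Finset.mul_sum]
      exact Finset.sum_congr rfl fun i _ => by push_cast; ring
    · exact fun i _ => (((hqh i).integrable).bdd_mul (c := 1)
        (by fun_prop : Measurable fun y => ec (-(s * p y))).aestronglyMeasurable
        (Filter.Eventually.of_forall fun y => by simp)).const_mul _
  have hder := hasDerivAt_integral_ec_mul hpm hh.integrable hph
  have hcont : Continuous fun s : ℝ => -(2 * Real.pi * Complex.I) *
      ∫ y, ec (-(s * p y)) * (p y * h y) :=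
    continuous_const.mul (continuous_integral_ec_mul hph (θ := fun y s => -(s * p y))
      (fun s => by fun_prop) fun y => by fun_prop)
  have key := enorm_sq_le_of_hasDerivAt hder hcont ϱ
  have hb : ∀ (k : Eucl n → ℂ) (s : ℝ), ‖∫ y, ec (-(s * p y)) * k y‖ₑ = ‖gHat F k (s • ω)‖ₑ :=
    fun k s => by rw [hray, enorm_mul, enorm_ec, one_mul]
  have hb' : ∀ (k : Eucl n → ℂ) (s : ℝ), ‖∫ y, ec (-(s * p y)) * k y‖ = ‖gHat F k (s • ω)‖ :=
    fun k s => by rw [hray, norm_mul, norm_ec, one_mul]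
  have hm : Measurable fun s : ℝ => ‖gHat F h (s • ω)‖ₑ ^ 2 :=
    ((continuous_gHat hFm hh.integrable).comp
      (continuous_id.smul continuous_const)).measurable.enorm.pow_const 2
  rw [lintegral_add_left (hm.const_mul _), lintegral_const_mul _ hm]
  simp only [hb] at key
  refine key.trans (add_le_add le_rfl (lintegral_mono fun s => ?_))
  have hreal : ‖-(2 * Real.pi * Complex.I) * ∫ y, ec (-(s * p y)) * (p y * h y)‖ ^ 2 ≤
      (2 * Real.pi) ^ 2 * (n + 1) * ∑ i, ‖gHat F (fun y => (q i y : ℂ) * h y) (s • ω)‖ ^ 2 := by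
    have e : ‖-(2 * Real.pi * Complex.I)‖ = 2 * Real.pi := by
      rw [norm_neg]; simp [abs_of_pos Real.pi_pos]
    rw [norm_mul, e, mul_pow, mul_assoc]
    refine mul_le_mul_of_nonneg_left ?_ (by positivity)
    have h2 : ‖∫ y, ec (-(s * p y)) * (p y * h y)‖ ≤
        ∑ i, ‖gHat F (fun y => (q i y : ℂ) * h y) (s • ω)‖ := by
      rw [hsum]
      refine (norm_sum_le _ _).trans (Finset.sum_le_sum fun i _ => ?_)
      rw [norm_mul, hb', Complex.norm_real]
      exact mul_le_of_le_one_left (norm_nonneg _) ((PiLp.norm_apply_le ω i).trans hω.le)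
    refine (pow_le_pow_left₀ (norm_nonneg _) h2 2).trans ?_
    have h3 := sq_sum_le_card_mul_sum_sq (s := (Finset.univ : Finset (Fin (n + 1))))
      (f := fun i => ‖gHat F (fun y => (q i y : ℂ) * h y) (s • ω)‖)
    simpa using h3
  have h4 := ENNReal.ofReal_le_ofReal hreal
  rw [ENNReal.ofReal_mul (by positivity), ENNReal.ofReal_sum_of_nonneg (fun i _ => by positivity),
    ENNReal.ofReal_pow (norm_nonneg _), ofReal_norm] at h4
  simp_rw [ENNReal.ofReal_pow (norm_nonneg _), ofReal_norm] at h4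
  exact h4

theorem lintegral_sphereMeasure {n : ℕ} (r : ℝ) {Φ : Eucl (n + 1) → ℝ≥0∞} (hΦ : Measurable Φ) :
    ∫⁻ ξ, Φ ξ ∂(sphereMeasure (n + 1) r) = ENNReal.ofReal (r ^ n) *
      ∫⁻ ω : Metric.sphere (0 : Eucl (n + 1)) 1, Φ (r • (ω : Eucl (n + 1)))
        ∂((volume : Measure (Eucl (n + 1))).toSphere) := by
  rw [sphereMeasure, lintegral_smul_measure, lintegral_map hΦ (by fun_prop), Nat.add_sub_cancel,
    smul_eq_mul]

/-- The values on the sphere are controlled along rays by the transforms of `h` and of its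
coordinate multiples; in polar coordinates these become shell integrals, bounded by
`exists_lintegral_shell_gHat_le`. The coordinates are at most `2` on the support of `h`, whence the
factor `4`. -/
theorem exists_lintegral_sphere_gHat_le (n : ℕ) (M : ℝ≥0) :
    ∃ C : ℝ≥0, ∀ F : Eucl n → ℝ, IsC11With n M F → (∀ x, ‖fderiv ℝ F x‖ ≤ 1 / 20) →
      ∀ r : ℝ, 1 ≤ r → ∀ h : Eucl n → ℂ, BddSupp h → (∀ y, h y ≠ 0 → ‖y‖ ≤ 1) →
        ∫⁻ ξ, ‖gHat F h ((2 * Real.pi)⁻¹ • ξ)‖ₑ ^ 2 ∂(sphereMeasure (n + 1) r) ≤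
          C * ENNReal.ofReal √r * ∫⁻ y, ‖h y‖ₑ ^ 2 := by
  obtain ⟨C, hC⟩ := exists_lintegral_shell_gHat_le n M
  set D : ℝ≥0∞ := ENNReal.ofReal ((2 * Real.pi) ^ n) *
    (16 * C + ENNReal.ofReal ((2 * Real.pi) ^ 2 * (n + 1)) * ((n + 1) * (C * 4))) with hD
  have hDt : D ≠ ∞ := by
    rw [hD]; finiteness
  refine ⟨D.toNNReal, fun F hF hF' r hr h hh h1 => ?_⟩
  rw [ENNReal.coe_toNNReal hDt]
  have hπ := Real.pi_pos
  have hr0 : 0 < r := by linarith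
  have hFm := hF.contDiff.continuous.measurable
  have hlip : ∀ x y, |F x - F y| ≤ 1 / 20 * ‖x - y‖ := by
    simpa using (hF.isFlatGraph hF' one_pos).lip
  set ϱ := r / (2 * Real.pi) with hϱ
  have hϱ0 : 0 < ϱ := by positivity
  have hϱ8 : 1 / 8 ≤ ϱ := by
    rw [hϱ, div_le_div_iff₀ (by norm_num) (by positivity)]
    nlinarith [Real.pi_lt_four]
  have hϱr : ϱ ≤ r := div_le_self hr0.le (by nlinarith [Real.pi_gt_three])
  set k : Fin (n + 1) → Eucl n → ℂ := fun i y =>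
    (((graphPoint F y - graphPoint F 0) i : ℝ) : ℂ) * h y with hk
  have hkb : ∀ i, BddSupp (k i) := fun i => hh.coord_mul hFm hlip h1 i
  have hm : ∀ g, BddSupp g → Measurable fun ζ => ‖gHat F g ζ‖ₑ ^ 2 := fun g hg =>
    (continuous_gHat hFm hg.integrable).measurable.enorm.pow_const 2
  have hm0 := hm h hh
  have hmk := fun i => hm (k i) (hkb i)
  set A := ENNReal.ofReal ((2 * Real.pi) ^ 2 * (n + 1)) with hA
  set Φ : Eucl (n + 1) → ℝ≥0∞ := fun ζ =>
    16 * ‖gHat F h ζ‖ₑ ^ 2 + A * ∑ i, ‖gHat F (k i) ζ‖ₑ ^ 2 with hΦ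
  have hsm : Measurable fun ζ => ∑ i, ‖gHat F (k i) ζ‖ₑ ^ 2 :=
    Finset.measurable_fun_sum _ fun i _ => hmk i
  have hΦm : Measurable Φ := (hm0.const_mul _).add (hsm.const_mul _)
  set P := ∫⁻ y, ‖h y‖ₑ ^ 2 with hP
  have hshell : ∫⁻ ζ in {ζ | ϱ ≤ ‖ζ‖ ∧ ‖ζ‖ ≤ ϱ + 1 / 8}, Φ ζ ≤
      (16 * C + A * ((n + 1) * (C * 4))) * (ENNReal.ofReal √r * P) := by
    have hs : ENNReal.ofReal √ϱ ≤ ENNReal.ofReal √r :=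
      ENNReal.ofReal_le_ofReal (Real.sqrt_le_sqrt hϱr)
    rw [hΦ, lintegral_add_left (hm0.const_mul _), lintegral_const_mul _ hm0,
      lintegral_const_mul _ hsm, lintegral_finsetSum _ fun i _ => hmk i]
    have h2 := (hC F hF hF' ϱ hϱ8 h hh)
    have h3 : ∀ i, ∫⁻ ζ in {ζ | ϱ ≤ ‖ζ‖ ∧ ‖ζ‖ ≤ ϱ + 1 / 8}, ‖gHat F (k i) ζ‖ₑ ^ 2 ≤
        C * ENNReal.ofReal √r * (4 * P) := fun i => by
      refine (hC F hF hF' ϱ hϱ8 (k i) (hkb i)).trans ?_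
      exact mul_le_mul' (mul_le_mul_right hs _) (lintegral_coord_mul_sq_le hlip h1 i)
    calc _ ≤ 16 * (C * ENNReal.ofReal √r * P) +
          A * ∑ _i : Fin (n + 1), C * ENNReal.ofReal √r * (4 * P) := by
          refine add_le_add (mul_le_mul_right (h2.trans ?_) _)
            (mul_le_mul_right (Finset.sum_le_sum fun i _ => h3 i) _)
          gcongr
      _ = _ := by
          rw [Finset.sum_const, Finset.card_univ, Fintype.card_fin, nsmul_eq_mul]
          push_cast; ring
  have hmr : Measurable fun ξ : Eucl (n + 1) => ‖gHat F h ((2 * Real.pi)⁻¹ • ξ)‖ₑ ^ 2 :=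
    hm0.comp (measurable_const_smul _)
  rw [lintegral_sphereMeasure r hmr]
  -- The sphere has angular radius `r`, while the shell estimate uses `ϱ = r/(2π)`; surface measure
  -- contributes the factor `(2π)^n`.
  have hrϱ : r ^ n = (2 * Real.pi) ^ n * ϱ ^ n := by
    rw [← mul_pow, hϱ]; congr 1; field_simp
  calc _ = ENNReal.ofReal ((2 * Real.pi) ^ n) * (ENNReal.ofReal (ϱ ^ n) *
        ∫⁻ ω : Metric.sphere (0 : Eucl (n + 1)) 1, ‖gHat F h (ϱ • (ω : Eucl (n + 1)))‖ₑ ^ 2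
          ∂((volume : Measure (Eucl (n + 1))).toSphere)) := by
        rw [hrϱ, ENNReal.ofReal_mul (by positivity), mul_assoc]
        simp_rw [smul_smul]
        rw [show (2 * Real.pi)⁻¹ * r = ϱ by rw [hϱ]; field_simp]
    _ ≤ ENNReal.ofReal ((2 * Real.pi) ^ n) * (ENNReal.ofReal (ϱ ^ n) *
        ∫⁻ ω : Metric.sphere (0 : Eucl (n + 1)) 1,
          (∫⁻ s in Set.Icc ϱ (ϱ + 1 / 8), Φ (s • (ω : Eucl (n + 1))))
          ∂((volume : Measure (Eucl (n + 1))).toSphere)) := by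
        gcongr with ω
        exact enorm_gHat_ray_sq_le hFm hlip hh h1 (mem_sphere_zero_iff_norm.1 ω.2) ϱ
    _ ≤ ENNReal.ofReal ((2 * Real.pi) ^ n) *
        ∫⁻ ζ in {ζ | ϱ ≤ ‖ζ‖ ∧ ‖ζ‖ ≤ ϱ + 1 / 8}, Φ ζ :=
        mul_le_mul_right (lintegral_toSphere_shell_le hΦm hϱ0) _
    _ ≤ ENNReal.ofReal ((2 * Real.pi) ^ n) * _ := mul_le_mul_right hshell _
    _ = _ := by rw [hD]; ring

/-! ### The extension operator and the eigenfunction estimate -/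

instance isFiniteMeasure_sphereMeasure (d : ℕ) (r : ℝ) : IsFiniteMeasure (sphereMeasure d r) :=
  ⟨by
    rw [sphereMeasure, Measure.smul_apply, smul_eq_mul]
    exact ENNReal.mul_lt_top ENNReal.ofReal_lt_top (measure_lt_top _ _)⟩

theorem exp_I_mul_eq_ec (s : ℝ) : Complex.exp (Complex.I * (s : ℂ)) = ec ((2 * Real.pi)⁻¹ * s) := by
  have := Real.pi_ne_zero
  rw [ec]
  congr 1
  push_cast
  field_simp

/-- The adjoint of the extension operator is the Fourier transform of a measure on the graph
restricted to the sphere. With `Q` the left side, `P` the squared norm of `g` and `b` a bound for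
the weight, duality gives `Q² ≤ P · C√r · bQ`, and the finite `Q` cancels. -/
theorem exists_sphereExtension_sq_le (n : ℕ) (M : ℝ≥0) {w : Eucl n → ℝ} (hwc : Continuous w)
    (hw0 : ∀ y, 0 ≤ w y) (hw1 : ∀ y, w y ≠ 0 → ‖y‖ ≤ 1) :
    ∃ C : ℝ≥0, ∀ F : Eucl n → ℝ, IsC11With n M F → (∀ x, ‖fderiv ℝ F x‖ ≤ 1 / 20) →
      ∀ r : ℝ, 1 ≤ r → ∀ g : Eucl (n + 1) → ℂ, Measurable g →
        MemLp g 2 (sphereMeasure (n + 1) r) →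
        ∫⁻ y, ENNReal.ofReal (w y) * ‖sphereExtension r g (graphPoint F y)‖ₑ ^ 2 ≤
          C * ENNReal.ofReal √r * eLpNorm g 2 (sphereMeasure (n + 1) r) ^ 2 := by
  obtain ⟨C, hC⟩ := exists_lintegral_sphere_gHat_le n M
  obtain ⟨B, hB⟩ := (isCompact_closedBall (0 : Eucl n) 1).exists_bound_of_continuousOn
    hwc.continuousOn
  have hwB : ∀ y, w y ≤ |B| := fun y => by
    by_cases hy : w y = 0
    · rw [hy]; exact abs_nonneg _
    · exact (le_abs_self _).trans ((hB y (by simpa using hw1 y hy)).trans (le_abs_self _))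
  set b : ℝ≥0 := ⟨|B|, abs_nonneg B⟩ with hb
  refine ⟨C * b, fun F hF hF' r hr g hgm hg => ?_⟩
  set μ := sphereMeasure (n + 1) r with hμ
  have hFm := hF.contDiff.continuous.measurable
  have hgp := measurable_graphPoint hFm
  have hwm := hwc.measurable
  have hgi : Integrable g μ := hg.integrable one_le_two
  have hwi : Integrable w := hwc.integrable_of_hasCompactSupport
    (HasCompactSupport.of_support_subset_isCompact (isCompact_closedBall (0 : Eucl n) 1)
      fun y hy => by simpa using hw1 y hy)
  set k : Eucl n → Eucl (n + 1) → ℂ := fun y ξ =>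
    ec ((2 * Real.pi)⁻¹ * inner ℝ (graphPoint F y) ξ) with hk
  have hkm : Measurable (Function.uncurry k) := by
    simp only [hk, Function.uncurry_def]; fun_prop
  have hk1 : ∀ y ξ, ‖k y ξ‖ ≤ 1 := fun y ξ => by simp [hk]
  have hT : ∀ y, sphereExtension r g (graphPoint F y) = ∫ ξ, k y ξ * g ξ ∂μ := fun y => by
    simp only [sphereExtension, exp_I_mul_eq_ec, hk, hμ]
  simp_rw [hT]
  set U : Eucl n → ℂ := fun y => ∫ ξ, k y ξ * g ξ ∂μ with hU
  have hUm : Measurable U := measurable_integral_kernel_mul hkm hgm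
  have hUb : ∀ y, ‖U y‖ ≤ ∫ ξ, ‖g ξ‖ ∂μ := fun y => norm_integral_mul_le (hk1 y) hgi
  set h : Eucl n → ℂ := fun y => (w y : ℂ) * U y with hh
  have hh1 : ∀ y, h y ≠ 0 → ‖y‖ ≤ 1 := fun y hy => hw1 y fun h0 => hy (by simp [hh, h0])
  have hhb : BddSupp h := by
    refine ⟨by fun_prop, ⟨|B| * ∫ ξ, ‖g ξ‖ ∂μ, fun y => ?_⟩, 1, fun y hy => ?_⟩
    · rw [hh]
      simp only [norm_mul, Complex.norm_real, Real.norm_eq_abs]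
      rw [abs_of_nonneg (hw0 y)]
      exact mul_le_mul (hwB y) (hUb y) (norm_nonneg _) (abs_nonneg _)
    · by_contra h0
      exact absurd (hh1 y h0) (not_le.2 hy)
  have hV : ∀ ξ, ∫ y, (starRingEnd ℂ) (k y ξ) * (w y * U y) =
      gHat F h ((2 * Real.pi)⁻¹ • ξ) := fun ξ => by
    rw [gHat]
    congr 1; ext y
    simp only [hk, conj_ec, inner_smul_right, hh]
  have hdual := sq_lintegral_weight_mul_sq_le (μ := (volume : Measure (Eucl n))) (ν := μ) hkm hk1
    hgm hgi hwm hw0 hwi MeasurableSet.univ fun _ _ => Set.mem_univ _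
  rw [Measure.restrict_univ] at hdual
  change (∫⁻ y, ENNReal.ofReal (w y) * ‖U y‖ₑ ^ 2) ^ 2 ≤ (∫⁻ ξ, ‖g ξ‖ₑ ^ 2 ∂μ) *
    ∫⁻ ξ, ‖∫ y, (starRingEnd ℂ) (k y ξ) * (w y * U y)‖ₑ ^ 2 ∂μ at hdual
  simp_rw [hV] at hdual
  have hr2 := hC F hF hF' r hr h hhb hh1
  set Q := ∫⁻ y, ENNReal.ofReal (w y) * ‖U y‖ₑ ^ 2 with hQ
  have hhQ : ∫⁻ y, ‖h y‖ₑ ^ 2 ≤ b * Q := by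
    rw [hQ, ← lintegral_const_mul' _ _ ENNReal.coe_ne_top]
    refine lintegral_mono fun y => ?_
    simp only [hh]
    have e : ‖(w y : ℂ)‖ₑ = ENNReal.ofReal (w y) := by
      rw [← ofReal_norm, Complex.norm_real, Real.norm_eq_abs, abs_of_nonneg (hw0 y)]
    rw [enorm_mul, mul_pow, e, sq (ENNReal.ofReal (w y)), mul_assoc]
    refine mul_le_mul_left ?_ _
    rw [← ENNReal.ofReal_coe_nnreal]
    exact ENNReal.ofReal_le_ofReal (hwB y)
  -- Finiteness, required for the cancellation: `U` is bounded because `g` is integrable on the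
  -- finite sphere measure, and `w` is integrable.
  have hQt : Q ≠ ∞ := by
    have h1 : ∀ y, ENNReal.ofReal (w y) * ‖U y‖ₑ ^ 2 ≤
        ENNReal.ofReal (w y) * ENNReal.ofReal (∫ ξ, ‖g ξ‖ ∂μ) ^ 2 := fun y => by
      refine mul_le_mul_right (pow_le_pow_left' ?_ 2) _
      rw [← ofReal_norm]; exact ENNReal.ofReal_le_ofReal (hUb y)
    refine ((lintegral_mono h1).trans_lt ?_).ne
    rw [lintegral_mul_const' _ _ (by finiteness)]
    exact ENNReal.mul_lt_top hwi.lintegral_lt_top (by finiteness)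
  rw [eLpNorm_two_sq]
  set P := ∫⁻ ξ, ‖g ξ‖ₑ ^ 2 ∂μ
  by_cases hQ0 : Q = 0
  · rw [hQ0]; exact zero_le
  have h3 : Q * Q ≤ Q * ((C * b) * ENNReal.ofReal √r * P) :=
    calc Q * Q = Q ^ 2 := (sq Q).symm
      _ ≤ _ := hdual
      _ ≤ P * (C * ENNReal.ofReal √r * (b * Q)) :=
          mul_le_mul_right (hr2.trans (mul_le_mul_right hhQ _)) _
      _ = _ := by ring
  rw [ENNReal.coe_mul]
  exact (ENNReal.mul_le_mul_iff_right hQ0 hQt).1 h3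

theorem exists_sphereExtension_le (n : ℕ) (M : ℝ≥0) (χ : Eucl n → ℝ)
    (hχ : ContDiff ℝ (⊤ : ℕ∞) χ) (hχ1 : Function.support χ ⊆ Metric.closedBall 0 1) :
    ∃ C : ℝ, 0 < C ∧
      ∀ F : Eucl n → ℝ, IsC11With n M F → (∀ x', ‖fderiv ℝ F x'‖ ≤ 1 / 20) →
      ∀ r : ℝ, 1 ≤ r →
      ∀ g : Eucl (n + 1) → ℂ, MemLp g 2 (sphereMeasure (n + 1) r) →
        (∫⁻ x' : Eucl n,
            ‖sphereExtension r g (graphPoint F x')‖ₑ ^ (2 : ℕ) * ‖χ x'‖ₑ) ^ (1 / 2 : ℝ)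
          ≤ ENNReal.ofReal (C * r ^ (1 / 4 : ℝ)) * eLpNorm g 2 (sphereMeasure (n + 1) r) := by
  obtain ⟨C, hC⟩ := exists_sphereExtension_sq_le n M (w := fun y => |χ y|) hχ.continuous.abs
    (fun y => abs_nonneg _) (fun y hy => by
      simpa using hχ1 (show χ y ≠ 0 from fun h => hy (by simp [h])))
  refine ⟨C + 1, by positivity, fun F hF hF' r hr g hg => ?_⟩
  have hr0 : 0 < r := by linarith
  set g' := hg.1.mk g with hg'
  have hgg : g =ᵐ[sphereMeasure (n + 1) r] g' := hg.1.ae_eq_mk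
  have hT : ∀ x, sphereExtension r g x = sphereExtension r g' x := fun x =>
    integral_congr_ae (by filter_upwards [hgg] with ξ hξ; rw [hξ])
  have key := hC F hF hF' r hr g' hg.1.stronglyMeasurable_mk.measurable (hg.ae_eq hgg)
  rw [eLpNorm_congr_ae hgg]
  simp_rw [hT]
  have e1 : ∀ y, ‖sphereExtension r g' (graphPoint F y)‖ₑ ^ 2 * ‖χ y‖ₑ =
      ENNReal.ofReal |χ y| * ‖sphereExtension r g' (graphPoint F y)‖ₑ ^ 2 := fun y => by
    rw [mul_comm, ← Real.norm_eq_abs, ofReal_norm]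
  simp_rw [e1]
  set N := eLpNorm g' 2 (sphereMeasure (n + 1) r)
  have h2 : C * ENNReal.ofReal √r * N ^ 2 ≤
      (ENNReal.ofReal ((C + 1) * r ^ (1 / 4 : ℝ)) * N) ^ 2 := by
    rw [mul_pow]
    refine mul_le_mul_left ?_ _
    rw [← ENNReal.ofReal_coe_nnreal, ← ENNReal.ofReal_mul (by positivity),
      ← ENNReal.ofReal_pow (by positivity)]
    apply ENNReal.ofReal_le_ofReal
    have h3 : (r ^ (1 / 4 : ℝ)) ^ 2 = √r := by
      rw [Real.sqrt_eq_rpow, ← Real.rpow_natCast, ← Real.rpow_mul hr0.le]; norm_num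
    rw [mul_pow, h3]
    have : (0 : ℝ) ≤ C := C.2
    gcongr
    nlinarith
  calc _ ≤ ((ENNReal.ofReal ((C + 1) * r ^ (1 / 4 : ℝ)) * N) ^ 2) ^ (1 / 2 : ℝ) :=
        ENNReal.rpow_le_rpow (key.trans h2) (by norm_num)
    _ = _ := by
        rw [← ENNReal.rpow_natCast, ← ENNReal.rpow_mul]; norm_num

end

/-! ### The two estimates together -/

theorem mainTheorem7 (n : ℕ) (M : ℝ≥0) :
    -- the square function estimate on the graph of `F`; `u t` is the continuous representative
    -- of `cos (t √(-Δ)) f`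
    (∃ C : ℝ, 0 < C ∧
      ∀ F : Eucl n → ℝ, IsC11With n M F → (∀ x', ‖fderiv ℝ F x'‖ ≤ 1 / 20) →
      ∀ r : ℝ, 1 ≤ r →
      ∀ f : L2Eucl (n + 1), HasFrequencyNear r f →
        ∃ u : ℝ → Eucl (n + 1) → ℂ,
          Continuous (Function.uncurry u) ∧
          (∀ t : ℝ, u t =ᵐ[volume] cosSqrtNegLaplacian t f) ∧
          (∫⁻ t in Set.Icc (0 : ℝ) 1,
              (eLpNorm (fun x' : Eucl n => u t (graphPoint F x')) 2 volume) ^ (4 : ℕ))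
              ^ (1 / 4 : ℝ)
            ≤ ENNReal.ofReal (C * r ^ (1 / 4 : ℝ) * ‖f‖)) ∧
    -- the restriction estimate for eigenfunctions of the Laplacian
    (∀ χ : Eucl n → ℝ, ContDiff ℝ (⊤ : ℕ∞) χ → Function.support χ ⊆ Metric.closedBall 0 1 →
      ∃ C : ℝ, 0 < C ∧
        ∀ F : Eucl n → ℝ, IsC11With n M F → (∀ x', ‖fderiv ℝ F x'‖ ≤ 1 / 20) →
        ∀ r : ℝ, 1 ≤ r →
        ∀ g : Eucl (n + 1) → ℂ, MemLp g 2 (sphereMeasure (n + 1) r) →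
          (∫⁻ x' : Eucl n,
              ‖sphereExtension r g (graphPoint F x')‖ₑ ^ (2 : ℕ) * ‖χ x'‖ₑ) ^ (1 / 2 : ℝ)
            ≤ ENNReal.ofReal (C * r ^ (1 / 4 : ℝ)) * eLpNorm g 2 (sphereMeasure (n + 1) r)) :=
  ⟨exists_cosSqrtNegLaplacian_le n M, exists_sphereExtension_le n M⟩
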